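/- Let $0\le l\le n-1$, let $\Omega\subset\subset\mathbb C^n$ be a pseudoconvex domain and let $z^0\in b\Omega$. Suppose that $b\Omega$ is smooth in an open neighborhood $V$ of $z^0$ (locally near each point of $b\Omega\cap V$ there is a smooth real function $r$ with $dr\ne0$ on $b\Omega$, $\Omega=\{r<0\}$ and $b\Omega=\{r=0\}$) and that the Levi form of $b\Omega$ has rank $n-l-1$ at every point of $b\Omega\cap V$. Write $\zeta'=(\zeta_2,\dots,\zeta_{n-l})$ and $\zeta''=(\zeta_{n-l+1},\dots,\zeta_n)$. Then there are an open neighborhood $U\subset\subset V$ of $z^0$, positive numbers $\lambda_j=\lambda_j(p)$ $(2\le j\le n-l)$ depending smoothly on $p\in b\Omega\cap U$, and, for each $p\in b\Omega\cap U$, a biholomorphic map $\Phi_p$ from $U$ onto an open subset of the unit ball $B(0,1)$, with $\Phi_p(p)=0$ and $\Phi_p$ depending smoothly on $p$, together with a smooth function $\rho=\rho_p$ on $\Phi_p(U)$ such that $\Phi_p(\Omega\cap U)=\{\rho<0\}$, $\Phi_p(b\Omega\cap U)=\{\rho=0\}$, $d\rho\neq0$ on $\Phi_p(b\Omega\cap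 U)$ and $$\rho(\zeta)=\operatorname{Re}\zeta_1+\sum_{j=2}^{n-l}\lambda_j|\zeta_j|^2+O\bigl(|\zeta'|^2|\zeta''|+|\zeta'|^3+|\operatorname{Im}\zeta_1|\,|\zeta|\bigr)$$ near $0$, uniformly for $p$ in compact subsets of $b\Omega\cap U$, and such that the following holds. Put $\widetilde\Omega_p=\Phi_p(\Omega\cap U)$ and, for $\delta,a>0$, $$P_{\delta,a}=\{\zeta:\ |\zeta_1|<a\delta,\ |\zeta_j|<a\delta^{1/2}\ (2\le j\le n-l),\ |\zeta_j|<a\ (n-l+1\le j\le n)\}.$$ For every open neighborhood $W\subset\subset U$ of $z^0$ there are positive constants $a,b,C,\delta_0$ and constants $C_\alpha$ $(\alpha\in\mathbb N^n)$ such that for all $p\in b\Omega\cap W$ and all $0<\delta<\delta_0$ there is a function $g=g_{p,\delta}\in C^\infty(\overline{\widetilde\Omega_p})$, real-valued and the restriction of a smooth function on $\mathbb C^n$, with 1. $|g|\le1$ on $\widetilde\Omega_p$; 2. $g$ is plurisubharmonic on $\widetilde\Omega_p$; 3. for all $\zeta\in P_{\delta,ab}\cap\widetilde\Omega_p$ and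 $Y\in\mathbb C^n$, $$\sum_{j,k=1}^n\frac{\partial^2g}{\partial\zeta_j\partial\bar\zeta_k}(\zeta)Y_j\overline{Y_k}\ \ge\ \frac1C\Bigl(\frac{|\langle\partial\rho(\zeta),Y\rangle|^2}{\delta^2}+\sum_{j=2}^{n-l}\frac{|Y_j|^2}{\delta}+\sum_{j=n-l+1}^n|Y_j|^2\Bigr),\qquad \langle\partial\rho,Y\rangle=\sum_j\frac{\partial\rho}{\partial\zeta_j}Y_j;$$ 4. for all $\zeta\in P_{\delta,ab}\cap\widetilde\Omega_p$, all $\alpha\in\mathbb N^n$ and all $D^\alpha=D_1^{\alpha_1}\cdots D_n^{\alpha_n}$, where $D_j^{\alpha_j}$ is any mixed partial derivative in $\zeta_j,\bar\zeta_j$ of total order $\alpha_j$, $$|D^\alpha g(\zeta)|\le C_\alpha\,\delta^{-(\alpha_1+\frac12\sum_{j=2}^{n-l}\alpha_j)}.$$ -/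

import Mathlib

open scoped ContDiff

/-- `ℂⁿ` with its Euclidean norm. -/
abbrev CSpace (n : ℕ) : Type := EuclideanSpace ℂ (Fin n)

section Wirtinger

variable {n : ℕ}

/-- `∂f/∂z_j = ½ (∂f/∂x_j - i ∂f/∂y_j)`. -/
noncomputable def dz (j : Fin n) (f : CSpace n → ℂ) (z : CSpace n) : ℂ :=
  (fderiv ℝ f z (EuclideanSpace.single j 1)
    - Complex.I * fderiv ℝ f z (EuclideanSpace.single j Complex.I)) / 2

/-- `∂f/∂z̄_j = ½ (∂f/∂x_j + i ∂f/∂y_j)`. -/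
noncomputable def dzbar (j : Fin n) (f : CSpace n → ℂ) (z : CSpace n) : ℂ :=
  (fderiv ℝ f z (EuclideanSpace.single j 1)
    + Complex.I * fderiv ℝ f z (EuclideanSpace.single j Complex.I)) / 2

/-- The mixed partial derivative `D_1 ⋯ D_n f`, where `D_j` is the derivative of order `β j`
in `z_j` and of order `γ j` in `z̄_j`. -/
noncomputable def mixedDeriv (β γ : Fin n → ℕ) (f : CSpace n → ℂ) : CSpace n → ℂ :=
  (List.ofFn fun j : Fin n => (dz j)^[β j] ∘ (dzbar j)^[γ j]).foldr (fun D h => D h) f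

/-- A real function regarded as a complex-valued one. -/
def toC (r : CSpace n → ℝ) : CSpace n → ℂ := fun z => (r z : ℂ)

/-- `⟨∂r(z), X⟩ = ∑_j ∂r/∂z_j(z) X_j`. -/
noncomputable def delPairing (r : CSpace n → ℝ) (z X : CSpace n) : ℂ :=
  ∑ j, dz j (toC r) z * X j

/-- `L_r(z; X, Y) = ∑_{j,k} ∂²r/∂z_j∂z̄_k(z) X_j Ȳ_k`. -/
noncomputable def leviForm (r : CSpace n → ℝ) (z X Y : CSpace n) : ℂ :=
  ∑ j, ∑ k, dz j (dzbar k (toC r)) z * X j * (starRingEnd ℂ) (Y k)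

/-- The complex tangent space `T^{1,0}_z` of the level set of `r` through `z`. -/
noncomputable def complexTangent (r : CSpace n → ℝ) (z : CSpace n) :
    Submodule ℂ (CSpace n) where
  carrier := {X | delPairing r z X = 0}
  zero_mem' := by simp [delPairing]
  add_mem' := by
    intro X Y hX hY
    simp only [Set.mem_ofPred_eq, delPairing] at *
    simp [mul_add, Finset.sum_add_distrib, hX, hY]
  smul_mem' := by
    intro c X hX
    simp only [Set.mem_ofPred_eq, delPairing] at *
    simp [mul_left_comm, ← Finset.mul_sum, hX]

/-- The Levi nullspace: the `X ∈ T^{1,0}_z` with `L_r(z; X, Y) = 0` for all `Y ∈ T^{1,0}_z`. -/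
noncomputable def leviNullspace (r : CSpace n → ℝ) (z : CSpace n) :
    Submodule ℂ (CSpace n) where
  carrier := {X | X ∈ complexTangent r z ∧ ∀ Y ∈ complexTangent r z, leviForm r z X Y = 0}
  zero_mem' := ⟨Submodule.zero_mem _, by simp [leviForm]⟩
  add_mem' := by
    rintro X X' ⟨hX, hX0⟩ ⟨hX', hX0'⟩
    refine ⟨Submodule.add_mem _ hX hX', fun Y hY => ?_⟩
    have h : leviForm r z (X + X') Y = leviForm r z X Y + leviForm r z X' Y := by
      simp [leviForm, mul_add, add_mul, Finset.sum_add_distrib]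
    rw [h, hX0 Y hY, hX0' Y hY, add_zero]
  smul_mem' := by
    rintro c X ⟨hX, hX0⟩
    refine ⟨Submodule.smul_mem _ c hX, fun Y hY => ?_⟩
    have h : leviForm r z (c • X) Y = c * leviForm r z X Y := by
      simp only [leviForm, Finset.mul_sum, PiLp.smul_apply, smul_eq_mul]
      exact Finset.sum_congr rfl fun j _ => Finset.sum_congr rfl fun k _ => by ring
    rw [h, hX0 Y hY, mul_zero]

/-- The rank (number of non-zero eigenvalues) of the Levi form on `T^{1,0}_z`. -/
noncomputable def leviRank (r : CSpace n → ℝ) (z : CSpace n) : ℕ :=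
  Module.finrank ℂ (complexTangent r z) - Module.finrank ℂ (leviNullspace r z)

end Wirtinger

section Domains

variable {n : ℕ}

/-- Plurisubharmonicity of a finite-valued function: upper semicontinuity and the sub-mean value
inequality on every closed complex disc contained in `D`. (For a finite-valued plurisubharmonic
function the circle means are finite, whence the integrability clause.) -/
def PlurisubharmonicOn (u : CSpace n → ℝ) (D : Set (CSpace n)) : Prop :=
  UpperSemicontinuousOn u D ∧
    ∀ z w : CSpace n, (∀ t : ℂ, ‖t‖ ≤ 1 → z + t • w ∈ D) →
      CircleIntegrable (fun t : ℂ => u (z + t • w)) 0 1 ∧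
        u z ≤ Real.circleAverage (fun t : ℂ => u (z + t • w)) 0 1

/-- Pseudoconvexity: `-log dist(z, bΩ)` is plurisubharmonic on `Ω`. -/
def IsPseudoconvex (Ω : Set (CSpace n)) : Prop :=
  PlurisubharmonicOn (fun z => -Real.log (Metric.infDist z (frontier Ω))) Ω

/-- `r` is a smooth defining function, on the open set `N`, of `Ω` and of its boundary. -/
structure IsDefiningFunction (Ω N : Set (CSpace n)) (r : CSpace n → ℝ) : Prop where
  isOpen : IsOpen N
  smooth : ContDiffOn ℝ ∞ r N
  neg_iff : ∀ z ∈ N, (r z < 0 ↔ z ∈ Ω)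
  zero_iff : ∀ z ∈ N, (r z = 0 ↔ z ∈ frontier Ω)
  fderiv_ne : ∀ z ∈ N, z ∈ frontier Ω → fderiv ℝ r z ≠ 0

/-- The boundary of `Ω` is smooth in `V`. -/
def SmoothBoundaryIn (Ω V : Set (CSpace n)) : Prop :=
  ∀ q ∈ frontier Ω ∩ V, ∃ (N : Set (CSpace n)) (r : CSpace n → ℝ),
    q ∈ N ∧ IsDefiningFunction Ω N r

/-- `R(bΩ, q) = k`. (The rank does not depend on the local defining function.) -/
def HasLeviRank (Ω : Set (CSpace n)) (q : CSpace n) (k : ℕ) : Prop :=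
  ∀ (N : Set (CSpace n)) (r : CSpace n → ℝ),
    q ∈ N → IsDefiningFunction Ω N r → leviRank r q = k

/-- `f` maps the open set `U` biholomorphically onto the open set `f(U)`. -/
def IsBiholomorphicOn (f : CSpace n → CSpace n) (U : Set (CSpace n)) : Prop :=
  DifferentiableOn ℂ f U ∧ IsOpen (f '' U) ∧
    ∃ h : CSpace n → CSpace n, DifferentiableOn ℂ h (f '' U) ∧ Set.LeftInvOn h f U

end Domains

section Blocks

variable {n : ℕ} [NeZero n]

/-- The indices of `ζ' = (ζ_2, …, ζ_{n-l})`; coordinates are numbered from `0` in the code. -/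
def midIdx (n l : ℕ) [NeZero n] : Finset (Fin n) :=
  Finset.univ.filter fun j => j ≠ 0 ∧ j.val + l < n

/-- The indices of `ζ'' = (ζ_{n-l+1}, …, ζ_n)`. -/
def lastIdx (n l : ℕ) : Finset (Fin n) :=
  Finset.univ.filter fun j => n ≤ j.val + l

/-- The Euclidean length of the block of coordinates in `s`. -/
noncomputable def blockNorm (s : Finset (Fin n)) (ζ : CSpace n) : ℝ :=
  Real.sqrt (∑ j ∈ s, ‖ζ j‖ ^ 2)

/-- The polydisc `P_{δ,a}`. -/
def polydisc (l : ℕ) (δ a : ℝ) : Set (CSpace n) :=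
  {ζ | ‖ζ 0‖ < a * δ ∧ (∀ j ∈ midIdx n l, ‖ζ j‖ < a * Real.sqrt δ) ∧
    ∀ j ∈ lastIdx n l, ‖ζ j‖ < a}

/-- `U ⊂⊂ V` is a neighbourhood of `z⁰` and, for `p ∈ bΩ ∩ U`, the maps `Φ p` are holomorphic
coordinates on `U` with values in the unit ball, centred at `p` and depending smoothly on `p`, in
which `ρ p` is a defining function of the image of `bΩ ∩ U` of the form
`Re ζ_1 + ∑ λ_j |ζ_j|² + O(|ζ'|²|ζ''| + |ζ'|³ + |Im ζ_1| |ζ|)` near `0`, locally uniformly in `p`.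

Smoothness in `p` on the hypersurface `bΩ ∩ U` (closed in `U`) is smoothness of an extension to
`U`; the values at `p ∉ bΩ` have no other meaning. -/
structure IsNormalFamily (l : ℕ) (Ω V : Set (CSpace n)) (z₀ : CSpace n) (U : Set (CSpace n))
    (Φ : CSpace n → CSpace n → CSpace n) (lam : CSpace n → Fin n → ℝ)
    (ρ : CSpace n → CSpace n → ℝ) : Prop where
  isOpen : IsOpen U
  mem : z₀ ∈ U
  compact_closure : IsCompact (closure U)
  closure_subset : closure U ⊆ V
  biholo : ∀ p ∈ frontier Ω ∩ U, IsBiholomorphicOn (Φ p) U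
  maps_ball : ∀ p ∈ frontier Ω ∩ U, Set.MapsTo (Φ p) U (Metric.ball 0 1)
  center : ∀ p ∈ frontier Ω ∩ U, Φ p p = 0
  smooth : ContDiffOn ℝ ∞ (fun q : CSpace n × CSpace n => Φ q.1 q.2) (U ×ˢ U)
  lam_pos : ∀ p ∈ frontier Ω ∩ U, ∀ j ∈ midIdx n l, 0 < lam p j
  lam_smooth : ∀ j ∈ midIdx n l, ContDiffOn ℝ ∞ (fun p => lam p j) U
  rho_smooth : ∀ p ∈ frontier Ω ∩ U, ContDiffOn ℝ ∞ (ρ p) (Φ p '' U)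
  rho_neg : ∀ p ∈ frontier Ω ∩ U, ∀ z ∈ U, (ρ p (Φ p z) < 0 ↔ z ∈ Ω)
  rho_zero : ∀ p ∈ frontier Ω ∩ U, ∀ z ∈ U, (ρ p (Φ p z) = 0 ↔ z ∈ frontier Ω)
  rho_fderiv : ∀ p ∈ frontier Ω ∩ U, ∀ z ∈ frontier Ω ∩ U, fderiv ℝ (ρ p) (Φ p z) ≠ 0
  rho_form : ∀ K ⊆ frontier Ω ∩ U, IsCompact K → ∃ s > 0, ∃ A : ℝ,
    ∀ p ∈ K, ∀ ζ ∈ Φ p '' U, ‖ζ‖ < s →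
      |ρ p ζ - ((ζ 0).re + ∑ j ∈ midIdx n l, lam p j * ‖ζ j‖ ^ 2)| ≤
        A * (blockNorm (midIdx n l) ζ ^ 2 * blockNorm (lastIdx n l) ζ
          + blockNorm (midIdx n l) ζ ^ 3 + |(ζ 0).im| * ‖ζ‖)

end Blocks

/-!
The proof has three parts: coordinates in which the defining function has the stated form, one
explicit formula for the plurisubharmonic functions, and a dilation argument that makes the
estimates uniform.

*Coordinates.* Near `z₀` choose a defining function `r` with `r (z + t v) = r z + t`
(`exists_local_defining_function`). Its level sets are translates of the boundary, so by Levi's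
theorem (`levi_nonneg_of_pseudoconvex`) all of them have a nonnegative Levi form, and by the rank
hypothesis the Levi nullspaces have dimension `l` (`eventually_levi`). They form an involutive
distribution, because `∂r` vanishes on them and they lie in the kernel of the Levi form
(`lieBracket_mem_nullSpace`); so they have a frame of commuting fields (`exists_null_frame`) and
integral manifolds depending smoothly on the initial point (`exists_leaves`), which are complex
submanifolds of the level sets. `normalMap` parametrizes a neighbourhood of `p` by the leaf through
`p`, by complex tangential fields that are Levi-orthonormal at `p`, and by `v`. The fields are
projections of constant vectors along `v`, and `∂r` is holomorphic along the leaves up to the Levi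
form, which vanishes on null vectors; hence `normalMap` is holomorphic for each `p`. On the leaf the
pulled back function and its complex tangential derivatives vanish, and a quadratic correction
removes the pure terms in `ζ'` at the centre. Solving for the level in the direction `Re ζ₁`
(`IsAdapted.exists_normal_form`) gives `ρ` with `ρ (ζ + t e₁) = ρ ζ + t`. Its remainder
(`exists_remainder_bound`) is controlled by Taylor's formula off the leaf. All `λ_j` equal `1`.

*The functions.* Take `g = (e^{ρ/δ} + K |ζ|²) / (K + 1)` (`expWeight`). Its Levi form is
`(e^{ρ/δ} (L_ρ(Y, Y) / δ + |∂ρ(Y)|² / δ²) + K |Y|²) / (K + 1)`. The level sets of `ρ_p` are again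
translates of the boundary, so `L_ρ ≥ 0` on the complex tangent spaces at interior points too
(`eventually_levi_nonneg`) and therefore `L_ρ(Y, Y) ≥ -C |∂ρ(Y)| |Y|` (`levi_lower_bound`). For
large `K`, independent of `δ`, completing the square shows that `g` is plurisubharmonic where
`ρ < 0`.

*Uniformity.* With `δ = τ²` and the dilation `S_τ w = (τ² w₁, τ w', w'')`, the functions
`τ⁻² ρ_p(S_τ w)` extend smoothly to `τ = 0`, because `ρ_p` vanishes to the right order on the leaf
(`exists_dilated`). So `g ∘ S_τ` is the restriction of a function that is smooth in `(p, τ, w)` near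
`(z₀, 0, 0)`. Its derivatives are bounded by compactness, and its Levi form is bounded below by a
positive constant, since it is so at the points `(z₀, τ, 0)` (`levi_expWeight_center`,
`eventually_levi_lower`). Undoing the dilation yields the powers of `δ` (`levi_anisotropic`,
`mixedDeriv_weight_bound`).
-/

open scoped ContDiff Topology
open Filter

/-! ### Functions that are smooth near a point -/

/-- `f` is of class `C^∞` on some neighbourhood of `x`. (For the exponent `∞`, `ContDiffAt` at the
single point `x` is weaker.) -/
def SmoothNear {X Y : Type*} [NormedAddCommGroup X] [NormedSpace ℝ X] [NormedAddCommGroup Y]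
    [NormedSpace ℝ Y] (f : X → Y) (x : X) : Prop :=
  ∀ᶠ y in 𝓝 x, ContDiffAt ℝ ∞ f y

section SmoothNear

variable {X Y Z : Type*} [NormedAddCommGroup X] [NormedSpace ℝ X] [NormedAddCommGroup Y]
  [NormedSpace ℝ Y] [NormedAddCommGroup Z] [NormedSpace ℝ Z]

theorem SmoothNear.contDiffAt {f : X → Y} {x : X} (h : SmoothNear f x) : ContDiffAt ℝ ∞ f x :=
  h.self_of_nhds

theorem SmoothNear.continuousAt {f : X → Y} {x : X} (h : SmoothNear f x) : ContinuousAt f x :=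
  h.contDiffAt.continuousAt

theorem ContDiff.smoothNear {f : X → Y} (h : ContDiff ℝ ∞ f) (x : X) : SmoothNear f x :=
  Eventually.of_forall fun _ => h.contDiffAt

theorem SmoothNear.comp {g : Y → Z} {f : X → Y} {x : X} (hg : SmoothNear g (f x))
    (hf : SmoothNear f x) : SmoothNear (fun y => g (f y)) x := by
  filter_upwards [hf, hf.continuousAt.eventually hg] with y h1 h2
  exact h2.comp y h1

/-- A function smooth near a point agrees there with a globally smooth one. -/
theorem SmoothNear.exists_contDiff [FiniteDimensional ℝ X] {f : X → Y} {x : X}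
    (hf : SmoothNear f x) : ∃ g : X → Y, ContDiff ℝ ∞ g ∧ g =ᶠ[𝓝 x] f := by
  obtain ⟨ε, hε, h⟩ := Metric.eventually_nhds_iff_ball.1 hf
  let c : ContDiffBump x := ⟨ε / 4, ε / 2, by positivity, by linarith⟩
  refine ⟨fun y => c y • f y, ?_, ?_⟩
  · rw [contDiff_iff_contDiffAt]
    intro y
    by_cases hy : y ∈ Metric.ball x ε
    · exact c.contDiff.contDiffAt.smul (h y hy)
    · have hy' : y ∉ tsupport c := by
        rw [c.tsupport_eq]
        intro h'
        have h2 := Metric.mem_closedBall.1 h'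
        rw [Metric.mem_ball, not_lt] at hy
        have : c.rOut = ε / 2 := rfl
        linarith
      have : (fun y => c y • f y) =ᶠ[𝓝 y] fun _ => 0 := by
        filter_upwards [notMem_tsupport_iff_eventuallyEq.1 hy'] with z hz
        simp [hz]
      exact contDiffAt_const.congr_of_eventuallyEq this
  · filter_upwards [c.eventuallyEq_one] with y hy
    simp [hy]

/-- The implicit function theorem, with smoothness on a neighbourhood of the base point. -/
theorem exists_smooth_implicitFunction [CompleteSpace X] [CompleteSpace Y] [CompleteSpace Z]
    {F : X × Y → Z} {u : X × Y} (hF : SmoothNear F u) (h0 : F u = 0)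
    (hinv : (fderiv ℝ F u ∘L .inr ℝ X Y).IsInvertible) :
    ∃ φ : X → Y, SmoothNear φ u.1 ∧ φ u.1 = u.2 ∧ (∀ᶠ a in 𝓝 u.1, F (a, φ a) = 0) ∧
      ∀ᶠ v in 𝓝 u, F v = 0 → φ v.1 = v.2 := by
  have hn : (∞ : WithTop ℕ∞) ≠ 0 := by simp
  have hFu := hF.contDiffAt
  set φ := hFu.implicitFunction hn hinv with hφ
  have hφu : φ u.1 = u.2 := hFu.implicitFunction_apply_self hn hinv
  have hz : ∀ᶠ a in 𝓝 u.1, F (a, φ a) = 0 := by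
    filter_upwards [hFu.eventually_apply_implicitFunction hn hinv] with a ha
    rw [ha, h0]
  have hφc : ∀ᶠ a in 𝓝 u.1, ContinuousAt φ a := by
    have h1 : ContDiffAt ℝ 1 φ u.1 :=
      (hFu.contDiffAt_implicitFunction hn hinv).of_le (by exact_mod_cast le_top)
    filter_upwards [h1.eventually (by simp)] with a ha using ha.continuousAt
  -- Invertibility of the partial derivative is an open condition.
  have hinv' : ∀ᶠ v in 𝓝 u, (fderiv ℝ F v ∘L .inr ℝ X Y).IsInvertible := by
    have hc : ContinuousAt (fun v => fderiv ℝ F v ∘L .inr ℝ X Y) u := by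
      have : ContinuousAt (fderiv ℝ F) u := (hFu.fderiv_right (m := 0) (by simp)).continuousAt
      exact (ContinuousLinearMap.compL ℝ Y (X × Y) Z |>.flip (.inr ℝ X Y)).continuous.continuousAt.comp
        this
    obtain ⟨e, he⟩ := hinv
    have : ∀ᶠ T in 𝓝 (e : Y →L[ℝ] Z), T.IsInvertible := by
      filter_upwards [ContinuousLinearEquiv.nhds e] with T hT
      obtain ⟨e', rfl⟩ := hT
      exact ⟨e', rfl⟩
    rw [he] at this
    exact hc.eventually this
  have htend : Tendsto (fun a => (a, φ a)) (𝓝 u.1) (𝓝 u) := by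
    have : ContinuousAt (fun a => (a, φ a)) u.1 := continuousAt_id.prodMk hφc.self_of_nhds
    simpa [ContinuousAt, hφu] using this
  refine ⟨φ, ?_, hφu, hz, ?_⟩
  · filter_upwards [hz.eventually_nhds, hφc, htend.eventually hF, htend.eventually hinv']
      with a h1 h2 h3 h4
    refine (h3.contDiffAt_implicitFunction hn h4).congr_of_eventuallyEq ?_
    have h5 := h3.eventually_apply_eq_iff_implicitFunction hn h4
    have h6 : Tendsto (fun a => (a, φ a)) (𝓝 a) (𝓝 (a, φ a)) := continuousAt_id.prodMk h2
    filter_upwards [h1, h6.eventually h5] with b hb1 hb2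
    have := hb2.1 (by rw [hb1, h1.self_of_nhds])
    exact this.symm
  · filter_upwards [hFu.eventually_apply_eq_iff_implicitFunction hn hinv] with v hv h
    exact hv.1 (by rw [h, h0])

/-- Taylor's formula of order two with Lagrange remainder. -/
theorem exists_taylor_two {f : X → ℝ} {x h : X}
    (hf : ∀ s ∈ Set.Icc (0 : ℝ) 1, ContDiffAt ℝ 2 f (x + s • h)) :
    ∃ θ ∈ Set.Ioo (0 : ℝ) 1,
      f (x + h) = f x + fderiv ℝ f x h + fderiv ℝ (fderiv ℝ f) (x + θ • h) h h / 2 := by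
  have hl : ∀ s : ℝ, HasDerivAt (fun s : ℝ => x + s • h) h s := fun s => by
    simpa using ((hasDerivAt_id s).smul_const h).const_add x
  have h1 : ∀ s ∈ Set.Icc (0 : ℝ) 1,
      HasDerivAt (fun s : ℝ => f (x + s • h)) (fderiv ℝ f (x + s • h) h) s := fun s hs =>
    (((hf s hs).differentiableAt (by simp)).hasFDerivAt).comp_hasDerivAt s (hl s)
  have h2 : ∀ s ∈ Set.Icc (0 : ℝ) 1, HasDerivAt (fun s : ℝ => fderiv ℝ f (x + s • h) h)
      (fderiv ℝ (fderiv ℝ f) (x + s • h) h h) s := fun s hs => by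
    have h3 : DifferentiableAt ℝ (fderiv ℝ f) (x + s • h) :=
      ((hf s hs).fderiv_right (m := 1) (by norm_num)).differentiableAt (by simp)
    have h4 := h3.hasFDerivAt.comp_hasDerivAt s (hl s)
    exact (ContinuousLinearMap.apply ℝ ℝ h).hasFDerivAt.comp_hasDerivAt s h4
  -- Cauchy's mean value theorem, twice.
  set a : ℝ := f (x + h) - f x - fderiv ℝ f x h
  let G : ℝ → ℝ := fun s => f (x + s • h) - f x - s * fderiv ℝ f x h - s ^ 2 * a
  have hG : ∀ s ∈ Set.Icc (0 : ℝ) 1, HasDerivAt G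
      (fderiv ℝ f (x + s • h) h - fderiv ℝ f x h - 2 * s * a) s := fun s hs => by
    have := (((h1 s hs).sub_const (f x)).sub ((hasDerivAt_id s).mul_const (fderiv ℝ f x h))).sub
      (((hasDerivAt_id s).pow 2).mul_const a)
    refine this.congr_deriv ?_
    simp
  have hG0 : G 0 = G 1 := by simp [G, a]
  obtain ⟨c, hc, hc'⟩ := exists_hasDerivAt_eq_zero (f := G) (a := 0) (b := 1) one_pos
    (fun s hs => (hG s hs).continuousAt.continuousWithinAt) hG0
    (fun s hs => hG s (Set.Ioo_subset_Icc_self hs))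
  let G1 : ℝ → ℝ := fun s => fderiv ℝ f (x + s • h) h - fderiv ℝ f x h - 2 * s * a
  have hsub : Set.Icc 0 c ⊆ Set.Icc (0 : ℝ) 1 := Set.Icc_subset_Icc le_rfl hc.2.le
  have hG1 : ∀ s ∈ Set.Icc (0 : ℝ) c, HasDerivAt G1
      (fderiv ℝ (fderiv ℝ f) (x + s • h) h h - 2 * a) s := fun s hs => by
    have := ((h2 s (hsub hs)).sub_const (fderiv ℝ f x h)).sub
      (((hasDerivAt_id s).const_mul 2).mul_const a)
    refine this.congr_deriv ?_
    simp
  obtain ⟨θ, hθ, hθ'⟩ := exists_hasDerivAt_eq_zero (f := G1) (a := 0) (b := c) hc.1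
    (fun s hs => (hG1 s hs).continuousAt.continuousWithinAt) (by simp only [G1]; rw [hc']; simp)
    (fun s hs => hG1 s (Set.Ioo_subset_Icc_self hs))
  refine ⟨θ, ⟨hθ.1, hθ.2.trans hc.2⟩, ?_⟩
  have : a = fderiv ℝ (fderiv ℝ f) (x + θ • h) h h / 2 := by linarith
  rw [← this]; simp only [a]; ring

end SmoothNear

/-! ### Superposition operators on spaces of curves -/

section Superposition

variable {K : Type} [TopologicalSpace K] [CompactSpace K]

/-- The bilinear pairing `(T, h) ↦ (t ↦ T t (h t))` of curves of operators with curves. -/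
noncomputable def curvePairing (K E F : Type) [TopologicalSpace K] [CompactSpace K]
    [NormedAddCommGroup E] [NormedSpace ℝ E] [NormedAddCommGroup F] [NormedSpace ℝ F] :
    C(K, E →L[ℝ] F) →L[ℝ] C(K, E) →L[ℝ] C(K, F) :=
  LinearMap.mkContinuous₂
    (LinearMap.mk₂ ℝ (fun (T : C(K, E →L[ℝ] F)) (h : C(K, E)) => (⟨fun t => T t (h t), by fun_prop⟩ : C(K, F)))
      (fun _ _ _ => by ext; simp) (fun _ _ _ => by ext; simp)
      (fun _ _ _ => by ext; simp) (fun _ _ _ => by ext; simp)) 1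
    (fun T h => by
      rw [one_mul, ContinuousMap.norm_le _ (by positivity)]
      intro t
      exact (T t).le_of_opNorm_le_of_le (T.norm_coe_le_norm t) (h.norm_coe_le_norm t))

@[simp] theorem curvePairing_apply {E F : Type} [NormedAddCommGroup E] [NormedSpace ℝ E]
    [NormedAddCommGroup F] [NormedSpace ℝ F] (T : C(K, E →L[ℝ] F)) (h : C(K, E)) (t : K) :
    curvePairing K E F T h t = T t (h t) := rfl

theorem hasFDerivAt_superposition {E F : Type} [NormedAddCommGroup E] [NormedSpace ℝ E]
    [NormedAddCommGroup F] [NormedSpace ℝ F] (f : C(E, F)) (f' : C(E, E →L[ℝ] F))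
    (hf : ∀ x, HasFDerivAt f (f' x) x) (x : C(K, E)) :
    HasFDerivAt (fun x : C(K, E) => f.comp x) (curvePairing K E F (f'.comp x)) x := by
  rw [hasFDerivAt_iff_isLittleO_nhds_zero, Asymptotics.isLittleO_iff]
  intro c hc
  have hcont : ContinuousAt (fun x : C(K, E) => f'.comp x) x :=
    f'.continuous_postcomp.continuousAt
  obtain ⟨δ, hδ, h⟩ := (Metric.continuousAt_iff (α := C(K, E)) (β := C(K, E →L[ℝ] F))).1 hcont c hc
  filter_upwards [Metric.ball_mem_nhds (0 : C(K, E)) hδ] with y hy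
  rw [ContinuousMap.norm_le _ (by positivity)]
  intro t
  have hb : ∀ z ∈ segment ℝ (x t) (x t + y t), ‖f' z - f' (x t)‖ ≤ c := by
    intro z hz
    rw [segment_eq_image'] at hz
    obtain ⟨s, hs, rfl⟩ := hz
    have h1 := h (x := x + s • y) (by
      rw [dist_eq_norm, add_sub_cancel_left, norm_smul, Real.norm_eq_abs, abs_of_nonneg hs.1]
      have := mem_ball_zero_iff.1 hy
      nlinarith [norm_nonneg y, hs.2])
    have h2 := (ContinuousMap.dist_apply_le_dist (f := f'.comp (x + s • y)) (g := f'.comp x) t).trans h1.le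
    simpa [dist_eq_norm] using h2
  have := (convex_segment (x t) (x t + y t)).norm_image_sub_le_of_norm_hasFDerivWithin_le'
    (f := f) (f' := f') (φ := f' (x t)) (C := c)
    (fun z _ => (hf z).hasFDerivWithinAt) hb (left_mem_segment ℝ _ _) (right_mem_segment ℝ _ _)
  simp only [add_sub_cancel_left] at this
  refine le_trans (by simpa using this) ?_
  exact mul_le_mul_of_nonneg_left (y.norm_coe_le_norm t) hc.le

/-- Superposition with a smooth map is a smooth operator on a space of continuous curves. -/
theorem contDiff_superposition {E : Type} [NormedAddCommGroup E] [NormedSpace ℝ E] (m : ℕ) :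
    ∀ {F : Type} [NormedAddCommGroup F] [NormedSpace ℝ F] (f : C(E, F)), ContDiff ℝ ∞ f →
      ContDiff ℝ m (fun x : C(K, E) => f.comp x) := by
  induction m with
  | zero =>
    intro F _ _ f _
    exact contDiff_zero.2 f.continuous_postcomp
  | succ m ih =>
    intro F _ _ f hf
    have hf' : ContDiff ℝ ∞ (fderiv ℝ f) := hf.fderiv_right (by simp)
    let f' : C(E, E →L[ℝ] F) := ⟨fderiv ℝ f, hf'.continuous⟩
    rw [show ((m + 1 : ℕ) : WithTop ℕ∞) = (m : WithTop ℕ∞) + 1 by push_cast; rfl,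
      contDiff_succ_iff_hasFDerivAt]
    refine ⟨fun x => curvePairing K E F (f'.comp x), ?_, fun x =>
      hasFDerivAt_superposition f f' (fun x => (hf.differentiable (by simp) x).hasFDerivAt) x⟩
    exact (curvePairing K E F).contDiff.comp (ih f' hf')

theorem contDiff_superposition_infty {E F : Type} [NormedAddCommGroup E] [NormedSpace ℝ E]
    [NormedAddCommGroup F] [NormedSpace ℝ F] (f : C(E, F)) (hf : ContDiff ℝ ∞ f) :
    ContDiff ℝ ∞ (fun x : C(K, E) => f.comp x) :=
  contDiff_infty.2 fun m => contDiff_superposition m f hf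

end Superposition

/-- Integration `x ↦ ∫₀ᵗ x` as an operator on curves. -/
noncomputable def primitiveOp (F : Type) [NormedAddCommGroup F] [NormedSpace ℝ F] :
    C(unitInterval, F) →L[ℝ] C(unitInterval, F) :=
  LinearMap.mkContinuous
    { toFun := fun x => ⟨fun t => ∫ s in (0 : ℝ)..t, x (Set.projIcc 0 1 zero_le_one s), by
        have hc : Continuous fun s : ℝ => x (Set.projIcc 0 1 zero_le_one s) := by fun_prop
        exact (intervalIntegral.continuous_primitive (fun a b => hc.intervalIntegrable a b) 0).comp
          continuous_subtype_val⟩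
      map_add' := fun x y => by
        ext t
        have hc : ∀ x : C(unitInterval, F), Continuous fun s : ℝ =>
          x (Set.projIcc 0 1 zero_le_one s) := fun x => by fun_prop
        simpa using intervalIntegral.integral_add ((hc x).intervalIntegrable 0 t)
          ((hc y).intervalIntegrable 0 t)
      map_smul' := fun c x => by
        ext t
        simp } 1
    (fun x => by
      rw [one_mul, ContinuousMap.norm_le _ (by positivity)]
      intro t
      refine (intervalIntegral.norm_integral_le_of_norm_le_const (C := ‖x‖)
        fun s _ => x.norm_coe_le_norm _).trans ?_
      have h1 := t.2.1
      have h2 := t.2.2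
      rw [sub_zero, abs_of_nonneg h1]
      nlinarith [norm_nonneg x])

theorem primitiveOp_apply {F : Type} [NormedAddCommGroup F] [NormedSpace ℝ F]
    (x : C(unitInterval, F)) (t : unitInterval) :
    primitiveOp F x t = ∫ s in (0 : ℝ)..t, x (Set.projIcc 0 1 zero_le_one s) := rfl

theorem norm_primitiveOp_le {F : Type} [NormedAddCommGroup F] [NormedSpace ℝ F]
    (x : C(unitInterval, F)) : ‖primitiveOp F x‖ ≤ ‖x‖ := by
  simpa using (LinearMap.mkContinuous_norm_le _ zero_le_one _ : ‖primitiveOp F‖ ≤ 1) |>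
    (primitiveOp F).le_of_opNorm_le (x := x)

/-- Integrals depending on a parameter are smooth in the parameter. -/
theorem contDiff_integral_param {X F : Type} [NormedAddCommGroup X] [NormedSpace ℝ X]
    [NormedAddCommGroup F] [NormedSpace ℝ F] {G : X × ℝ → F} (hG : ContDiff ℝ ∞ G) :
    ContDiff ℝ ∞ fun x => ∫ t in (0 : ℝ)..1, G (x, t) := by
  let c : X →L[ℝ] C(unitInterval, X × ℝ) := LinearMap.mkContinuous
    { toFun := fun x => ContinuousMap.const _ (x, 0)
      map_add' := fun x y => by ext <;> simp
      map_smul' := fun a x => by ext <;> simp } 1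
      (fun x => by
        rw [one_mul, ContinuousMap.norm_le _ (by positivity)]
        intro t; simp)
  let c0 : C(unitInterval, X × ℝ) := ⟨fun t => (0, (t : ℝ)), by fun_prop⟩
  have h1 : ContDiff ℝ ∞ fun x : X => (⟨G, hG.continuous⟩ : C(X × ℝ, F)).comp (c x + c0) :=
    (contDiff_superposition_infty ⟨G, hG.continuous⟩ hG).comp (c.contDiff.add contDiff_const)
  have h2 := (ContinuousMap.evalCLM ℝ (1 : unitInterval)).contDiff.comp
    ((primitiveOp F).contDiff.comp h1)
  convert h2 using 1
  ext x
  simp only [Function.comp_apply, ContinuousMap.evalCLM_apply, primitiveOp_apply]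
  refine intervalIntegral.integral_congr fun t ht => ?_
  rw [Set.uIcc_of_le zero_le_one] at ht
  simp [c, c0, Set.projIcc_of_mem zero_le_one ht]

/-! ### The form `∂r` and the Levi form in terms of real derivatives -/

section Forms

variable {n : ℕ}

/-- The complex linear part `X ↦ (φ(X) - i φ(iX)) / 2` of a real functional `φ`. -/
noncomputable def complexPartAux (φ : CSpace n →L[ℝ] ℝ) : CSpace n →L[ℂ] ℂ :=
  LinearMap.toContinuousLinearMap
    { toFun := fun X => ((φ X : ℂ) - Complex.I * φ (Complex.I • X)) / 2
      map_add' := fun X Y => by simp only [map_add, smul_add, Complex.ofReal_add]; ring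
      map_smul' := fun c X => by
        have h1 : c • X = c.re • X + c.im • (Complex.I • X) := by
          conv_lhs => rw [← Complex.re_add_im c]
          rw [add_smul, mul_smul]; rfl
        have h2 : Complex.I • c • X = c.re • (Complex.I • X) - c.im • X := by
          rw [h1, smul_add, smul_comm Complex.I c.re, smul_comm Complex.I c.im, smul_smul,
            Complex.I_mul_I, neg_one_smul, smul_neg, sub_eq_add_neg]
        rw [h2, h1]
        simp only [map_add, map_sub, map_smul, smul_eq_mul, RingHom.id_apply]
        apply Complex.ext <;> simp <;> ring }

theorem complexPartAux_apply (φ : CSpace n →L[ℝ] ℝ) (X : CSpace n) :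
    complexPartAux φ X = ((φ X : ℂ) - Complex.I * φ (Complex.I • X)) / 2 := rfl

theorem norm_complexPartAux_le (φ : CSpace n →L[ℝ] ℝ) : ‖complexPartAux φ‖ ≤ 1 * ‖φ‖ := by
  rw [one_mul]
  refine ContinuousLinearMap.opNorm_le_bound _ (norm_nonneg _) fun X => ?_
  have h1 : ‖(φ X : ℂ)‖ ≤ ‖φ‖ * ‖X‖ := by simpa using φ.le_opNorm X
  have h2 : ‖(φ (Complex.I • X) : ℂ)‖ ≤ ‖φ‖ * ‖X‖ := by
    simpa [norm_smul] using φ.le_opNorm (Complex.I • X)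
  have h3 := norm_sub_le (φ X : ℂ) (Complex.I * φ (Complex.I • X))
  rw [norm_mul, Complex.norm_I, one_mul] at h3
  rw [complexPartAux_apply, norm_div, Complex.norm_ofNat]
  linarith

/-- `complexPartAux` as a continuous linear map. -/
noncomputable def complexPart (n : ℕ) : (CSpace n →L[ℝ] ℝ) →L[ℝ] (CSpace n →L[ℂ] ℂ) :=
  LinearMap.mkContinuous
    { toFun := complexPartAux
      map_add' := fun φ ψ => ContinuousLinearMap.ext fun X => by
        change _ = complexPartAux φ X + complexPartAux ψ X
        simp only [complexPartAux_apply, add_apply, Complex.ofReal_add]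
        ring
      map_smul' := fun c φ => ContinuousLinearMap.ext fun X => by
        change _ = c • complexPartAux φ X
        simp only [complexPartAux_apply, smul_apply, smul_eq_mul, Complex.ofReal_mul,
          Complex.real_smul]
        ring } 1 norm_complexPartAux_le

theorem complexPart_apply (φ : CSpace n →L[ℝ] ℝ) (X : CSpace n) :
    complexPart n φ X = ((φ X : ℂ) - Complex.I * φ (Complex.I • X)) / 2 := rfl

/-- The complex linear functional `∂r(z)`. -/
noncomputable def delForm (r : CSpace n → ℝ) (z : CSpace n) : CSpace n →L[ℂ] ℂ :=
  complexPart n (fderiv ℝ r z)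

theorem delForm_apply (r : CSpace n → ℝ) (z X : CSpace n) :
    delForm r z X = ((fderiv ℝ r z X : ℂ) - Complex.I * fderiv ℝ r z (Complex.I • X)) / 2 := rfl

theorem delForm_re (r : CSpace n → ℝ) (z X : CSpace n) :
    (delForm r z X).re = fderiv ℝ r z X / 2 := by
  simp [delForm_apply]

theorem fderiv_eq_two_mul_re (r : CSpace n → ℝ) (z X : CSpace n) :
    fderiv ℝ r z X = 2 * (delForm r z X).re := by
  rw [delForm_re]; ring

theorem sum_smul_single (X : CSpace n) :
    X = ∑ j, X j • (EuclideanSpace.single j 1 : CSpace n) := by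
  ext k
  simp [Pi.single_apply]

theorem single_I_eq (j : Fin n) :
    (EuclideanSpace.single j Complex.I : CSpace n) =
      Complex.I • (EuclideanSpace.single j 1 : CSpace n) := by
  ext k
  by_cases h : k = j <;> simp [h]

theorem fderiv_toC {r : CSpace n → ℝ} {z : CSpace n} (hr : DifferentiableAt ℝ r z)
    (X : CSpace n) : fderiv ℝ (toC r) z X = (fderiv ℝ r z X : ℂ) := by
  have h : HasFDerivAt (toC r) (Complex.ofRealCLM ∘L fderiv ℝ r z) z :=
    Complex.ofRealCLM.hasFDerivAt.comp z hr.hasFDerivAt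
  rw [h.fderiv]; rfl

theorem delPairing_eq {r : CSpace n → ℝ} {z : CSpace n} (hr : DifferentiableAt ℝ r z)
    (X : CSpace n) : delPairing r z X = delForm r z X := by
  conv_rhs => rw [sum_smul_single X, map_sum]
  refine Finset.sum_congr rfl fun j _ => ?_
  rw [map_smul, smul_eq_mul, mul_comm, dz, fderiv_toC hr, fderiv_toC hr, single_I_eq,
    delForm_apply]

theorem SmoothNear.fderiv {X Y : Type*} [NormedAddCommGroup X] [NormedSpace ℝ X]
    [NormedAddCommGroup Y] [NormedSpace ℝ Y] {f : X → Y} {x : X} (h : SmoothNear f x) :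
    SmoothNear (fderiv ℝ f) x := by
  filter_upwards [h] with y hy using hy.fderiv_right (by simp)

theorem contDiff_delForm {r : CSpace n → ℝ} (hr : ContDiff ℝ ∞ r) :
    ContDiff ℝ ∞ (delForm r) :=
  (complexPart n).contDiff.comp (hr.fderiv_right (by simp))

theorem fderiv_delForm_apply {r : CSpace n → ℝ} {z : CSpace n}
    (hr : DifferentiableAt ℝ (fderiv ℝ r) z) (Y X : CSpace n) :
    fderiv ℝ (delForm r) z Y X = ((fderiv ℝ (fderiv ℝ r) z Y X : ℂ)
      - Complex.I * fderiv ℝ (fderiv ℝ r) z Y (Complex.I • X)) / 2 := by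
  have h : HasFDerivAt (delForm r) (complexPart n ∘L fderiv ℝ (fderiv ℝ r) z) z :=
    (complexPart n).hasFDerivAt.comp z hr.hasFDerivAt
  rw [h.fderiv]; rfl

/-- The complex linear functional `X ↦ L_r(z; X, Y)`, as the part of the derivative of `∂r` that is
conjugate linear in the direction `Y` of differentiation. -/
noncomputable def leviL (r : CSpace n → ℝ) (z Y : CSpace n) : CSpace n →L[ℂ] ℂ :=
  (2 : ℂ)⁻¹ • (fderiv ℝ (delForm r) z Y + Complex.I • fderiv ℝ (delForm r) z (Complex.I • Y))

theorem leviL_add (r : CSpace n → ℝ) (z Y Y' : CSpace n) :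
    leviL r z (Y + Y') = leviL r z Y + leviL r z Y' := by
  simp only [leviL, smul_add, map_add]; abel

theorem leviL_smul (r : CSpace n → ℝ) (z Y : CSpace n) (c : ℂ) :
    leviL r z (c • Y) = (starRingEnd ℂ) c • leviL r z Y := by
  have h1 : c • Y = c.re • Y + c.im • (Complex.I • Y) := by
    conv_lhs => rw [← Complex.re_add_im c]
    rw [add_smul, mul_smul]; rfl
  have h2 : Complex.I • c • Y = c.re • (Complex.I • Y) - c.im • Y := by
    rw [h1, smul_add, smul_comm Complex.I c.re, smul_comm Complex.I c.im, smul_smul,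
      Complex.I_mul_I, neg_one_smul, smul_neg, sub_eq_add_neg]
  rw [leviL, h2, h1]
  simp only [map_add, map_sub, map_smul, leviL]
  ext X
  simp only [smul_apply, add_apply,
    sub_apply, smul_eq_mul, Complex.real_smul]
  apply Complex.ext <;> simp <;> ring

theorem leviL_sum (r : CSpace n → ℝ) (z : CSpace n) {ι : Type*} (s : Finset ι)
    (Y : ι → CSpace n) : leviL r z (∑ i ∈ s, Y i) = ∑ i ∈ s, leviL r z (Y i) := by
  classical
  induction s using Finset.induction_on with
  | empty => ext; simp [leviL]
  | insert a s ha ih => rw [Finset.sum_insert ha, Finset.sum_insert ha, leviL_add, ih]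

theorem leviL_apply {r : CSpace n → ℝ} {z : CSpace n} (hr : DifferentiableAt ℝ (fderiv ℝ r) z)
    (X Y : CSpace n) : leviL r z Y X =
      ((fderiv ℝ (fderiv ℝ r) z Y X + fderiv ℝ (fderiv ℝ r) z (Complex.I • Y) (Complex.I • X) : ℝ)
        + Complex.I * (fderiv ℝ (fderiv ℝ r) z (Complex.I • Y) X
          - fderiv ℝ (fderiv ℝ r) z Y (Complex.I • X) : ℝ)) / 4 := by
  simp only [leviL, smul_apply, add_apply,
    smul_eq_mul, fderiv_delForm_apply hr]
  push_cast
  linear_combination (- (fderiv ℝ (fderiv ℝ r) z (Complex.I • Y) (Complex.I • X) : ℂ) / 4)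
    * Complex.I_mul_I

/-- The derivative of `∂r` fails to be complex linear in the direction of differentiation by a
multiple of the Levi form. -/
theorem fderiv_delForm_I_smul {r : CSpace n → ℝ} {z : CSpace n} (X Y : CSpace n) :
    fderiv ℝ (delForm r) z (Complex.I • X) Y =
      Complex.I * fderiv ℝ (delForm r) z X Y - 2 * Complex.I * leviL r z X Y := by
  simp only [leviL, smul_apply, add_apply, smul_eq_mul]
  linear_combination (fderiv ℝ (delForm r) z (Complex.I • X) Y) * Complex.I_mul_I

theorem isSymm_of_contDiffAt {V : Type*} [NormedAddCommGroup V] [NormedSpace ℝ V] {r : V → ℝ}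
    {z : V} (hr : ContDiffAt ℝ 2 r z) (X Y : V) :
    fderiv ℝ (fderiv ℝ r) z X Y = fderiv ℝ (fderiv ℝ r) z Y X :=
  (hr.isSymmSndFDerivAt (by simp)).eq X Y

theorem I_smul_I_smul (X : CSpace n) : Complex.I • Complex.I • X = -X := by
  rw [smul_smul, Complex.I_mul_I, neg_one_smul]

theorem leviL_conj {r : CSpace n → ℝ} {z : CSpace n} (hr : ContDiffAt ℝ 2 r z)
    (X Y : CSpace n) : (starRingEnd ℂ) (leviL r z Y X) = leviL r z X Y := by
  have hd : DifferentiableAt ℝ (fderiv ℝ r) z :=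
    (hr.fderiv_right (m := 1) (by norm_num)).differentiableAt (by simp)
  rw [leviL_apply hd, leviL_apply hd]
  rw [isSymm_of_contDiffAt hr X Y, isSymm_of_contDiffAt hr (Complex.I • X) (Complex.I • Y),
    isSymm_of_contDiffAt hr (Complex.I • X) Y, isSymm_of_contDiffAt hr X (Complex.I • Y)]
  simp only [map_div₀, map_add, map_mul, Complex.conj_ofReal, Complex.conj_I, map_ofNat]
  push_cast
  ring

theorem leviL_self_re {r : CSpace n → ℝ} {z : CSpace n}
    (hr : DifferentiableAt ℝ (fderiv ℝ r) z) (X : CSpace n) :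
    (leviL r z X X).re = (fderiv ℝ (fderiv ℝ r) z X X
      + fderiv ℝ (fderiv ℝ r) z (Complex.I • X) (Complex.I • X)) / 4 := by
  rw [leviL_apply hr]
  simp

theorem leviForm_eq {r : CSpace n → ℝ} {z : CSpace n} (hr : ContDiffAt ℝ 2 r z)
    (X Y : CSpace n) : leviForm r z X Y = leviL r z Y X := by
  have hd : DifferentiableAt ℝ (fderiv ℝ r) z :=
    (hr.fderiv_right (m := 1) (by norm_num)).differentiableAt (by simp)
  have hev : ∀ k : Fin n, dzbar k (toC r) =ᶠ[𝓝 z] fun y =>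
      ((fderiv ℝ r y (EuclideanSpace.single k 1) : ℂ)
        + Complex.I * fderiv ℝ r y (EuclideanSpace.single k Complex.I)) / 2 := by
    intro k
    filter_upwards [hr.eventually (by simp)] with y hy
    have := hy.differentiableAt (by simp)
    rw [dzbar, fderiv_toC this, fderiv_toC this]
  have hdz : ∀ (k : Fin n) (u : CSpace n), fderiv ℝ (dzbar k (toC r)) z u =
      ((fderiv ℝ (fderiv ℝ r) z u (EuclideanSpace.single k 1) : ℂ)
        + Complex.I * fderiv ℝ (fderiv ℝ r) z u (EuclideanSpace.single k Complex.I)) / 2 := by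
    intro k u
    rw [(hev k).fderiv_eq]
    have hv : ∀ v : CSpace n, HasFDerivAt (fun y => (fderiv ℝ r y v : ℂ))
        (Complex.ofRealCLM ∘L (ContinuousLinearMap.apply ℝ ℝ v) ∘L fderiv ℝ (fderiv ℝ r) z) z :=
      fun v => Complex.ofRealCLM.hasFDerivAt.comp z
        ((ContinuousLinearMap.apply ℝ ℝ v).hasFDerivAt.comp z hd.hasFDerivAt)
    have h := ((hv (EuclideanSpace.single k 1)).add
      ((hv (EuclideanSpace.single k Complex.I)).const_mul Complex.I)).mul_const (2⁻¹ : ℂ)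
    simp only [← div_eq_mul_inv] at h
    erw [h.fderiv]
    simp [div_eq_mul_inv]
    ring
  have hjk : ∀ j k : Fin n, dz j (dzbar k (toC r)) z =
      leviL r z (EuclideanSpace.single k 1) (EuclideanSpace.single j 1) := by
    intro j k
    rw [dz, hdz, hdz, leviL_apply hd, single_I_eq, single_I_eq,
      isSymm_of_contDiffAt hr (EuclideanSpace.single k 1) (EuclideanSpace.single j 1),
      isSymm_of_contDiffAt hr (Complex.I • EuclideanSpace.single k 1)
        (Complex.I • EuclideanSpace.single j 1),
      isSymm_of_contDiffAt hr (Complex.I • EuclideanSpace.single k 1) (EuclideanSpace.single j 1),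
      isSymm_of_contDiffAt hr (EuclideanSpace.single k 1) (Complex.I • EuclideanSpace.single j 1)]
    push_cast
    linear_combination (- (fderiv ℝ (fderiv ℝ r) z (Complex.I • EuclideanSpace.single j 1)
      (Complex.I • EuclideanSpace.single k 1) : ℂ) / 4) * Complex.I_mul_I
  conv_rhs => rw [sum_smul_single X, map_sum, sum_smul_single Y]
  refine Finset.sum_congr rfl fun j _ => ?_
  rw [map_smul, leviL_sum, sum_apply, smul_eq_mul, Finset.mul_sum]
  refine Finset.sum_congr rfl fun k _ => ?_
  rw [leviL_smul, hjk, smul_apply, smul_eq_mul]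
  ring

/-- The second derivative of `r` in terms of the derivative of `∂r`. -/
theorem hessian_eq_two_mul_re {r : CSpace n → ℝ} {z : CSpace n}
    (hr : DifferentiableAt ℝ (fderiv ℝ r) z) (X Y : CSpace n) :
    fderiv ℝ (fderiv ℝ r) z X Y = 2 * (fderiv ℝ (delForm r) z X Y).re := by
  rw [fderiv_delForm_apply hr]
  simp
  ring

end Forms

/-! ### Plurisubharmonic functions and holomorphic discs -/

section Plurisubharmonic

variable {n : ℕ}

theorem hasDerivAt_integral_of_continuous {F F' : ℝ → ℝ → ℝ}
    (hF : Continuous (Function.uncurry F)) (hF' : Continuous (Function.uncurry F'))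
    (h : ∀ s θ, HasDerivAt (fun s => F s θ) (F' s θ) s) (a b s₀ : ℝ) :
    HasDerivAt (fun s => ∫ θ in a..b, F s θ) (∫ θ in a..b, F' s₀ θ) s₀ := by
  obtain ⟨C, hC⟩ := ((isCompact_closedBall s₀ 1).prod (isCompact_uIcc (a := a) (b := b))).exists_bound_of_continuousOn
    hF'.continuousOn
  have hcF : ∀ s, Continuous (F s) := fun s => hF.comp (by fun_prop : Continuous fun θ => (s, θ))
  have hcF' : ∀ s, Continuous (F' s) := fun s => hF'.comp (by fun_prop : Continuous fun θ => (s, θ))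
  refine (intervalIntegral.hasDerivAt_integral_of_dominated_loc_of_deriv_le
    (F := F) (F' := F') (bound := fun _ => C) (s := Metric.ball s₀ 1)
    (Metric.ball_mem_nhds _ one_pos) ?_ ?_ ?_ ?_ ?_ ?_).2
  · exact Eventually.of_forall fun s => (hcF s).aestronglyMeasurable
  · exact (hcF s₀).intervalIntegrable _ _
  · exact (hcF' s₀).aestronglyMeasurable
  · refine Eventually.of_forall fun θ hθ s hs => ?_
    exact hC (s, θ) ⟨Metric.ball_subset_closedBall hs, Set.uIoc_subset_uIcc hθ⟩
  · exact intervalIntegrable_const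
  · exact Eventually.of_forall fun θ _ s _ => h s θ

/-- The sub-mean value property of a function whose Levi form is nonnegative along a disc. In polar
coordinates `s ∂ₛ(s ∂ₛ A) ≥ 0` for the circle means `A(s)`, because `∂²/∂θ²` integrates to zero. -/
theorem le_circleAverage_of_levi_nonneg {g : CSpace n → ℝ} (hg : ContDiff ℝ ∞ g)
    (z w : CSpace n) (h : ∀ t : ℂ, ‖t‖ ≤ 1 → ∀ Y, 0 ≤ (leviL g (z + t • w) Y Y).re) :
    g z ≤ Real.circleAverage (fun t : ℂ => g (z + t • w)) 0 1 := by
  have hg1 : ContDiff ℝ ∞ (fderiv ℝ g) := hg.fderiv_right (by simp)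
  have hg2 : Continuous (fderiv ℝ (fderiv ℝ g)) := hg1.continuous_fderiv (by simp)
  have hgc : Continuous (fderiv ℝ g) := hg1.continuous
  have hg0 : Continuous g := hg.continuous
  have hD1 : ∀ y, HasFDerivAt g (fderiv ℝ g y) y :=
    fun y => (hg.differentiable (by simp) y).hasFDerivAt
  have hD2 : ∀ y, HasFDerivAt (fderiv ℝ g) (fderiv ℝ (fderiv ℝ g) y) y :=
    fun y => (hg1.differentiable (by simp) y).hasFDerivAt
  -- `v θ = e^{iθ} w`, and `p s θ` runs over the disc.
  let v : ℝ → CSpace n := fun θ => Complex.exp (θ * Complex.I) • w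
  have hvc : Continuous v := by fun_prop
  have hv : ∀ θ, HasDerivAt v (Complex.I • v θ) θ := fun θ => by
    have h1 : HasDerivAt (fun θ : ℝ => Complex.exp (θ * Complex.I))
        (Complex.exp (θ * Complex.I) * Complex.I) θ := by
      have := ((Complex.ofRealCLM.hasDerivAt (x := θ)).mul_const Complex.I).cexp
      simpa using this
    have h2 := h1.smul_const w
    simpa only [v, smul_smul, mul_comm] using h2
  have hvI : ∀ θ, HasDerivAt (fun θ => Complex.I • v θ) (-v θ) θ := fun θ => by
    have := (hv θ).const_smul Complex.I
    rwa [I_smul_I_smul] at this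
  let p : ℝ → ℝ → CSpace n := fun s θ => z + s • v θ
  have hpc : Continuous (Function.uncurry p) := by
    simp only [p, Function.uncurry_def]; fun_prop
  have hps : ∀ s θ, HasDerivAt (fun s => p s θ) (v θ) s := fun s θ =>
    (((hasDerivAt_id s).smul_const (v θ)).const_add z).congr_deriv (one_smul _ _)
  have hpθ : ∀ s θ, HasDerivAt (p s) (s • Complex.I • v θ) θ := fun s θ =>
    ((hv θ).const_smul s).const_add z
  let F0 : ℝ → ℝ → ℝ := fun s θ => g (p s θ)
  let F1 : ℝ → ℝ → ℝ := fun s θ => fderiv ℝ g (p s θ) (v θ)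
  let F2 : ℝ → ℝ → ℝ := fun s θ => fderiv ℝ (fderiv ℝ g) (p s θ) (v θ) (v θ)
  let T1 : ℝ → ℝ → ℝ := fun s θ => fderiv ℝ g (p s θ) (s • Complex.I • v θ)
  let T2 : ℝ → ℝ → ℝ := fun s θ =>
    fderiv ℝ (fderiv ℝ g) (p s θ) (s • Complex.I • v θ) (s • Complex.I • v θ) - s * F1 s θ
  have hc0 : Continuous (Function.uncurry F0) := hg0.comp hpc
  have hv2 : Continuous fun q : ℝ × ℝ => v q.2 := hvc.comp continuous_snd
  have hc1 : Continuous (Function.uncurry F1) := (hgc.comp hpc).clm_apply hv2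
  have hc2 : Continuous (Function.uncurry F2) := ((hg2.comp hpc).clm_apply hv2).clm_apply hv2
  have hw2 : Continuous fun q : ℝ × ℝ => q.1 • Complex.I • v q.2 := by
    fun_prop
  have hcT2 : Continuous (Function.uncurry T2) :=
    (((hg2.comp hpc).clm_apply hw2).clm_apply hw2).sub (continuous_fst.mul hc1)
  have hsl : ∀ {F : ℝ → ℝ → ℝ}, Continuous (Function.uncurry F) → ∀ s, Continuous (F s) :=
    fun hF s => hF.comp (by fun_prop : Continuous fun θ => (s, θ))
  have hd0 : ∀ s θ, HasDerivAt (fun s => F0 s θ) (F1 s θ) s := fun s θ =>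
    (hD1 _).comp_hasDerivAt s (hps s θ)
  have hd1 : ∀ s θ, HasDerivAt (fun s => F1 s θ) (F2 s θ) s := fun s θ =>
    (ContinuousLinearMap.apply ℝ ℝ (v θ)).hasFDerivAt.comp_hasDerivAt s
      ((hD2 _).comp_hasDerivAt s (hps s θ))
  have hdT : ∀ s θ, HasDerivAt (T1 s) (T2 s θ) θ := fun s θ => by
    have h1 := ((hD2 _).comp_hasDerivAt θ (hpθ s θ)).clm_apply ((hvI θ).const_smul s)
    refine h1.congr_deriv ?_
    simp [T2, F1, sub_eq_add_neg]
  have hT2int : ∀ s, ∫ θ in (0 : ℝ)..2 * Real.pi, T2 s θ = 0 := fun s => by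
    rw [intervalIntegral.integral_eq_sub_of_hasDerivAt (fun θ _ => hdT s θ)
      ((hsl hcT2 s).intervalIntegrable _ _)]
    have hper : v (2 * Real.pi) = v 0 := by
      simp [v, Complex.exp_two_pi_mul_I]
    simp [T1, p, hper]
  let A : ℝ → ℝ := fun s => ∫ θ in (0 : ℝ)..2 * Real.pi, F0 s θ
  let A1 : ℝ → ℝ := fun s => ∫ θ in (0 : ℝ)..2 * Real.pi, F1 s θ
  let A2 : ℝ → ℝ := fun s => ∫ θ in (0 : ℝ)..2 * Real.pi, F2 s θ
  have hA : ∀ s, HasDerivAt A (A1 s) s := fun s =>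
    hasDerivAt_integral_of_continuous hc0 hc1 hd0 _ _ s
  have hA1 : ∀ s, HasDerivAt A1 (A2 s) s := fun s =>
    hasDerivAt_integral_of_continuous hc1 hc2 hd1 _ _ s
  have hv1 : ∀ θ, v θ = (Complex.exp (θ * Complex.I)) • w := fun _ => rfl
  have hkey : ∀ s ∈ Set.Icc (0 : ℝ) 1, 0 ≤ s ^ 2 * A2 s + s * A1 s := by
    intro s hs
    have e1 : s ^ 2 * A2 s + s * A1 s =
        ∫ θ in (0 : ℝ)..2 * Real.pi, (s ^ 2 * F2 s θ + s * F1 s θ + T2 s θ) := by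
      have i2 := (hsl hc2 s).intervalIntegrable (μ := MeasureTheory.volume) 0 (2 * Real.pi)
      have i1 := (hsl hc1 s).intervalIntegrable (μ := MeasureTheory.volume) 0 (2 * Real.pi)
      have iT := (hsl hcT2 s).intervalIntegrable (μ := MeasureTheory.volume) 0 (2 * Real.pi)
      rw [intervalIntegral.integral_add ((i2.const_mul _).add (i1.const_mul _)) iT, hT2int,
        intervalIntegral.integral_add (i2.const_mul _) (i1.const_mul _),
        intervalIntegral.integral_const_mul, intervalIntegral.integral_const_mul, add_zero]
    rw [e1]
    refine intervalIntegral.integral_nonneg (by positivity) fun θ _ => ?_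
    have hp : p s θ = z + ((s : ℂ) * Complex.exp (θ * Complex.I)) • w := by
      simp only [p, v, mul_smul]; rfl
    have h2 := h ((s : ℂ) * Complex.exp (θ * Complex.I)) (by
      rw [norm_mul, Complex.norm_exp_ofReal_mul_I, mul_one, Complex.norm_real, Real.norm_eq_abs,
        abs_of_nonneg hs.1]
      exact hs.2) (v θ)
    rw [← hp, leviL_self_re (hD2 _).differentiableAt] at h2
    have e2 : s ^ 2 * F2 s θ + s * F1 s θ + T2 s θ = s ^ 2 * (F2 s θ +
        fderiv ℝ (fderiv ℝ g) (p s θ) (Complex.I • v θ) (Complex.I • v θ)) := by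
      simp only [T2, map_smul, smul_apply, smul_eq_mul]
      ring
    rw [e2]
    refine mul_nonneg (sq_nonneg s) ?_
    simp only [F2]
    linarith
  have hB : ∀ s, HasDerivAt (fun s => s * A1 s) (A1 s + s * A2 s) s := fun s =>
    ((hasDerivAt_id s).mul (hA1 s)).congr_deriv (by simp)
  have hBmono : MonotoneOn (fun s => s * A1 s) (Set.Icc 0 1) := by
    refine monotoneOn_of_deriv_nonneg (convex_Icc 0 1)
      (fun s _ => (hB s).continuousAt.continuousWithinAt)
      (fun s _ => (hB s).differentiableAt.differentiableWithinAt) fun s hs => ?_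
    rw [interior_Icc] at hs
    rw [(hB s).deriv]
    have := hkey s ⟨hs.1.le, hs.2.le⟩
    have h3 : 0 ≤ s * (A1 s + s * A2 s) := by linarith
    exact nonneg_of_mul_nonneg_right h3 hs.1
  have hAmono : MonotoneOn A (Set.Icc 0 1) := by
    refine monotoneOn_of_deriv_nonneg (convex_Icc 0 1)
      (fun s _ => (hA s).continuousAt.continuousWithinAt)
      (fun s _ => (hA s).differentiableAt.differentiableWithinAt) fun s hs => ?_
    rw [interior_Icc] at hs
    rw [(hA s).deriv]
    have h3 := hBmono ⟨le_rfl, zero_le_one⟩ ⟨hs.1.le, hs.2.le⟩ hs.1.le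
    simp only [zero_mul] at h3
    exact nonneg_of_mul_nonneg_right h3 hs.1
  have h01 := hAmono ⟨le_rfl, zero_le_one⟩ ⟨zero_le_one, le_rfl⟩ zero_le_one
  have hA0 : A 0 = 2 * Real.pi * g z := by
    simp [A, F0, p]
  have hA1' : Real.circleAverage (fun t : ℂ => g (z + t • w)) 0 1 = (2 * Real.pi)⁻¹ * A 1 := by
    simp [Real.circleAverage_def, A, F0, p, v, circleMap]
  rw [hA1']
  rw [hA0] at h01
  have hpi : 0 < 2 * Real.pi := by positivity
  rw [inv_mul_eq_div, le_div_iff₀ hpi]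
  linarith

theorem plurisubharmonicOn_of_levi_nonneg {g : CSpace n → ℝ} (hg : ContDiff ℝ ∞ g)
    {D : Set (CSpace n)} (h : ∀ z ∈ D, ∀ Y, 0 ≤ (leviL g z Y Y).re) :
    PlurisubharmonicOn g D := by
  refine ⟨hg.continuous.upperSemicontinuous.upperSemicontinuousOn D, fun z w hzw => ⟨?_, ?_⟩⟩
  · have : Continuous fun t : ℂ => g (z + t • w) := hg.continuous.comp (by fun_prop)
    exact this.continuousOn.circleIntegrable'
  · exact le_circleAverage_of_levi_nonneg hg z w fun t ht => h _ (hzw t ht)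

/-- The maximum principle for continuous plurisubharmonic functions on holomorphic discs, derived
from the sub-mean value property on flat discs. If it failed, then
`u(A(t) + d) + ε|t|² - k|d|²` would have an interior maximum in `(t, d)`. Moving along the flat disc
tangent to `A` there keeps the penalty `k|d|²` constant up to the real part of a holomorphic function
of mean zero and an error of higher order, against the strict gain of `ε|t|²`. -/
theorem PlurisubharmonicOn.le_of_le_on_circle {u : CSpace n → ℝ} {Ω : Set (CSpace n)}
    (hΩ : IsOpen Ω) (hu : PlurisubharmonicOn u Ω) (hc : ContinuousOn u Ω) {A : ℂ → CSpace n}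
    {R : ℝ} (hR : 0 < R) {O : Set ℂ} (hO : IsOpen O) (hRO : Metric.closedBall 0 R ⊆ O)
    (hA : DifferentiableOn ℂ A O) (hmem : ∀ t : ℂ, ‖t‖ ≤ R → A t ∈ Ω) {M : ℝ}
    (hM : ∀ t : ℂ, ‖t‖ = R → u (A t) ≤ M) : u (A 0) ≤ M := by
  by_contra! hlt
  set e := (u (A 0) - M) / 4 with he
  have he0 : 0 < e := by rw [he]; linarith
  have hAc : ContinuousOn A (Metric.closedBall 0 R) := hA.continuousOn.mono hRO
  have hK : IsCompact (A '' Metric.closedBall 0 R) := (isCompact_closedBall 0 R).image_of_continuousOn hAc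
  have hKΩ : A '' Metric.closedBall 0 R ⊆ Ω := by
    rintro _ ⟨t, ht, rfl⟩
    exact hmem t (by simpa using ht)
  obtain ⟨δ, hδ, hδΩ⟩ := hK.exists_cthickening_subset_open hΩ hKΩ
  set S := Metric.cthickening δ (A '' Metric.closedBall 0 R)
  have hS : IsCompact S := hK.cthickening
  obtain ⟨δ', hδ', hunif⟩ := Metric.uniformContinuousOn_iff.1
    (hS.uniformContinuousOn_of_continuous (hc.mono hδΩ)) e he0
  set η := min δ (δ' / 2) with hη
  have hη0 : 0 < η := by rw [hη]; positivity
  have hmemS : ∀ t d, ‖t‖ ≤ R → ‖d‖ ≤ η → A t + d ∈ S := fun t d ht hd => by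
    refine Metric.mem_cthickening_of_dist_le (A t + d) (A t) δ _
      ⟨t, by simpa using ht, rfl⟩ ?_
    rw [dist_eq_norm, add_sub_cancel_left]
    exact hd.trans (min_le_left _ _)
  have hclose : ∀ t d, ‖t‖ ≤ R → ‖d‖ ≤ η → |u (A t + d) - u (A t)| < e := fun t d ht hd => by
    have h1 := hunif (A t + d) (hmemS t d ht hd) (A t)
      (by simpa using hmemS t 0 ht (by simpa using hη0.le)) (by
        rw [dist_eq_norm, add_sub_cancel_left]
        have := hd.trans (min_le_right _ _)
        linarith)
    rwa [Real.dist_eq] at h1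
  set k := e / η ^ 2 with hk
  have hk0 : 0 < k := by positivity
  set ε := e / R ^ 2 with hε
  have hε0 : 0 < ε := by positivity
  let Ξ : ℂ × CSpace n → ℝ := fun q => u (A q.1 + q.2) + ε * ‖q.1‖ ^ 2 - k * ‖q.2‖ ^ 2
  have hΞc : ContinuousOn Ξ (Metric.closedBall 0 R ×ˢ Metric.closedBall 0 η) := by
    have h1 : ContinuousOn (fun q : ℂ × CSpace n => u (A q.1 + q.2))
        (Metric.closedBall 0 R ×ˢ Metric.closedBall 0 η) := by
      refine (hc.mono hδΩ).comp (t := S) ?_ ?_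
      · exact (hAc.comp continuousOn_fst fun q hq => hq.1).add continuousOn_snd
      · rintro ⟨t, d⟩ ⟨ht, hd⟩
        exact hmemS t d (by simpa using ht) (by simpa using hd)
    exact (h1.add (by fun_prop)).sub (by fun_prop)
  obtain ⟨⟨t₀, d₀⟩, ⟨ht₀, hd₀⟩, hmax⟩ :=
    ((isCompact_closedBall (0 : ℂ) R).prod (isCompact_closedBall (0 : CSpace n) η)).exists_isMaxOn
      ⟨(0, 0), by simp [hR.le, hη0.le]⟩ hΞc
  have ht₀' : ‖t₀‖ ≤ R := by simpa using ht₀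
  have hd₀' : ‖d₀‖ ≤ η := by simpa using hd₀
  have hmax' : ∀ t d, ‖t‖ ≤ R → ‖d‖ ≤ η → Ξ (t, d) ≤ Ξ (t₀, d₀) := fun t d ht hd =>
    hmax ⟨by simpa using ht, by simpa using hd⟩
  have hd₀lt : ‖d₀‖ < η := by
    have h1 := hmax' t₀ 0 ht₀' (by simpa using hη0.le)
    have h2 := (abs_lt.1 (hclose t₀ d₀ ht₀' hd₀')).2
    simp only [Ξ, add_zero, norm_zero] at h1
    have h3 : k * ‖d₀‖ ^ 2 < k * η ^ 2 := by
      have : k * η ^ 2 = e := by rw [hk]; field_simp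
      rw [this]; linarith
    have h4 := lt_of_mul_lt_mul_left h3 hk0.le
    exact lt_of_pow_lt_pow_left₀ 2 hη0.le h4
  have ht₀lt : ‖t₀‖ < R := by
    refine lt_of_le_of_ne ht₀' fun heq => ?_
    have h1 := hmax' 0 0 (by simpa using hR.le) (by simpa using hη0.le)
    have h2 := (abs_lt.1 (hclose t₀ d₀ ht₀' hd₀')).2
    have h3 := hM t₀ heq
    simp only [Ξ, add_zero, norm_zero, heq] at h1
    have h4 : ε * R ^ 2 = e := by rw [hε]; field_simp
    have h5 : 0 ≤ k * ‖d₀‖ ^ 2 := by positivity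
    have h6 : u (A 0) = M + 4 * e := by rw [he]; ring
    rw [h4] at h1
    linarith
  -- The remainder of the first order expansion of `A` at `t₀`.
  have hAt : DifferentiableAt ℂ A t₀ := hA.differentiableAt (hO.mem_nhds (hRO ht₀))
  set a := deriv A t₀
  let Rem : ℂ → CSpace n := fun s => A (t₀ + s) - A t₀ - s • a
  set c := Real.sqrt (ε / (2 * k))
  have hc0 : 0 < c := by positivity
  have hc2 : k * c ^ 2 = ε / 2 := by
    rw [Real.sq_sqrt (by positivity)]; field_simp
  have hlo : ∀ᶠ s in 𝓝 (0 : ℂ), ‖Rem s‖ ≤ c * ‖s‖ :=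
    (hasDerivAt_iff_isLittleO_nhds_zero.1 hAt.hasDerivAt).bound hc0
  obtain ⟨η', hη', hlo'⟩ := Metric.eventually_nhds_iff.1 hlo
  obtain ⟨σ, hσ0, hσ1, hσ2, hσ3⟩ : ∃ σ > 0, σ < η' ∧ ‖t₀‖ + σ ≤ R ∧ ‖d₀‖ + c * σ ≤ η := by
    refine ⟨min (η' / 2) (min (R - ‖t₀‖) ((η - ‖d₀‖) / c)), ?_, ?_, ?_, ?_⟩
    · have := sub_pos.2 ht₀lt
      have := sub_pos.2 hd₀lt
      positivity
    · exact (min_le_left _ _).trans_lt (by linarith)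
    · have := (min_le_right (η' / 2) _).trans (min_le_left (R - ‖t₀‖) ((η - ‖d₀‖) / c))
      linarith
    · have := (min_le_right (η' / 2) _).trans (min_le_right (R - ‖t₀‖) ((η - ‖d₀‖) / c))
      rw [le_div_iff₀ hc0] at this
      linarith
  have hnσ : ∀ t : ℂ, ‖(σ : ℂ) * t‖ = σ * ‖t‖ := fun t => by
    rw [norm_mul, Complex.norm_real, Real.norm_eq_abs, abs_of_pos hσ0]
  have hRem : ∀ t : ℂ, ‖t‖ ≤ 1 → ‖Rem (σ * t)‖ ≤ c * σ := fun t ht => by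
    have h1 := hlo' (y := σ * t) (by
      rw [dist_zero_right, hnσ]; nlinarith)
    rw [hnσ] at h1
    refine h1.trans ?_
    gcongr
    nlinarith
  have hin : ∀ t : ℂ, ‖t‖ ≤ 1 → ‖t₀ + σ * t‖ ≤ R ∧ ‖d₀ - Rem (σ * t)‖ ≤ η := fun t ht => by
    constructor
    · refine (norm_add_le _ _).trans ?_
      rw [hnσ]; nlinarith
    · refine (norm_sub_le _ _).trans ?_
      linarith [hRem t ht]
  have hpt : ∀ t : ℂ, A t₀ + d₀ + t • ((σ : ℂ) • a) = A (t₀ + σ * t) + (d₀ - Rem (σ * t)) :=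
    fun t => by
      simp only [Rem, smul_smul, mul_comm t]; abel
  obtain ⟨hint, hmean⟩ := hu.2 (A t₀ + d₀) ((σ : ℂ) • a) fun t ht => by
    rw [hpt]
    exact hδΩ (hmemS _ _ (hin t ht).1 (hin t ht).2)
  let Hol : ℂ → ℂ := fun t => -(2 * ε * σ * (starRingEnd ℂ) t₀) * t
    - 2 * k * inner ℂ d₀ (Rem (σ * t))
  have hHol : DifferentiableOn ℂ Hol (Metric.closedBall 0 1) := by
    intro t ht
    have h1 : DifferentiableAt ℂ A (t₀ + σ * t) := by
      refine hA.differentiableAt (hO.mem_nhds (hRO ?_))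
      simpa using (hin t (by simpa using ht)).1
    have h2 : DifferentiableAt ℂ (fun t : ℂ => Rem (σ * t)) t := by
      have h3 : DifferentiableAt ℂ (fun t : ℂ => A (t₀ + σ * t)) t :=
        h1.comp t (f := fun t : ℂ => t₀ + σ * t) (by fun_prop)
      simp only [Rem]
      fun_prop
    have h4 : DifferentiableAt ℂ (fun t : ℂ => inner ℂ d₀ (Rem (σ * t))) t :=
      (innerSL ℂ d₀).differentiableAt.comp t h2
    exact (((differentiableAt_id.const_mul _).sub (h4.const_mul _))).differentiableWithinAt
  have hHolavg : Real.circleAverage (fun t => (Hol t).re) 0 1 = 0 := by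
    have hd : DiffContOnCl ℂ Hol (Metric.ball 0 |1|) := by
      rw [abs_one]
      exact (hHol.mono Metric.closure_ball_subset_closedBall).diffContOnCl
    have h1 := hd.circleAverage
    have hci : CircleIntegrable Hol 0 1 :=
      (hHol.continuousOn.mono (by simpa using Metric.sphere_subset_closedBall)).circleIntegrable'
    have h2 := Complex.reCLM.circleAverage_comp_comm hci
    rw [h1] at h2
    simpa [Hol, Rem, Function.comp_def] using h2
  have hci2 : CircleIntegrable (fun t => (Hol t).re) 0 1 := by
    refine ContinuousOn.circleIntegrable' ?_
    exact Complex.continuous_re.comp_continuousOn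
      (hHol.continuousOn.mono (by simpa using Metric.sphere_subset_closedBall))
  have hle : ∀ t ∈ Metric.sphere (0 : ℂ) |1|, u (A t₀ + d₀ + t • ((σ : ℂ) • a)) ≤
      (u (A t₀ + d₀) - ε * σ ^ 2 + k * (c * σ) ^ 2) + (Hol t).re := by
    intro t ht
    have ht1 : ‖t‖ = 1 := by simpa using ht
    obtain ⟨h1, h2⟩ := hin t ht1.le
    have h3 := hmax' _ _ h1 h2
    simp only [Ξ] at h3
    rw [hpt]
    have h4 : ‖t₀ + σ * t‖ ^ 2 = ‖t₀‖ ^ 2 + 2 * (σ * ((starRingEnd ℂ) t₀ * t).re) + σ ^ 2 := by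
      have h5 := norm_add_sq (𝕜 := ℂ) t₀ (σ * t)
      rw [hnσ, ht1, mul_one] at h5
      rw [h5]
      have : RCLike.re (inner ℂ t₀ ((σ : ℂ) * t)) = σ * ((starRingEnd ℂ) t₀ * t).re := by
        simp [RCLike.inner_apply]
        ring
      rw [this]
    have h6 : ‖d₀ - Rem (σ * t)‖ ^ 2 ≤
        ‖d₀‖ ^ 2 - 2 * (inner ℂ d₀ (Rem (σ * t)) : ℂ).re + (c * σ) ^ 2 := by
      have h7 := norm_sub_sq (𝕜 := ℂ) d₀ (Rem (σ * t))
      rw [h7]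
      have h8 := hRem t ht1.le
      have h9 : ‖Rem (σ * t)‖ ^ 2 ≤ (c * σ) ^ 2 := by gcongr
      simp only [RCLike.re_to_complex]
      linarith
    have h10 : (Hol t).re = -(2 * ε * (σ * ((starRingEnd ℂ) t₀ * t).re))
        - 2 * k * (inner ℂ d₀ (Rem (σ * t)) : ℂ).re := by
      simp [Hol]
      ring
    rw [h10]
    nlinarith
  have hci3 := (circleIntegrable_const (u (A t₀ + d₀) - ε * σ ^ 2 + k * (c * σ) ^ 2) (0 : ℂ) 1)
  have hav := Real.circleAverage_mono hint (hci3.add hci2) hle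
  have hsplit := Real.circleAverage_fun_add hci3 hci2
  rw [hHolavg, Real.circleAverage_const, add_zero] at hsplit
  have hfin := hmean.trans (hav.trans_eq hsplit)
  have : 0 < ε * σ ^ 2 := by positivity
  nlinarith

end Plurisubharmonic

/-! ### Pseudoconvexity and the Levi form -/

section Pseudoconvex

variable {n : ℕ}

theorem continuousOn_neg_log_infDist {Ω : Set (CSpace n)} (hΩ : IsOpen Ω)
    (hne : (frontier Ω).Nonempty) :
    ContinuousOn (fun z => -Real.log (Metric.infDist z (frontier Ω))) Ω := by
  refine ContinuousOn.neg (ContinuousOn.log (Metric.continuous_infDist_pt _).continuousOn ?_)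
  intro z hz
  refine ((isClosed_frontier.notMem_iff_infDist_pos hne).1 fun h => ?_).ne'
  rw [hΩ.frontier_eq] at h
  exact h.2 hz

theorem fderiv_delForm_smul {r : CSpace n → ℝ} {z : CSpace n} (t : ℂ) (X Y : CSpace n) :
    fderiv ℝ (delForm r) z (t • X) Y =
      t * (fderiv ℝ (delForm r) z X Y - leviL r z X Y) + (starRingEnd ℂ) t * leviL r z X Y := by
  have h1 : t • X = t.re • X + t.im • (Complex.I • X) := by
    conv_lhs => rw [← Complex.re_add_im t]
    rw [add_smul, mul_smul]; rfl
  rw [h1, map_add, map_smul, map_smul, add_apply, smul_apply, smul_apply, fderiv_delForm_I_smul,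
    Complex.real_smul, Complex.real_smul]
  have h2 : (starRingEnd ℂ) t = t.re - t.im * Complex.I := by
    apply Complex.ext <;> simp
  rw [h2]
  nth_rewrite 3 [← Complex.re_add_im t]
  ring

theorem exists_delForm_eq_one {r : CSpace n → ℝ} {z : CSpace n} (h : fderiv ℝ r z ≠ 0) :
    ∃ v, delForm r z v = 1 := by
  obtain ⟨X, hX⟩ : ∃ X, fderiv ℝ r z X ≠ 0 := by
    by_contra! hc
    exact h (by ext X; simpa using hc X)
  have hX' : delForm r z X ≠ 0 := fun h0 => hX (by rw [fderiv_eq_two_mul_re, h0]; simp)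
  exact ⟨(delForm r z X)⁻¹ • X, by rw [map_smul, smul_eq_mul, inv_mul_cancel₀ hX']⟩

set_option maxHeartbeats 1000000 in
/-- If the Levi form is negative in the complex tangential direction `X`, then a quadratic disc
tangent to `X` lies in `{ρ < 0}` but for its centre. -/
theorem exists_quadratic_disc {ρ : CSpace n → ℝ} {ζ : CSpace n} (hρ : ContDiffAt ℝ ∞ ρ ζ)
    (h0 : ρ ζ = 0) {v X : CSpace n} (hv : delForm ρ ζ v = 1) (hX : delForm ρ ζ X = 0)
    (hneg : (leviL ρ ζ X X).re < 0) :
    ∃ c : ℂ, ∃ κ > 0, ∀ᶠ t : ℂ in 𝓝 0, ρ (ζ + (t • X + t ^ 2 • c • v)) ≤ -κ * ‖t‖ ^ 2 := by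
  set L := (leviL ρ ζ X X).re with hL
  set Q := fderiv ℝ (delForm ρ) ζ X X - leviL ρ ζ X X with hQ
  set c := -Q / 2
  set M := ‖X‖ + ‖c • v‖ with hM
  have hM0 : 0 ≤ M := by positivity
  set H := fderiv ℝ (fderiv ℝ ρ) with hH
  have hH1 : ContDiffAt ℝ 1 (fderiv ℝ ρ) ζ := hρ.fderiv_right (by norm_cast)
  have hHc : ContinuousAt H ζ := (hH1.fderiv_right (m := 0) (by simp)).continuousAt
  set η := -L / (2 * (M ^ 2 + 1)) with hη
  have hη0 : 0 < η := by rw [hη]; apply div_pos (by linarith); positivity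
  have hev : ∀ᶠ y in 𝓝 ζ, ContDiffAt ℝ 2 ρ y ∧ ‖H y - H ζ‖ ≤ η := by
    have h2 : ContDiffAt ℝ 2 ρ ζ := hρ.of_le (by norm_cast)
    have h3 := hHc.eventually (Metric.closedBall_mem_nhds (H ζ) hη0)
    filter_upwards [h2.eventually (by simp), h3] with y h4 h5
    exact ⟨h4, (dist_eq_norm (H y) (H ζ)).symm.le.trans h5⟩
  obtain ⟨s, hs, hball⟩ := Metric.eventually_nhds_iff_ball.1 hev
  refine ⟨c, -L / 2, by linarith, ?_⟩
  have hsmall : ∀ᶠ t : ℂ in 𝓝 0, ‖t‖ < 1 ∧ M * ‖t‖ < s ∧ 4 * ‖H ζ‖ * M ^ 2 * ‖t‖ < -L := by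
    have h1 : Tendsto (fun t : ℂ => ‖t‖) (𝓝 0) (𝓝 0) := tendsto_norm_zero
    have h2 := h1.const_mul M
    have h3 := h1.const_mul (4 * ‖H ζ‖ * M ^ 2)
    rw [mul_zero] at h2 h3
    exact (h1.eventually_lt_const one_pos).and ((h2.eventually_lt_const hs).and
      (h3.eventually_lt_const (by linarith)))
  filter_upwards [hsmall] with t ⟨ht1, ht2, ht3⟩
  set h := t • X + t ^ 2 • c • v with hh
  have ht0 := norm_nonneg t
  have hd : ‖h - t • X‖ ≤ M * ‖t‖ ^ 2 := by
    rw [hh, add_sub_cancel_left, norm_smul, norm_pow]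
    have : ‖c • v‖ ≤ M := by rw [hM]; linarith [norm_nonneg X]
    nlinarith [sq_nonneg ‖t‖]
  have htX : ‖t • X‖ ≤ M * ‖t‖ := by
    rw [norm_smul]
    have : ‖X‖ ≤ M := by rw [hM]; linarith [norm_nonneg (c • v)]
    nlinarith
  have hhn : ‖h‖ ≤ M * ‖t‖ := by
    rw [hh]
    refine (norm_add_le _ _).trans ?_
    rw [norm_smul, norm_smul (t ^ 2), norm_pow]
    have : ‖t‖ ^ 2 ≤ ‖t‖ := by nlinarith
    have := mul_le_mul_of_nonneg_right this (norm_nonneg (c • v))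
    rw [hM]; linarith
  have hseg : ∀ θ ∈ Set.Icc (0 : ℝ) 1, ζ + θ • h ∈ Metric.ball ζ s := fun θ hθ => by
    rw [mem_ball_iff_norm, add_sub_cancel_left, norm_smul, Real.norm_eq_abs, abs_of_nonneg hθ.1]
    nlinarith [norm_nonneg h, hθ.2]
  obtain ⟨θ, hθ, htay⟩ := exists_taylor_two (x := ζ) (h := h) fun θ hθ => (hball _ (hseg θ hθ)).1
  have hHθ := (hball _ (hseg θ (Set.Ioo_subset_Icc_self hθ))).2
  set y := ζ + θ • h
  have e1 : fderiv ℝ ρ ζ h = 2 * (t ^ 2 * c).re := by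
    rw [fderiv_eq_two_mul_re, hh, map_add, map_smul, map_smul, map_smul, hX, hv]
    simp
  have e2 : H ζ (t • X) (t • X) = 2 * ((t ^ 2 * Q).re + ‖t‖ ^ 2 * L) := by
    rw [hH, hessian_eq_two_mul_re (hH1.differentiableAt (by simp)), map_smul, fderiv_delForm_smul,
      smul_eq_mul, ← hQ]
    have : t * (t * Q + (starRingEnd ℂ) t * leviL ρ ζ X X) =
        t ^ 2 * Q + ((‖t‖ ^ 2 : ℝ) : ℂ) * leviL ρ ζ X X := by
      rw [mul_add, ← mul_assoc t ((starRingEnd ℂ) t), Complex.mul_conj, Complex.normSq_eq_norm_sq]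
      ring
    rw [this, Complex.add_re, Complex.re_ofReal_mul]
  have e3 : |H y h h - H ζ (t • X) (t • X)| ≤ -L * ‖t‖ ^ 2 := by
    have split : H y h h - H ζ (t • X) (t • X) =
        (H y - H ζ) h h + (H ζ (h - t • X) h + H ζ (t • X) (h - t • X)) := by
      simp only [sub_apply, map_sub]; ring
    rw [split]
    have b1 : |(H y - H ζ) h h| ≤ η * (M * ‖t‖) * (M * ‖t‖) :=
      (H y - H ζ).le_of_opNorm₂_le_of_le hHθ hhn hhn
    have b2 : |H ζ (h - t • X) h| ≤ ‖H ζ‖ * (M * ‖t‖ ^ 2) * (M * ‖t‖) :=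
      (H ζ).le_of_opNorm₂_le_of_le le_rfl hd hhn
    have b3 : |H ζ (t • X) (h - t • X)| ≤ ‖H ζ‖ * (M * ‖t‖) * (M * ‖t‖ ^ 2) :=
      (H ζ).le_of_opNorm₂_le_of_le le_rfl htX hd
    have b4 : η * M ^ 2 ≤ -L / 2 := by
      rw [hη, div_mul_eq_mul_div, div_le_div_iff₀ (by positivity) (by norm_num)]
      nlinarith
    have b6 := mul_le_mul_of_nonneg_right b4 (sq_nonneg ‖t‖)
    have b7 := mul_le_mul_of_nonneg_right ht3.le (sq_nonneg ‖t‖)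
    generalize (H y - H ζ) h h = p1 at b1 ⊢
    generalize H ζ (h - t • X) h = p2 at b2 ⊢
    generalize H ζ (t • X) (h - t • X) = p3 at b3 ⊢
    rw [abs_le] at b1 b2 b3 ⊢
    constructor <;> linarith
  rw [htay, h0, e1]
  have e4 := (abs_le.1 e3).2
  rw [e2] at e4
  have e5 : (t ^ 2 * c).re = -(t ^ 2 * Q).re / 2 := by
    have : t ^ 2 * c = -(t ^ 2 * Q) / 2 := by simp only [c]; ring
    rw [this]; simp
  rw [e5]
  simp only [hH] at e4 ⊢
  nlinarith

/-- **Levi's theorem.** In holomorphic coordinates `Θ` in which `ρ` is a defining function at `ζ`,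
the Levi form of a pseudoconvex domain is nonnegative on the complex tangent space. Otherwise the
inward translates of a quadratic disc violate the maximum principle for `-log dist`. -/
theorem levi_nonneg_of_pseudoconvex {Ω : Set (CSpace n)} (hΩ : IsOpen Ω) (hp : IsPseudoconvex Ω)
    {Θ : CSpace n → CSpace n} {ρ : CSpace n → ℝ} {ζ : CSpace n}
    (hΘ : ∀ᶠ y in 𝓝 ζ, DifferentiableAt ℂ Θ y) (hρ : ContDiffAt ℝ ∞ ρ ζ)
    (hin : ∀ᶠ y in 𝓝 ζ, ρ y < 0 → Θ y ∈ Ω) (hfr : Θ ζ ∈ frontier Ω) (h0 : ρ ζ = 0)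
    (hd : fderiv ℝ ρ ζ ≠ 0) {X : CSpace n} (hX : delForm ρ ζ X = 0) :
    0 ≤ (leviL ρ ζ X X).re := by
  by_contra! hneg
  obtain ⟨v, hv⟩ := exists_delForm_eq_one hd
  obtain ⟨c, κ, hκ, hdisc⟩ := exists_quadratic_disc hρ h0 hv hX hneg
  let h : ℂ → CSpace n := fun t => t • X + t ^ 2 • c • v
  have hhd : Differentiable ℂ h := by fun_prop
  have hderiv : ∀ᶠ y in 𝓝 ζ, DifferentiableAt ℝ ρ y ∧ 0 < fderiv ℝ ρ y v := by
    have h1 : ContDiffAt ℝ 1 ρ ζ := hρ.of_le (by norm_cast)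
    have h2 : ContinuousAt (fun y => fderiv ℝ ρ y v) ζ :=
      (h1.fderiv_right (m := 0) (by simp)).continuousAt.clm_apply continuousAt_const
    have h3 : 0 < fderiv ℝ ρ ζ v := by rw [fderiv_eq_two_mul_re, hv]; simp
    filter_upwards [h1.eventually (by simp), h2.eventually_const_lt h3] with y h4 h5
    exact ⟨h4.differentiableAt (by simp), h5⟩
  obtain ⟨s, hs, hball⟩ := Metric.eventually_nhds_iff_ball.1 (hΘ.and (hin.and hderiv))
  -- The discs `t ↦ ζ + h t - ε v` for `‖t‖ ≤ t₀`, `0 ≤ ε ≤ ε₀` stay in the good neighbourhood.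
  have hh0 : Tendsto h (𝓝 0) (𝓝 0) := by
    have := hhd.continuous.tendsto 0
    simpa [h] using this
  obtain ⟨t₁, ht₁, htt⟩ := Metric.eventually_nhds_iff_ball.1
    (hdisc.and (hh0.norm.eventually_lt_const (by simpa using half_pos hs : ‖(0 : CSpace n)‖ < s / 2)))
  set t₀ := t₁ / 2 with ht₀
  have ht₀0 : 0 < t₀ := by positivity
  have htb : ∀ t : ℂ, ‖t‖ ≤ t₀ → ρ (ζ + h t) ≤ -κ * ‖t‖ ^ 2 ∧ ‖h t‖ < s / 2 := fun t ht =>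
    htt t (by rw [mem_ball_zero_iff]; linarith)
  set ε₀ := s / (2 * (‖v‖ + 1)) with hε₀
  have hε₀0 : 0 < ε₀ := by positivity
  have hεv : ∀ ε : ℝ, 0 ≤ ε → ε ≤ ε₀ → ‖ε • v‖ < s / 2 := fun ε h1 h2 => by
    rw [norm_smul, Real.norm_eq_abs, abs_of_nonneg h1]
    have h3 : ε₀ * (‖v‖ + 1) = s / 2 := by rw [hε₀]; field_simp
    nlinarith [norm_nonneg v]
  have hmemb : ∀ t : ℂ, ‖t‖ ≤ t₀ → ∀ ε : ℝ, 0 ≤ ε → ε ≤ ε₀ →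
      ζ + h t - ε • v ∈ Metric.ball ζ s := fun t ht ε h1 h2 => by
    rw [mem_ball_iff_norm, show ζ + h t - ε • v - ζ = h t - ε • v by abel]
    refine (norm_sub_le _ _).trans_lt ?_
    linarith [(htb t ht).2, hεv ε h1 h2]
  have hneg' : ∀ t : ℂ, ‖t‖ ≤ t₀ → ∀ ε : ℝ, 0 ≤ ε → ε ≤ ε₀ → (0 < ε ∨ 0 < ‖t‖) →
      ρ (ζ + h t - ε • v) < 0 := by
    intro t ht ε h1 h2 h3
    have h4 := (htb t ht).1
    rcases h1.eq_or_lt with rfl | h5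
    · have h6 : 0 < ‖t‖ := by simpa using h3
      rw [zero_smul, sub_zero]
      have : 0 < κ * ‖t‖ ^ 2 := by positivity
      linarith
    · have hmd : ∀ s ∈ Set.Icc (0 : ℝ) ε, HasDerivAt (fun s : ℝ => ρ (ζ + h t - s • v))
          (-fderiv ℝ ρ (ζ + h t - s • v) v) s := fun s hs => by
        have h6 := (hball _ (hmemb t ht s hs.1 (hs.2.trans h2))).2.2.1.hasFDerivAt
        have h7 : HasDerivAt (fun s : ℝ => ζ + h t - s • v) (-v) s := by
          have := ((hasDerivAt_id s).smul_const v).const_sub (ζ + h t)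
          rwa [one_smul] at this
        have h8 := h6.comp_hasDerivAt s h7
        rwa [map_neg] at h8
      obtain ⟨ξ, hξ, hξ'⟩ := exists_hasDerivAt_eq_slope _ _ h5
        (fun s hs => (hmd s hs).continuousAt.continuousWithinAt)
        (fun s hs => hmd s (Set.Ioo_subset_Icc_self hs))
      have h6 := (hball _ (hmemb t ht ξ hξ.1.le (hξ.2.le.trans h2))).2.2.2
      rw [eq_div_iff (by linarith), zero_smul, sub_zero, sub_zero] at hξ'
      have : 0 ≤ κ * ‖t‖ ^ 2 := by positivity
      nlinarith
  have hinΩ : ∀ t : ℂ, ‖t‖ ≤ t₀ → ∀ ε : ℝ, 0 ≤ ε → ε ≤ ε₀ → (0 < ε ∨ 0 < ‖t‖) →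
      Θ (ζ + h t - ε • v) ∈ Ω := fun t ht ε h1 h2 h3 =>
    (hball _ (hmemb t ht ε h1 h2)).2.1 (hneg' t ht ε h1 h2 h3)
  set u := fun z => -Real.log (Metric.infDist z (frontier Ω)) with hu
  have huc : ContinuousOn u Ω := continuousOn_neg_log_infDist hΩ ⟨_, hfr⟩
  -- The boundaries of the discs stay in a compact part of `Ω`.
  obtain ⟨M, hM⟩ : ∃ M, ∀ t : ℂ, ‖t‖ = t₀ → ∀ ε : ℝ, 0 ≤ ε → ε ≤ ε₀ →
      u (Θ (ζ + h t - ε • v)) ≤ M := by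
    have hcomp : IsCompact (Metric.sphere (0 : ℂ) t₀ ×ˢ Set.Icc 0 ε₀) :=
      (isCompact_sphere 0 t₀).prod isCompact_Icc
    have hcont : ContinuousOn (fun q : ℂ × ℝ => u (Θ (ζ + h q.1 - q.2 • v)))
        (Metric.sphere (0 : ℂ) t₀ ×ˢ Set.Icc 0 ε₀) := by
      refine ContinuousOn.comp (g := u) (t := Ω) huc ?_ ?_
      · intro q hq
        have hq1 : ‖q.1‖ = t₀ := by simpa using hq.1
        have h1 := (hball _ (hmemb q.1 hq1.le q.2 hq.2.1 hq.2.2)).1.continuousAt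
        refine (ContinuousAt.comp (f := fun q : ℂ × ℝ => ζ + h q.1 - q.2 • v) h1
          ?_).continuousWithinAt
        have := hhd.continuous
        fun_prop
      · intro q hq
        have hq1 : ‖q.1‖ = t₀ := by simpa using hq.1
        exact hinΩ q.1 hq1.le q.2 hq.2.1 hq.2.2 (Or.inr (by rw [hq1]; exact ht₀0))
    obtain ⟨M, hM⟩ := hcomp.bddAbove_image hcont
    exact ⟨M, fun t ht ε h1 h2 => hM ⟨(t, ε), ⟨by simpa using ht, h1, h2⟩, rfl⟩⟩
  have hcenter : ∀ ε : ℝ, 0 < ε → ε ≤ ε₀ → u (Θ (ζ - ε • v)) ≤ M := by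
    intro ε h1 h2
    have hO : IsOpen {t : ℂ | ζ + h t - ε • v ∈ Metric.ball ζ s} :=
      Metric.isOpen_ball.preimage (by have := hhd.continuous; fun_prop)
    have := hp.le_of_le_on_circle hΩ huc (A := fun t => Θ (ζ + h t - ε • v)) ht₀0 hO
      (fun t ht => hmemb t (by simpa using ht) ε h1.le h2)
      (fun t ht => by
        have h3 := (hball _ ht).1
        exact (h3.comp t (f := fun t => ζ + h t - ε • v) (by fun_prop)).differentiableWithinAt)
      (fun t ht => hinΩ t ht ε h1.le h2 (Or.inl h1))
      (fun t ht => hM t ht ε h1.le h2)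
    simpa [h] using this
  -- The centres tend to the boundary.
  have htend : Tendsto (fun ε : ℝ => dist (Θ (ζ - ε • v)) (Θ ζ)) (𝓝[>] 0) (𝓝 0) := by
    have h1 : ContinuousAt Θ ζ := (hball ζ (Metric.mem_ball_self hs)).1.continuousAt
    have h2 : Tendsto (fun ε : ℝ => ζ - ε • v) (𝓝[>] 0) (𝓝 ζ) := by
      have : Continuous fun ε : ℝ => ζ - ε • v := by fun_prop
      simpa using (this.tendsto 0).mono_left nhdsWithin_le_nhds
    exact tendsto_iff_dist_tendsto_zero.1 (h1.tendsto.comp h2)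
  have hev := htend.eventually_lt_const (Real.exp_pos (-M))
  obtain ⟨ε, hε1, hε2, hε3⟩ := (hev.and ((Ioc_mem_nhdsGT hε₀0))).exists
  have h1 := hcenter ε hε2 hε3
  have h2 : Metric.infDist (Θ (ζ - ε • v)) (frontier Ω) < Real.exp (-M) :=
    (Metric.infDist_le_dist_of_mem hfr).trans_lt hε1
  have h3 : 0 < Metric.infDist (Θ (ζ - ε • v)) (frontier Ω) := by
    refine (isClosed_frontier.notMem_iff_infDist_pos ⟨_, hfr⟩).1 fun hmem => ?_
    rw [hΩ.frontier_eq] at hmem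
    have := hinΩ 0 (by simpa using ht₀0.le) ε hε2.le hε3 (Or.inl hε2)
    simp only [h, zero_smul, ne_eq, OfNat.ofNat_ne_zero, not_false_eq_true, zero_pow, add_zero]
      at this
    exact hmem.2 this
  have h4 := (Real.log_lt_iff_lt_exp h3).2 h2
  simp only [hu] at h1
  linarith

end Pseudoconvex

/-! ### Defining functions that are graphs -/

section Graph

variable {P X : Type*} [NormedAddCommGroup P] [NormedSpace ℝ P] [CompleteSpace P]
  [NormedAddCommGroup X] [NormedSpace ℝ X] [CompleteSpace X]

/-- If `G` increases in the direction `v` of the second variable, then its zero set is the graph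
`{s = 0}` of a function `s` whose level sets are translates of each other along `v`. -/
theorem exists_graph_function {G : P × X → ℝ} {u : P × X} {v : X} (hG : SmoothNear G u)
    (h0 : G u = 0) (hv : 0 < fderiv ℝ G u (0, v)) :
    ∃ s : P × X → ℝ, SmoothNear s u ∧ s u = 0 ∧
      (∀ᶠ q in 𝓝 u, G (q.1, q.2 - s q • v) = 0) ∧
      (∀ᶠ q in 𝓝 u, (G q < 0 ↔ s q < 0) ∧ (G q = 0 ↔ s q = 0)) ∧
      ∀ᶠ q : (P × X) × ℝ in 𝓝 (u, 0), s (q.1.1, q.1.2 + q.2 • v) = s q.1 + q.2 := by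
  let sh : (P × X) × ℝ → P × X := fun q => (q.1.1, q.1.2 - q.2 • v)
  have hsh : ContDiff ℝ ∞ sh := by fun_prop
  have hsh0 : sh (u, 0) = u := by simp [sh]
  have hF : SmoothNear (fun q => G (sh q)) (u, (0 : ℝ)) :=
    SmoothNear.comp (by rw [hsh0]; exact hG) (hsh.smoothNear _)
  have hder : fderiv ℝ (fun q => G (sh q)) (u, (0 : ℝ)) ∘L .inr ℝ (P × X) ℝ =
      ContinuousLinearEquiv.unitsEquivAut ℝ (Units.mk0 (-fderiv ℝ G u (0, v))
        (neg_ne_zero.2 hv.ne')) := by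
    have h1 : HasFDerivAt G (fderiv ℝ G u) (sh (u, 0)) := by
      rw [hsh0]; exact (hG.contDiffAt.differentiableAt (by simp)).hasFDerivAt
    have h2 := (hsh.differentiable (by simp) (u, (0 : ℝ))).hasFDerivAt
    have h3 := h1.comp (u, (0 : ℝ)) h2
    have h4 : fderiv ℝ sh (u, (0 : ℝ)) (0, 1) = (0, -v) := by
      have h5 : HasDerivAt (fun t : ℝ => sh (u, t)) ((0, -v) : P × X) 0 := by
        have h6 := ((hasDerivAt_id (0 : ℝ)).smul_const v).const_sub u.2
        rw [one_smul] at h6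
        exact (hasDerivAt_const (0 : ℝ) u.1).prodMk h6
      have h7 : HasDerivAt (fun t : ℝ => (u, t)) ((0 : P × X), (1 : ℝ)) 0 :=
        (hasDerivAt_const (0 : ℝ) u).prodMk (hasDerivAt_id _)
      exact (h2.comp_hasDerivAt (0 : ℝ) h7).unique h5
    rw [show fderiv ℝ (fun q => G (sh q)) (u, (0 : ℝ)) = _ from h3.fderiv]
    ext
    simp only [ContinuousLinearMap.comp_apply, ContinuousLinearMap.inr_apply, h4]
    rw [show ((0 : P), -v) = -((0 : P), v) by simp, map_neg]
    simp
  obtain ⟨s, hs, hsu, hz, huniq⟩ := exists_smooth_implicitFunction hF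
    (by simpa [hsh0] using h0) (by rw [hder]; exact ⟨_, rfl⟩)
  -- On a ball, `G` is strictly increasing along `v`.
  have hpos : ∀ᶠ q in 𝓝 u, DifferentiableAt ℝ G q ∧ 0 < fderiv ℝ G q (0, v) := by
    have h1 : ContinuousAt (fun q => fderiv ℝ G q (0, v)) u :=
      ((hG.contDiffAt.fderiv_right (m := 0) (by simp)).continuousAt).clm_apply continuousAt_const
    filter_upwards [hG, h1.eventually_const_lt hv] with q h2 h3
    exact ⟨h2.differentiableAt (by simp), h3⟩
  obtain ⟨ε, hε, hball⟩ := Metric.eventually_nhds_iff_ball.1 hpos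
  have hmono : ∀ (p : P) (x : X) (t : ℝ), (p, x) ∈ Metric.ball u ε →
      (p, x + t • v) ∈ Metric.ball u ε → 0 < t → G (p, x) < G (p, x + t • v) := by
    intro p x t h1 h2 ht
    have hmem : ∀ a ∈ Set.Icc (0 : ℝ) t, (p, x + a • v) ∈ Metric.ball u ε := by
      intro a ha
      have h3 := (convex_ball u ε).add_smul_mem (x := (p, x)) (y := (0, t • v)) h1
        (by simpa using h2) (t := a / t) ⟨div_nonneg ha.1 ht.le, (div_le_one ht).2 ha.2⟩
      have : a / t * t = a := by field_simp
      simpa [smul_smul, this] using h3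
    have hd : ∀ a ∈ Set.Icc (0 : ℝ) t, HasDerivAt (fun a : ℝ => G (p, x + a • v))
        (fderiv ℝ G (p, x + a • v) (0, v)) a := by
      intro a ha
      have h4 : HasDerivAt (fun a : ℝ => (p, x + a • v)) ((0 : P), v) a := by
        have h6 := ((hasDerivAt_id a).smul_const v).const_add x
        rw [one_smul] at h6
        exact (hasDerivAt_const a p).prodMk h6
      exact (hball _ (hmem a ha)).1.hasFDerivAt.comp_hasDerivAt a h4
    obtain ⟨ξ, hξ, hξ'⟩ := exists_hasDerivAt_eq_slope _ _ ht
      (fun a ha => (hd a ha).continuousAt.continuousWithinAt)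
      (fun a ha => hd a (Set.Ioo_subset_Icc_self ha))
    rw [eq_div_iff (by linarith), zero_smul, sub_zero, add_zero] at hξ'
    have := (hball _ (hmem ξ (Set.Ioo_subset_Icc_self hξ))).2
    nlinarith
  have hmono' : ∀ (p : P) (x : X) (t : ℝ), (p, x) ∈ Metric.ball u ε →
      (p, x + t • v) ∈ Metric.ball u ε → (0 < t → G (p, x) < G (p, x + t • v)) ∧
        (t < 0 → G (p, x + t • v) < G (p, x)) := by
    intro p x t h1 h2
    refine ⟨hmono p x t h1 h2, fun ht => ?_⟩
    have := hmono p (x + t • v) (-t) h2 (by simpa using h1) (by linarith)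
    simpa using this
  have hb : ∀ᶠ q in 𝓝 u, q ∈ Metric.ball u ε := Metric.ball_mem_nhds u hε
  have hshift : ∀ᶠ q in 𝓝 u, (q.1, q.2 - s q • v) ∈ Metric.ball u ε := by
    have h1 : ContinuousAt (fun q : P × X => (q.1, q.2 - s q • v)) u := by
      have := hs.continuousAt
      fun_prop
    refine h1.eventually ?_
    simpa [hsu] using hb
  refine ⟨s, hs, hsu, hz, ?_, ?_⟩
  · filter_upwards [hz, hb, hshift] with q h1 h2 h3
    have h4 := hmono' q.1 (q.2 - s q • v) (s q) h3 (by simpa using h2)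
    simp only [sub_add_cancel, Prod.mk.eta] at h4
    simp only [sh] at h1
    rw [h1] at h4
    rcases lt_trichotomy (s q) 0 with h5 | h5 | h5
    · have h6 := h4.2 h5
      exact ⟨⟨fun _ => h5, fun _ => h6⟩, ⟨fun h => absurd h h6.ne, fun h => absurd h h5.ne⟩⟩
    · have h6 : G q = 0 := by
        rw [h5, zero_smul, sub_zero] at h1; exact h1
      simp [h5, h6]
    · have h6 := h4.1 h5
      exact ⟨⟨fun h => absurd h h6.not_gt, fun h => absurd h h5.not_gt⟩,
        ⟨fun h => absurd h h6.ne', fun h => absurd h h5.ne'⟩⟩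
  · have hc1 : Tendsto (fun q : (P × X) × ℝ => (q.1.1, q.1.2 + q.2 • v)) (𝓝 (u, 0)) (𝓝 u) := by
      have : Continuous (fun q : (P × X) × ℝ => (q.1.1, q.1.2 + q.2 • v)) := by fun_prop
      simpa using this.tendsto (u, 0)
    have hc2 : Tendsto (fun q : (P × X) × ℝ => q.1) (𝓝 (u, 0)) (𝓝 u) :=
      (continuous_fst.tendsto (u, (0 : ℝ)))
    filter_upwards [hc1.eventually (hz.and hshift), hc2.eventually (hz.and hshift)]
      with q ⟨h1, h2⟩ ⟨h3, h4⟩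
    obtain ⟨⟨p, x⟩, t⟩ := q
    simp only [sh] at h1 h2 h3 h4 ⊢
    set a := s (p, x)
    set b := s (p, x + t • v)
    have h5 : x + t • v - b • v = (x - a • v) + (t + a - b) • v := by
      rw [sub_smul, add_smul]; abel
    rw [h5] at h1 h2
    have h6 := hmono' p (x - a • v) (t + a - b) h4 h2
    rw [h1, h3] at h6
    rcases lt_trichotomy (t + a - b) 0 with h7 | h7 | h7
    · exact absurd (h6.2 h7) (lt_irrefl 0)
    · linarith
    · exact absurd (h6.1 h7) (lt_irrefl 0)

end Graph

section LocalDefining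

variable {n : ℕ}

/-- The Levi nullspace in terms of `delForm` and `leviL`. -/
def nullSpace (r : CSpace n → ℝ) (z : CSpace n) : Submodule ℂ (CSpace n) where
  carrier := {X | delForm r z X = 0 ∧ ∀ Y, delForm r z Y = 0 → leviL r z Y X = 0}
  zero_mem' := by simp
  add_mem' := by
    rintro X X' ⟨h1, h2⟩ ⟨h3, h4⟩
    exact ⟨by simp [h1, h3], fun Y hY => by simp [h2 Y hY, h4 Y hY]⟩
  smul_mem' := by
    rintro c X ⟨h1, h2⟩
    exact ⟨by simp [h1], fun Y hY => by simp [h2 Y hY]⟩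

theorem mem_nullSpace {r : CSpace n → ℝ} {z X : CSpace n} : X ∈ nullSpace r z ↔
    delForm r z X = 0 ∧ ∀ Y, delForm r z Y = 0 → leviL r z Y X = 0 := Iff.rfl

theorem leviNullspace_eq {r : CSpace n → ℝ} {z : CSpace n} (hr : ContDiffAt ℝ 2 r z) :
    leviNullspace r z = nullSpace r z := by
  have hd : DifferentiableAt ℝ r z := hr.differentiableAt (by simp)
  ext X
  change (delPairing r z X = 0 ∧ ∀ Y, delPairing r z Y = 0 → leviForm r z X Y = 0) ↔ _
  simp only [mem_nullSpace, delPairing_eq hd, leviForm_eq hr]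

theorem finrank_complexTangent {r : CSpace n → ℝ} {z : CSpace n} (hr : DifferentiableAt ℝ r z)
    (h : fderiv ℝ r z ≠ 0) : Module.finrank ℂ (complexTangent r z) + 1 = n := by
  obtain ⟨v, hv⟩ := exists_delForm_eq_one h
  have h1 : complexTangent r z = LinearMap.ker (delForm r z : CSpace n →ₗ[ℂ] ℂ) := by
    ext X
    change delPairing r z X = 0 ↔ _
    rw [delPairing_eq hr]; rfl
  have h2 := LinearMap.finrank_range_add_finrank_ker (delForm r z : CSpace n →ₗ[ℂ] ℂ)
  have h3 : LinearMap.range (delForm r z : CSpace n →ₗ[ℂ] ℂ) = ⊤ := by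
    rw [LinearMap.range_eq_top]
    intro c
    exact ⟨c • v, by simp [hv]⟩
  rw [h3, finrank_top, Module.finrank_self, finrank_euclideanSpace_fin] at h2
  rw [h1]; omega

/-- Near a smooth boundary point there is a defining function with `r(z + tv) = r(z) + t`. -/
theorem exists_local_defining_function {Ω V : Set (CSpace n)} {z₀ : CSpace n}
    (hz₀ : z₀ ∈ frontier Ω ∩ V) (hs : SmoothBoundaryIn Ω V) :
    ∃ (r : CSpace n → ℝ) (v : CSpace n), ContDiff ℝ ∞ r ∧ r z₀ = 0 ∧
      (∀ᶠ z in 𝓝 z₀, (r z < 0 ↔ z ∈ Ω) ∧ (r z = 0 ↔ z ∈ frontier Ω)) ∧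
      ∀ᶠ q : CSpace n × ℝ in 𝓝 (z₀, 0), r (q.1 + q.2 • v) = r q.1 + q.2 := by
  obtain ⟨N, r₀, hzN, hN⟩ := hs z₀ hz₀
  have hr₀ : SmoothNear r₀ z₀ := by
    filter_upwards [hN.isOpen.mem_nhds hzN] with y hy
    exact hN.smooth.contDiffAt (hN.isOpen.mem_nhds hy)
  obtain ⟨v, hv⟩ : ∃ v, 0 < fderiv ℝ r₀ z₀ v := by
    obtain ⟨X, hX⟩ : ∃ X, fderiv ℝ r₀ z₀ X ≠ 0 := by
      by_contra! hc
      exact hN.fderiv_ne z₀ hzN hz₀.1 (by ext X; simpa using hc X)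
    rcases lt_or_gt_of_ne hX with h | h
    · exact ⟨-X, by simpa using h⟩
    · exact ⟨X, h⟩
  have hG : SmoothNear (fun q : ℝ × CSpace n => r₀ q.2) (0, z₀) :=
    SmoothNear.comp (f := fun q : ℝ × CSpace n => q.2) hr₀ (contDiff_snd.smoothNear _)
  obtain ⟨s, hs1, hs2, -, hs4, hs5⟩ := exists_graph_function (v := v) hG
    ((hN.zero_iff z₀ hzN).2 hz₀.1) (by
      have h1 : HasFDerivAt (fun q : ℝ × CSpace n => r₀ q.2)
          (fderiv ℝ r₀ z₀ ∘L .snd ℝ ℝ (CSpace n)) (0, z₀) :=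
        (hr₀.contDiffAt.differentiableAt (by simp)).hasFDerivAt.comp ((0 : ℝ), z₀) hasFDerivAt_snd
      rw [h1.fderiv]
      simpa using hv)
  have hin : Tendsto (fun z : CSpace n => ((0 : ℝ), z)) (𝓝 z₀) (𝓝 (0, z₀)) :=
    (by fun_prop : Continuous fun z : CSpace n => ((0 : ℝ), z)).tendsto z₀
  have hs1' : SmoothNear (fun z => s (0, z)) z₀ :=
    SmoothNear.comp (f := fun z : CSpace n => ((0 : ℝ), z)) hs1
      ((contDiff_const.prodMk contDiff_id).smoothNear _)
  obtain ⟨r, hr, hrs⟩ := hs1'.exists_contDiff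
  refine ⟨r, v, hr, hrs.self_of_nhds.trans hs2, ?_, ?_⟩
  · filter_upwards [hrs, hin.eventually hs4, hN.isOpen.mem_nhds hzN] with z h1 h2 h3
    rw [h1, ← h2.1, ← h2.2, hN.neg_iff z h3, hN.zero_iff z h3]
    exact ⟨Iff.rfl, Iff.rfl⟩
  · have h1 : Tendsto (fun q : CSpace n × ℝ => (((0 : ℝ), q.1), q.2)) (𝓝 (z₀, 0))
        (𝓝 (((0 : ℝ), z₀), 0)) :=
      (by fun_prop : Continuous fun q : CSpace n × ℝ => (((0 : ℝ), q.1), q.2)).tendsto (z₀, 0)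
    have h2 : Tendsto (fun q : CSpace n × ℝ => q.1 + q.2 • v) (𝓝 (z₀, 0)) (𝓝 z₀) := by
      have : Continuous fun q : CSpace n × ℝ => q.1 + q.2 • v := by fun_prop
      simpa using this.tendsto (z₀, 0)
    have h3 : Tendsto (fun q : CSpace n × ℝ => q.1) (𝓝 (z₀, 0)) (𝓝 z₀) :=
      continuous_fst.tendsto (z₀, (0 : ℝ))
    filter_upwards [h1.eventually hs5, h2.eventually hrs, h3.eventually hrs] with q h4 h5 h6
    rw [h5, h6, h4]

variable {r : CSpace n → ℝ} {v z₀ : CSpace n}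

/-- The level sets of `r` are translates of each other, with the same forms. -/
theorem eventually_forms_translate (hr : ContDiff ℝ ∞ r) (hr0 : r z₀ = 0)
    (ht : ∀ᶠ q : CSpace n × ℝ in 𝓝 (z₀, 0), r (q.1 + q.2 • v) = r q.1 + q.2) :
    ∀ᶠ z in 𝓝 z₀, r (z - r z • v) = 0 ∧ delForm r (z - r z • v) = delForm r z ∧
      leviL r (z - r z • v) = leviL r z := by
  have h1 : Tendsto (fun z => (z, -r z)) (𝓝 z₀) (𝓝 (z₀, 0)) := by
    have : Continuous fun z => (z, -r z) := by have := hr.continuous; fun_prop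
    simpa [hr0] using this.tendsto z₀
  filter_upwards [h1.eventually ht.eventually_nhds] with z hz
  have hz0 := hz.self_of_nhds
  set t := -r z with ht'
  have e1 : z - r z • v = z + t • v := by rw [ht', neg_smul, sub_eq_add_neg]
  have hev : ∀ᶠ y in 𝓝 z, r (y + t • v) = r y + t :=
    ((continuous_id.prodMk continuous_const).tendsto z).eventually hz
  have e2 : (fun y => fderiv ℝ r (y + t • v)) =ᶠ[𝓝 z] fderiv ℝ r := by
    filter_upwards [hev.eventually_nhds] with y hy
    have h2 : fderiv ℝ (fun y => r (y + t • v)) y = fderiv ℝ (fun y => r y + t) y :=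
      Filter.EventuallyEq.fderiv_eq hy
    rwa [fderiv_comp_add_right, fderiv_add_const] at h2
  have e3 : (fun y => delForm r (y + t • v)) =ᶠ[𝓝 z] delForm r := by
    filter_upwards [e2] with y hy
    simp only [delForm, hy]
  have e4 : fderiv ℝ (delForm r) (z + t • v) = fderiv ℝ (delForm r) z := by
    have := e3.fderiv_eq (𝕜 := ℝ)
    rwa [fderiv_comp_add_right] at this
  rw [e1]
  refine ⟨?_, e3.self_of_nhds, ?_⟩
  · have := hz0
    simp only at this
    rw [this, ht']; ring
  · ext Y
    simp only [leviL, e4]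

theorem eventually_fderiv_eq_one (ht : ∀ᶠ q : CSpace n × ℝ in 𝓝 (z₀, 0),
      r (q.1 + q.2 • v) = r q.1 + q.2) (hr : ContDiff ℝ ∞ r) :
    ∀ᶠ z in 𝓝 z₀, fderiv ℝ r z v = 1 := by
  have h1 : Tendsto (fun z : CSpace n => (z, (0 : ℝ))) (𝓝 z₀) (𝓝 (z₀, 0)) :=
    (by fun_prop : Continuous fun z : CSpace n => (z, (0 : ℝ))).tendsto z₀
  filter_upwards [h1.eventually ht.eventually_nhds] with z hz
  have hev : ∀ᶠ t : ℝ in 𝓝 0, r (z + t • v) = r z + t :=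
    ((continuous_const.prodMk continuous_id).tendsto (0 : ℝ)).eventually hz
  have h2 : HasDerivAt (fun t : ℝ => r (z + t • v)) (fderiv ℝ r z v) 0 := by
    have h3 : HasFDerivAt r (fderiv ℝ r z) (z + (0 : ℝ) • v) := by
      rw [zero_smul, add_zero]; exact (hr.differentiable (by simp) z).hasFDerivAt
    have h4 := ((hasDerivAt_id (0 : ℝ)).smul_const v).const_add z
    rw [one_smul] at h4
    exact h3.comp_hasDerivAt (0 : ℝ) h4
  have h5 : HasDerivAt (fun t : ℝ => r z + t) 1 0 := (hasDerivAt_id (0 : ℝ)).const_add (r z)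
  exact h2.unique (h5.congr_of_eventuallyEq hev)

/-- Near `z₀`, all level sets of `r` have a nonnegative Levi form with `l`-dimensional nullspace. -/
theorem eventually_levi {Ω V : Set (CSpace n)} {l : ℕ} (hl : l < n) (hΩo : IsOpen Ω)
    (hΩp : IsPseudoconvex Ω) (hV : IsOpen V) (hz₀ : z₀ ∈ V)
    (hrank : ∀ q ∈ frontier Ω ∩ V, HasLeviRank Ω q (n - l - 1))
    (hr : ContDiff ℝ ∞ r) (hr0 : r z₀ = 0)
    (hdef : ∀ᶠ z in 𝓝 z₀, (r z < 0 ↔ z ∈ Ω) ∧ (r z = 0 ↔ z ∈ frontier Ω))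
    (ht : ∀ᶠ q : CSpace n × ℝ in 𝓝 (z₀, 0), r (q.1 + q.2 • v) = r q.1 + q.2) :
    ∀ᶠ z in 𝓝 z₀, (∀ X, delForm r z X = 0 → 0 ≤ (leviL r z X X).re) ∧
      Module.finrank ℂ (nullSpace r z) = l := by
  have hproj : Tendsto (fun z => z - r z • v) (𝓝 z₀) (𝓝 z₀) := by
    have : Continuous fun z => z - r z • v := by have := hr.continuous; fun_prop
    simpa [hr0] using this.tendsto z₀
  have hd : ∀ᶠ z in 𝓝 z₀, fderiv ℝ r z ≠ 0 := by
    filter_upwards [eventually_fderiv_eq_one ht hr] with z hz h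
    rw [h] at hz; simp at hz
  filter_upwards [eventually_forms_translate hr hr0 ht,
    hproj.eventually ((hdef.and hd).and (hV.mem_nhds hz₀)).eventually_nhds] with z ⟨h1, h2, h3⟩ h4
  set w := z - r z • v
  have hw := h4.self_of_nhds
  have hwf : w ∈ frontier Ω := hw.1.1.2.1 h1
  constructor
  · intro X hX
    rw [← h3]
    rw [← h2] at hX
    exact levi_nonneg_of_pseudoconvex hΩo hΩp (Θ := id) (Eventually.of_forall fun _ =>
      differentiableAt_id) hr.contDiffAt (h4.mono fun y hy h => hy.1.1.1.1 h) hwf h1 hw.1.2 hX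
  · have e : nullSpace r z = nullSpace r w := by
      ext X; simp only [mem_nullSpace, h2, h3]
    rw [e]
    obtain ⟨ε, hε, hball⟩ := Metric.eventually_nhds_iff_ball.1 h4
    have hdefn : IsDefiningFunction Ω (Metric.ball w ε) r :=
      { isOpen := Metric.isOpen_ball
        smooth := hr.contDiffOn
        neg_iff := fun y hy => (hball y hy).1.1.1
        zero_iff := fun y hy => (hball y hy).1.1.2
        fderiv_ne := fun y hy _ => (hball y hy).1.2 }
    have hrk := hrank w ⟨hwf, hw.2⟩ _ r (Metric.mem_ball_self hε) hdefn
    have hT := finrank_complexTangent (hr.differentiable (by simp) w) hw.1.2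
    have h2' : ContDiffAt ℝ 2 r w := hr.contDiffAt.of_le (by norm_cast)
    have hle : leviNullspace r w ≤ complexTangent r w := fun X hX => hX.1
    have hle' := Submodule.finrank_mono hle
    rw [leviRank] at hrk
    rw [← leviNullspace_eq h2']
    omega

end LocalDefining

/-! ### The Levi nullspaces form an involutive distribution -/

section Involutive

variable {n : ℕ} {r : CSpace n → ℝ}

/-- The exterior derivative of `∂r`, evaluated on `X` and `Y`. -/
noncomputable def dDel (r : CSpace n → ℝ) (z X Y : CSpace n) : ℂ :=
  fderiv ℝ (delForm r) z X Y - fderiv ℝ (delForm r) z Y X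

theorem dDel_eq (hr : ContDiff ℝ ∞ r) (z X Y : CSpace n) :
    dDel r z X Y = leviL r z X Y - leviL r z Y X := by
  have h2 : ContDiffAt ℝ 2 r z := hr.contDiffAt.of_le (by norm_cast)
  have hd : DifferentiableAt ℝ (fderiv ℝ r) z :=
    (h2.fderiv_right (m := 1) (by norm_num)).differentiableAt (by simp)
  rw [dDel, fderiv_delForm_apply hd, fderiv_delForm_apply hd, leviL_apply hd, leviL_apply hd,
    isSymm_of_contDiffAt h2 Y X, isSymm_of_contDiffAt h2 (Complex.I • Y) (Complex.I • X),
    isSymm_of_contDiffAt h2 (Complex.I • Y) X, isSymm_of_contDiffAt h2 Y (Complex.I • X)]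
  push_cast
  ring

theorem dDel_skew (z X Y : CSpace n) : dDel r z X Y = -dDel r z Y X := by
  simp only [dDel]; ring

theorem dDel_sub_left (z X X' Y : CSpace n) :
    dDel r z (X - X') Y = dDel r z X Y - dDel r z X' Y := by
  simp only [dDel, map_sub, sub_apply]; ring

theorem leviL_eq_zero_symm (hr : ContDiff ℝ ∞ r) {z X Y : CSpace n} (h : leviL r z Y X = 0) :
    leviL r z X Y = 0 := by
  rw [← leviL_conj (hr.contDiffAt.of_le (by norm_cast)) X Y, h, map_zero]

theorem dDel_eq_zero (hr : ContDiff ℝ ∞ r) {z X Y : CSpace n} (hX : X ∈ nullSpace r z)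
    (hY : delForm r z Y = 0) : dDel r z X Y = 0 := by
  have h := hX.2 Y hY
  rw [dDel_eq hr, h, leviL_eq_zero_symm hr h, sub_zero]

theorem mem_nullSpace_of_dDel (hr : ContDiff ℝ ∞ r) {z X : CSpace n} (hX : delForm r z X = 0)
    (h : ∀ Y, delForm r z Y = 0 → dDel r z X Y = 0) : X ∈ nullSpace r z := by
  refine ⟨hX, fun Y hY => ?_⟩
  have h1 := h Y hY
  have h2 := h (Complex.I • Y) (by rw [map_smul, hY, smul_zero])
  rw [dDel_eq hr] at h1 h2
  rw [leviL_smul, map_smul, smul_apply, Complex.conj_I, smul_eq_mul, smul_eq_mul] at h2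
  have h3 : Complex.I * (leviL r z X Y + leviL r z Y X) = 0 := by linear_combination h2
  have h4 := (mul_eq_zero.1 h3).resolve_left Complex.I_ne_zero
  linear_combination (h4 - h1) / 2

section Along

variable {E W : Type*} [NormedAddCommGroup E] [NormedSpace ℂ E] [NormedAddCommGroup W]
  [NormedSpace ℝ W]

theorem hasDerivAt_apply {c : ℝ → E →L[ℂ] ℂ} {c' : E →L[ℂ] ℂ} {x : ℝ → E}
    {x' : E} {t : ℝ} (hc : HasDerivAt c c' t) (hx : HasDerivAt x x' t) :
    HasDerivAt (fun t => c t (x t)) (c' (x t) + c t x') t := by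
  have h4 : HasDerivAt (fun t => (c t).restrictScalars ℝ) (c'.restrictScalars ℝ) t :=
    (ContinuousLinearMap.restrictScalarsL ℂ E ℂ ℝ ℝ).hasFDerivAt.comp_hasDerivAt t hc
  exact h4.clm_apply hx

theorem hasDerivAt_line (z u : E) : HasDerivAt (fun t : ℝ => z + t • u) u 0 := by
  simpa using ((hasDerivAt_id (0 : ℝ)).smul_const u).const_add z

theorem hasDerivAt_along {Z : E → W}
    {z : E} (hZ : DifferentiableAt ℝ Z z) (u : E) :
    HasDerivAt (fun t : ℝ => Z (z + t • u)) (fderiv ℝ Z z u) 0 := by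
  have hZ' : HasFDerivAt Z (fderiv ℝ Z z) (z + (0 : ℝ) • u) := by simpa using hZ.hasFDerivAt
  exact hZ'.comp_hasDerivAt _ (hasDerivAt_line z u)

theorem hasDerivAt_pairing_along {G : Type*} [NormedAddCommGroup G] [NormedSpace ℝ G]
    (e : W →L[ℝ] E →L[ℝ] G) {D : E → E →L[ℝ] W}
    {X Y : E → E} {z : E} (hD : DifferentiableAt ℝ D z)
    (hX : DifferentiableAt ℝ X z) (hY : DifferentiableAt ℝ Y z) (u : E) :
    HasDerivAt (fun t : ℝ => e (D (z + t • u) (X (z + t • u))) (Y (z + t • u)))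
      (e (fderiv ℝ D z u (X z)) (Y z) + e (D z (fderiv ℝ X z u)) (Y z)
        + e (D z (X z)) (fderiv ℝ Y z u)) 0 := by
  have h1 := (hasDerivAt_along hD u).clm_apply (hasDerivAt_along hX u)
  have h3 := (e.hasFDerivAt.comp_hasDerivAt (0 : ℝ) h1).clm_apply (hasDerivAt_along hY u)
  simp only [zero_smul, add_zero, map_add, add_apply, Function.comp_apply] at h3
  exact h3

theorem tendsto_line (z u : E) : Tendsto (fun t : ℝ => z + t • u) (𝓝 0) (𝓝 z) := by
  simpa using (hasDerivAt_line z u).continuousAt.tendsto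

theorem differentiableAt_div {V : Type*} [NormedAddCommGroup V] [NormedSpace ℝ V] {a b : V → ℂ}
    {z : V} (ha : DifferentiableAt ℝ a z) (hb : DifferentiableAt ℝ b z) (h : b z ≠ 0) :
    DifferentiableAt ℝ (fun y => a y / b y) z := by
  simp only [div_eq_mul_inv]
  exact ha.mul (hb.inv h)

end Along

theorem delForm_lieBracket (hr : ContDiff ℝ ∞ r) {X Y : CSpace n → CSpace n} {z : CSpace n}
    (hX : DifferentiableAt ℝ X z) (hY : DifferentiableAt ℝ Y z)
    (hX0 : ∀ᶠ y in 𝓝 z, delForm r y (X y) = 0) (hY0 : ∀ᶠ y in 𝓝 z, delForm r y (Y y) = 0) :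
    delForm r z (fderiv ℝ Y z (X z) - fderiv ℝ X z (Y z)) = -dDel r z (X z) (Y z) := by
  have key : ∀ {Z : CSpace n → CSpace n}, DifferentiableAt ℝ Z z →
      (∀ᶠ y in 𝓝 z, delForm r y (Z y) = 0) → ∀ u,
      fderiv ℝ (delForm r) z u (Z z) + delForm r z (fderiv ℝ Z z u) = 0 := by
    intro Z hZ hZ0 u
    have h1 := hasDerivAt_along ((contDiff_delForm hr).differentiable (by simp) z) u
    have h3 := hasDerivAt_apply h1 (hasDerivAt_along hZ u)
    rw [zero_smul, add_zero] at h3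
    exact h3.unique ((hasDerivAt_const (0 : ℝ) (0 : ℂ)).congr_of_eventuallyEq
      ((tendsto_line z u).eventually hZ0))
  rw [map_sub, dDel]
  linear_combination key hY hY0 (X z) - key hX hX0 (Y z)

/-- The derivative of `dDel` along `u`, at fixed arguments `X` and `Y`. -/
noncomputable def ddDel (r : CSpace n → ℝ) (z u X Y : CSpace n) : ℂ :=
  fderiv ℝ (fderiv ℝ (delForm r)) z u X Y - fderiv ℝ (fderiv ℝ (delForm r)) z u Y X

/-- `d(dω) = 0` for `ω = ∂r`. -/
theorem ddDel_cyclic (hr : ContDiff ℝ ∞ r) (z X Y Z : CSpace n) :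
    ddDel r z X Y Z + ddDel r z Y Z X + ddDel r z Z X Y = 0 := by
  have h2 : ContDiffAt ℝ 2 (delForm r) z := (contDiff_delForm hr).contDiffAt.of_le (by norm_cast)
  have hs := h2.isSymmSndFDerivAt (by simp)
  simp only [ddDel]
  rw [hs.eq X Y, hs.eq Y Z, hs.eq Z X]
  ring

theorem ddDel_of_dDel_eq_zero (hr : ContDiff ℝ ∞ r) {X Y : CSpace n → CSpace n} {z : CSpace n}
    (hX : DifferentiableAt ℝ X z) (hY : DifferentiableAt ℝ Y z)
    (h : ∀ᶠ y in 𝓝 z, dDel r y (X y) (Y y) = 0) (u : CSpace n) :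
    ddDel r z u (X z) (Y z) + dDel r z (fderiv ℝ X z u) (Y z)
      + dDel r z (X z) (fderiv ℝ Y z u) = 0 := by
  have hB : DifferentiableAt ℝ (fderiv ℝ (delForm r)) z :=
    ((contDiff_delForm hr).fderiv_right (m := ∞) (by simp)).differentiable (by simp) z
  let e := ContinuousLinearMap.restrictScalarsL ℂ (CSpace n) ℂ ℝ ℝ
  have h1 := (hasDerivAt_pairing_along e hB hX hY u).sub (hasDerivAt_pairing_along e hB hY hX u)
  have h7 := h1.unique ((hasDerivAt_const (0 : ℝ) (0 : ℂ)).congr_of_eventuallyEq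
    ((tendsto_line z u).eventually h))
  have he : ∀ φ W, e φ W = φ W := fun _ _ => rfl
  simp only [he] at h7
  simp only [ddDel, dDel]
  linear_combination h7

/-- The bracket of two fields of Levi null vectors is a Levi null vector. -/
theorem lieBracket_mem_nullSpace (hr : ContDiff ℝ ∞ r) {v : CSpace n} {X Y : CSpace n → CSpace n}
    {z : CSpace n} (hv : delForm r z v ≠ 0) (hX : DifferentiableAt ℝ X z)
    (hY : DifferentiableAt ℝ Y z) (hX0 : ∀ᶠ y in 𝓝 z, X y ∈ nullSpace r y)
    (hY0 : ∀ᶠ y in 𝓝 z, Y y ∈ nullSpace r y) :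
    fderiv ℝ Y z (X z) - fderiv ℝ X z (Y z) ∈ nullSpace r z := by
  have hXT := hX0.mono fun y h => h.1
  have hYT := hY0.mono fun y h => h.1
  have hXz := hX0.self_of_nhds
  have hYz := hY0.self_of_nhds
  have hωv : ∀ᶠ y in 𝓝 z, delForm r y v ≠ 0 := by
    have hc : Continuous fun y => delForm r y v :=
      (contDiff_delForm hr).continuous.clm_apply continuous_const
    exact hc.continuousAt.eventually_ne hv
  refine mem_nullSpace_of_dDel hr ?_ fun W hW => ?_
  · rw [delForm_lieBracket hr hX hY hXT hYT, dDel_eq_zero hr hXz hYz.1, neg_zero]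
  -- Extend `W` to a section of the complex tangent spaces.
  let S : CSpace n → CSpace n := fun y => W - (delForm r y W / delForm r y v) • v
  have hωd : ∀ w, DifferentiableAt ℝ (fun y => delForm r y w) z := fun w => by
    have h1 := (contDiff_delForm hr).differentiable (by simp) z
    exact ((ContinuousLinearMap.apply ℂ ℂ w).restrictScalars ℝ).differentiableAt.comp z h1
  have hS : DifferentiableAt ℝ S z := by
    have h1 := differentiableAt_div (a := fun y => delForm r y W) (b := fun y => delForm r y v) (hωd W) (hωd v) hv
    exact (h1.smul_const v).const_sub W
  have hSz : S z = W := by simp [S, hW]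
  have hST : ∀ᶠ y in 𝓝 z, delForm r y (S y) = 0 := by
    filter_upwards [hωv] with y hy
    simp only [S, map_sub, map_smul, smul_eq_mul]
    field_simp
    ring
  have e1 := ddDel_of_dDel_eq_zero hr hY hS
    ((hY0.and hST).mono fun y h => dDel_eq_zero hr h.1 h.2) (X z)
  have e2 := ddDel_of_dDel_eq_zero hr hS hX
    ((hX0.and hST).mono fun y h => by rw [dDel_skew, dDel_eq_zero hr h.1 h.2, neg_zero]) (Y z)
  have e3 := ddDel_of_dDel_eq_zero hr hX hY
    ((hX0.and hYT).mono fun y h => dDel_eq_zero hr h.1 h.2) (S z)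
  have e4 := ddDel_cyclic hr z (X z) (Y z) (S z)
  have b1 : dDel r z (Y z) (fderiv ℝ S z (X z) - fderiv ℝ X z (S z)) = 0 := by
    refine dDel_eq_zero hr hYz ?_
    rw [delForm_lieBracket hr hX hS hXT hST, dDel_eq_zero hr hXz hST.self_of_nhds, neg_zero]
  have b2 : dDel r z (X z) (fderiv ℝ S z (Y z) - fderiv ℝ Y z (S z)) = 0 := by
    refine dDel_eq_zero hr hXz ?_
    rw [delForm_lieBracket hr hY hS hYT hST, dDel_eq_zero hr hYz hST.self_of_nhds, neg_zero]
  rw [dDel_skew, dDel_sub_left] at b1 b2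
  rw [← hSz, dDel_sub_left]
  have s1 := dDel_skew (r := r) z (S z) (fderiv ℝ X z (Y z))
  have s2 := dDel_skew (r := r) z (Y z) (fderiv ℝ S z (X z))
  have s3 := dDel_skew (r := r) z (X z) (fderiv ℝ Y z (S z))
  linear_combination e1 + e2 + e3 - e4 - b1 + b2 - s1 - s2 - s3

end Involutive

/-! ### A frame of Levi null vectors -/

section LinearAlgebra

theorem exists_basis_orthonormal {V ι : Type*} [AddCommGroup V] [Module ℂ V]
    [FiniteDimensional ℂ V] [Fintype ι] [DecidableEq ι]
    (hc : Module.finrank ℂ V = Fintype.card ι) (H : V → V →ₗ[ℂ] ℂ)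
    (hconj : ∀ x y, (starRingEnd ℂ) (H x y) = H y x) (hpos : ∀ x, 0 ≤ (H x x).re)
    (hdef : ∀ x, H x x = 0 → x = 0) :
    ∃ b : Module.Basis ι ℂ V, ∀ i j, H (b i) (b j) = if i = j then 1 else 0 := by
  let core : InnerProductSpace.Core ℂ V :=
    { inner := fun x y => H x y
      conj_inner_symm := fun x y => hconj y x
      re_inner_nonneg := hpos
      add_left := fun x y z => by
        rw [← hconj z, ← hconj z, ← hconj z, map_add, map_add]
      smul_left := fun x y c => by
        rw [← hconj y, ← hconj y, map_smul, smul_eq_mul, map_mul]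
      definite := hdef }
  let _ : NormedAddCommGroup V := core.toNormedAddCommGroup
  let _ : InnerProductSpace ℂ V := InnerProductSpace.ofCore core.toCore
  let e : Fin (Module.finrank ℂ V) ≃ ι := (finCongr hc).trans (Fintype.equivFin ι).symm
  let b := (stdOrthonormalBasis ℂ V).reindex e
  refine ⟨b.toBasis, fun i j => ?_⟩
  rw [OrthonormalBasis.coe_toBasis]
  exact b.inner_eq_ite i j

variable {n : ℕ} {r : CSpace n → ℝ}

theorem leviL_self_im {z : CSpace n} (hr : ContDiffAt ℝ 2 r z) (X : CSpace n) :
    (leviL r z X X).im = 0 := Complex.conj_eq_iff_im.1 (leviL_conj hr X X)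

/-- Null vectors of a positive semidefinite Levi form lie in its kernel. -/
theorem mem_nullSpace_of_levi_eq_zero {z X : CSpace n} (hr : ContDiffAt ℝ 2 r z)
    (hpsd : ∀ X, delForm r z X = 0 → 0 ≤ (leviL r z X X).re) (hX : delForm r z X = 0)
    (h0 : (leviL r z X X).re = 0) : X ∈ nullSpace r z := by
  refine ⟨hX, fun Y hY => ?_⟩
  by_contra hne
  set m := leviL r z Y X with hm
  set a := (leviL r z Y Y).re
  have ha : 0 ≤ a := hpsd Y hY
  have hpos : 0 < ‖m‖ ^ 2 := by positivity
  set t : ℝ := 1 / (a + 1)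
  have ht : 0 < t := by positivity
  have hta : t * a < 1 := by
    rw [one_div_mul_eq_div, div_lt_one (by positivity)]; linarith
  -- Test with `X - t m Y`.
  have h1 := hpsd (X + (-(t : ℂ) * m) • Y) (by rw [map_add, map_smul, hX, hY]; simp)
  have hsym : leviL r z X Y = (starRingEnd ℂ) m := (leviL_conj hr X Y).symm
  have e : leviL r z (X + (-(t : ℂ) * m) • Y) (X + (-(t : ℂ) * m) • Y) =
      leviL r z X X - 2 * t * (m * (starRingEnd ℂ) m)
        + t ^ 2 * (m * (starRingEnd ℂ) m) * leviL r z Y Y := by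
    rw [leviL_add, leviL_smul]
    simp only [map_add, add_apply, smul_apply, smul_eq_mul, map_smul, hsym, map_mul, map_neg,
      Complex.conj_ofReal, ← hm]
    ring
  rw [e, Complex.mul_conj, Complex.normSq_eq_norm_sq] at h1
  have h2 : (leviL r z X X - 2 * t * ((‖m‖ ^ 2 : ℝ) : ℂ)
      + t ^ 2 * ((‖m‖ ^ 2 : ℝ) : ℂ) * leviL r z Y Y).re =
      (leviL r z X X).re - 2 * t * ‖m‖ ^ 2 + t ^ 2 * ‖m‖ ^ 2 * a := by
    have : (2 * t * ((‖m‖ ^ 2 : ℝ) : ℂ)) = ((2 * t * ‖m‖ ^ 2 : ℝ) : ℂ) := by push_cast; ring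
    rw [this]
    have : ((t : ℂ) ^ 2 * ((‖m‖ ^ 2 : ℝ) : ℂ)) = ((t ^ 2 * ‖m‖ ^ 2 : ℝ) : ℂ) := by push_cast; ring
    rw [this, Complex.add_re, Complex.sub_re, Complex.ofReal_re, Complex.re_ofReal_mul]
  rw [h2, h0] at h1
  nlinarith [mul_pos ht hpos]

theorem card_lastIdx {l : ℕ} (hl : l < n) : (lastIdx n l).card = l := by
  have : lastIdx n l = (Finset.univ.filter fun j : Fin n => ¬ (j.val < n - l)) := by
    ext j; simp [lastIdx]
  have h2 := Finset.card_filter_add_card_filter_not (s := (Finset.univ : Finset (Fin n)))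
    (fun j : Fin n => j.val < n - l)
  rw [Fin.card_filter_val_lt, Finset.card_univ, Fintype.card_fin] at h2
  rw [this]; omega

variable [NeZero n]

theorem card_midIdx {l : ℕ} (hl : l < n) : (midIdx n l).card + 1 + l = n := by
  have h1 : insert (0 : Fin n) (midIdx n l) =
      (Finset.univ.filter fun j : Fin n => j.val < n - l) := by
    ext j
    simp only [midIdx, Finset.mem_insert, Finset.mem_filter, Finset.mem_univ, true_and]
    rcases eq_or_ne j 0 with h | h
    · subst h; simp; omega
    · simp [h]; omega
  have h2 : (0 : Fin n) ∉ midIdx n l := by simp [midIdx]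
  have h3 := Finset.card_insert_of_notMem h2
  rw [h1, Fin.card_filter_val_lt] at h3
  omega

theorem index_cases {l : ℕ} (j : Fin n) : j = 0 ∨ j ∈ midIdx n l ∨ j ∈ lastIdx n l := by
  simp only [midIdx, lastIdx, Finset.mem_filter, Finset.mem_univ, true_and]
  by_cases h : j = 0
  · exact Or.inl h
  · right
    by_cases h2 : j.val + l < n
    · exact Or.inl ⟨h, h2⟩
    · exact Or.inr (by omega)

theorem zero_notMem_midIdx {l : ℕ} : (0 : Fin n) ∉ midIdx n l := by simp [midIdx]

theorem zero_notMem_lastIdx {l : ℕ} (hl : l < n) : (0 : Fin n) ∉ lastIdx n l := by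
  simp [lastIdx, hl]

theorem notMem_lastIdx_of_mem_midIdx {l : ℕ} {j : Fin n} (h : j ∈ midIdx n l) :
    j ∉ lastIdx n l := by
  simp only [midIdx, lastIdx, Finset.mem_filter, Finset.mem_univ, true_and] at *
  omega

/-- At a point where the Levi form is positive semidefinite with `l`-dimensional nullspace, an
orthonormal system `f` for the Levi form and functionals `φ` restricting to coordinates on the
nullspace. -/
theorem exists_levi_coordinates {l : ℕ} (hl : l < n) {z v : CSpace n} (hr : ContDiffAt ℝ 2 r z)
    (hv : delForm r z v ≠ 0) (hpsd : ∀ X, delForm r z X = 0 → 0 ≤ (leviL r z X X).re)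
    (hN : Module.finrank ℂ (nullSpace r z) = l) :
    ∃ (f : Fin n → CSpace n) (φ : Fin n → CSpace n →L[ℂ] ℂ),
      (∀ j, delForm r z (f j) = 0) ∧
      (∀ i ∈ midIdx n l, ∀ j ∈ midIdx n l, leviL r z (f i) (f j) = if i = j then 1 else 0) ∧
      (∀ k j, φ k (f j) = 0) ∧
      ∀ X, delForm r z X = 0 → (∀ j ∈ midIdx n l, leviL r z (f j) X = 0) →
        (∀ k ∈ lastIdx n l, φ k X = 0) → X = 0 := by
  set N := nullSpace r z with hNdef
  set T := LinearMap.ker (delForm r z : CSpace n →ₗ[ℂ] ℂ) with hT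
  have hNT : N ≤ T := fun X hX => hX.1
  obtain ⟨C₀, hC₀⟩ := N.exists_isCompl
  set C := T ⊓ C₀ with hC
  have hsup : N ⊔ C = T := by
    rw [hC, inf_comm, ← sup_inf_assoc_of_le C₀ hNT, hC₀.sup_eq_top, top_inf_eq]
  have hinf : N ⊓ C = ⊥ := by
    rw [eq_bot_iff]
    rintro X ⟨h1, -, h3⟩
    exact hC₀.inf_eq_bot.le ⟨h1, h3⟩
  have hTdim : Module.finrank ℂ T + 1 = n := by
    have h2 := LinearMap.finrank_range_add_finrank_ker (delForm r z : CSpace n →ₗ[ℂ] ℂ)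
    have h3 : LinearMap.range (delForm r z : CSpace n →ₗ[ℂ] ℂ) = ⊤ := by
      rw [LinearMap.range_eq_top]
      intro c
      exact ⟨(c / delForm r z v) • v, by simp [hv]⟩
    rw [h3, finrank_top, Module.finrank_self, finrank_euclideanSpace_fin] at h2
    rw [hT]; omega
  have hCdim : Module.finrank ℂ C = Fintype.card {j // j ∈ midIdx n l} := by
    have h1 := Submodule.finrank_sup_add_finrank_inf_eq N C
    rw [hsup, hinf, finrank_bot, hN] at h1
    have h2 := card_midIdx hl
    rw [Fintype.card_coe]
    omega
  have hNdim : Module.finrank ℂ N = Fintype.card {j // j ∈ lastIdx n l} := by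
    rw [hN, Fintype.card_coe, card_lastIdx hl]
  obtain ⟨b, hb⟩ := exists_basis_orthonormal hCdim
    (fun x => (leviL r z (x : CSpace n) : CSpace n →ₗ[ℂ] ℂ) ∘ₗ C.subtype)
    (fun x y => leviL_conj hr _ _) (fun x => hpsd x x.2.1) (fun x hx => by
      have h1 : (x : CSpace n) ∈ N := mem_nullSpace_of_levi_eq_zero hr hpsd x.2.1 (by
        have := congrArg Complex.re hx
        simpa using this)
      have h2 : (x : CSpace n) ∈ N ⊓ C := ⟨h1, x.2⟩
      rw [hinf] at h2
      exact Subtype.ext ((Submodule.mem_bot ℂ).1 h2))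
  let bN := (Module.finBasisOfFinrankEq ℂ N hNdim).reindex (Fintype.equivFin _).symm
  let π := N.projectionOnto C₀ hC₀
  refine ⟨fun j => if h : j ∈ midIdx n l then (b ⟨j, h⟩ : CSpace n) else 0, fun k =>
    if h : k ∈ lastIdx n l then LinearMap.toContinuousLinearMap ((bN.coord ⟨k, h⟩) ∘ₗ π) else 0,
    fun j => ?_, fun i hi j hj => ?_, fun k j => ?_, fun X hX h1 h2 => ?_⟩
  · dsimp only
    split_ifs with h
    · exact (b ⟨j, h⟩).2.1
    · exact map_zero _
  · have := hb ⟨i, hi⟩ ⟨j, hj⟩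
    simpa [hi, hj] using this
  · dsimp only
    split_ifs with h h' h'
    · have : π (b ⟨j, h'⟩ : CSpace n) = 0 :=
        Submodule.projectionOnto_apply_right hC₀ ⟨_, (b ⟨j, h'⟩).2.2⟩
      simp [this]
    · simp
    · simp
    · simp
  · have hXT : X ∈ N ⊔ C := by rw [hsup]; exact hX
    obtain ⟨Y, hY, Z, hZ, rfl⟩ := Submodule.mem_sup.1 hXT
    have hZ0 : Z = 0 := by
      have h3 : ∀ i : {j // j ∈ midIdx n l}, b.repr ⟨Z, hZ⟩ i = 0 := by
        intro i
        have h4 := h1 i i.2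
        simp only [i.2, dif_pos, map_add] at h4
        rw [hY.2 _ (b i).2.1, zero_add] at h4
        have h5 := b.sum_repr ⟨Z, hZ⟩
        have h6 := congrArg (fun x : C => leviL r z (b i) (x : CSpace n)) h5
        simp only [Submodule.coe_sum, Submodule.coe_smul, map_sum, map_smul] at h6
        rw [h4] at h6
        have h7 : ∀ j, leviL r z (b i) (b j : CSpace n) = if i = j then 1 else 0 := hb i
        simpa [h7] using h6
      have h8 : (⟨Z, hZ⟩ : C) = 0 := b.repr.map_eq_zero_iff.1 (Finsupp.ext h3)
      exact congrArg Subtype.val h8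
    subst hZ0
    rw [add_zero]
    have h3 : (⟨Y, hY⟩ : N) = 0 := by
      apply bN.repr.map_eq_zero_iff.1
      ext k
      have h4 := h2 k k.2
      have h5 : π Y = ⟨Y, hY⟩ := Submodule.projectionOnto_apply_left hC₀ ⟨Y, hY⟩
      simpa [h5] using h4
    exact congrArg Subtype.val h3

end LinearAlgebra

section NullFrame

variable {n : ℕ} {r : CSpace n → ℝ}

/-- The linear map with given components. -/
noncomputable def ofComponents (A : Fin n → CSpace n →L[ℂ] ℂ) : CSpace n →L[ℂ] CSpace n :=
  ∑ j, (A j).smulRight (EuclideanSpace.single j 1)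

theorem ofComponents_apply (A : Fin n → CSpace n →L[ℂ] ℂ) (X : CSpace n) (j : Fin n) :
    ofComponents A X j = A j X := by
  simp [ofComponents, Pi.single_apply]

theorem contDiffAt_ofComponents {X : Type*} [NormedAddCommGroup X] [NormedSpace ℝ X] {x : X}
    {A : X → Fin n → CSpace n →L[ℂ] ℂ} (hA : ∀ j, ContDiffAt ℝ ∞ (fun x => A x j) x) :
    ContDiffAt ℝ ∞ (fun x => ofComponents (A x)) x := by
  refine ContDiffAt.sum fun j _ => ?_
  exact (((ContinuousLinearMap.smulRightL ℂ (CSpace n) (CSpace n)).flip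
    (EuclideanSpace.single j 1)).restrictScalars ℝ).contDiff.contDiffAt.comp x (hA j)

/-- The projection to the coordinates in `s`. -/
noncomputable def blockProj (s : Finset (Fin n)) : CSpace n →L[ℂ] CSpace n :=
  ∑ j ∈ s, (EuclideanSpace.proj j : CSpace n →L[ℂ] ℂ).smulRight (EuclideanSpace.single j 1)

theorem blockProj_eq (s : Finset (Fin n)) (ζ : CSpace n) :
    blockProj s ζ = ∑ j ∈ s, ζ j • (EuclideanSpace.single j 1 : CSpace n) := by
  simp [blockProj]

theorem blockProj_apply (s : Finset (Fin n)) (ζ : CSpace n) (j : Fin n) :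
    blockProj s ζ j = if j ∈ s then ζ j else 0 := by
  simp [blockProj, Pi.single_apply]

theorem blockProj_idem (s : Finset (Fin n)) (ζ : CSpace n) :
    blockProj s (blockProj s ζ) = blockProj s ζ := by
  ext j; simp only [blockProj_apply]; split_ifs <;> rfl

theorem contDiffAt_leviL (hr : ContDiff ℝ ∞ r) {X : Type*} [NormedAddCommGroup X] [NormedSpace ℝ X]
    {z Y : X → CSpace n} {x : X} (hz : ContDiffAt ℝ ∞ z x) (hY : ContDiffAt ℝ ∞ Y x) :
    ContDiffAt ℝ ∞ (fun x => leviL r (z x) (Y x)) x := by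
  have h1 : ContDiffAt ℝ ∞ (fun x => fderiv ℝ (delForm r) (z x)) x :=
    ((contDiff_delForm hr).fderiv_right (m := ∞) (by simp)).contDiffAt.comp x hz
  have hI : ContDiffAt ℝ ∞ (fun x => Complex.I • Y x) x := hY.const_smul Complex.I
  exact ((h1.clm_apply hY).add ((h1.clm_apply hI).const_smul Complex.I)).const_smul (2 : ℂ)⁻¹

theorem isInvertible_of_forall_eq_zero {A : CSpace n →L[ℂ] CSpace n} (h : ∀ X, A X = 0 → X = 0) :
    A.IsInvertible := by
  have hinj : Function.Injective (A : CSpace n →ₗ[ℂ] CSpace n) :=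
    (injective_iff_map_eq_zero _).2 h
  exact ⟨(LinearEquiv.ofInjectiveEndo _ hinj).toContinuousLinearEquiv, by ext; rfl⟩

theorem SmoothNear.clm_inverse {X : Type*} [NormedAddCommGroup X] [NormedSpace ℝ X]
    {A : X → CSpace n →L[ℂ] CSpace n} {x : X} (hA : SmoothNear A x) (h : (A x).IsInvertible) :
    (∀ᶠ y in 𝓝 x, (A y).IsInvertible) ∧ SmoothNear (fun y => (A y).inverse) x := by
  have h1 : ∀ᶠ y in 𝓝 x, (A y).IsInvertible := by
    obtain ⟨e, he⟩ := h
    have h2 := hA.continuousAt.eventually (p := fun B => B.IsInvertible) (by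
      rw [← he]
      filter_upwards [e.nhds] with B ⟨e', h'⟩ using ⟨e', h'⟩)
    exact h2
  refine ⟨h1, ?_⟩
  filter_upwards [h1, hA] with y hy hy'
  have h2 : ContDiffAt ℂ ∞ ContinuousLinearMap.inverse (A y) := hy.contDiffAt_map_inverse
  exact (h2.restrict_scalars ℝ).comp y hy'

/-- The projection of `f` to the complex tangent space at `z` along `v`. -/
noncomputable def tangentField (r : CSpace n → ℝ) (v f z : CSpace n) : CSpace n :=
  f - (delForm r z f / delForm r z v) • v

theorem delForm_tangentField {v f z : CSpace n} (h : delForm r z v ≠ 0) :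
    delForm r z (tangentField r v f z) = 0 := by
  simp only [tangentField, map_sub, map_smul, smul_eq_mul]
  field_simp
  ring

theorem contDiffAt_delForm_apply (hr : ContDiff ℝ ∞ r) (f z : CSpace n) :
    ContDiffAt ℝ ∞ (fun z => delForm r z f) z :=
  ((ContinuousLinearMap.apply ℂ ℂ f).restrictScalars ℝ).contDiff.contDiffAt.comp z
    (contDiff_delForm hr).contDiffAt

theorem contDiffAt_tangentField (hr : ContDiff ℝ ∞ r) {v f z : CSpace n} (h : delForm r z v ≠ 0) :
    ContDiffAt ℝ ∞ (tangentField r v f) z := by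
  have h1 := contDiffAt_delForm_apply hr f z
  have h2 := contDiffAt_delForm_apply hr v z
  have h3 : ContDiffAt ℝ ∞ (fun z => delForm r z f / delForm r z v) z := by
    simp only [div_eq_mul_inv]
    exact h1.mul (h2.inv h)
  exact contDiffAt_const.sub (h3.smul contDiffAt_const)

variable [NeZero n]

/-- Commuting fields `z ↦ 𝓔 z a`, linear in `a`, that span the Levi nullspaces near `z₀`. -/
theorem exists_null_frame {l : ℕ} (hl : l < n) {z₀ v : CSpace n} (hr : ContDiff ℝ ∞ r)
    (hv : delForm r z₀ v ≠ 0)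
    (hlev : ∀ᶠ z in 𝓝 z₀, (∀ X, delForm r z X = 0 → 0 ≤ (leviL r z X X).re) ∧
      Module.finrank ℂ (nullSpace r z) = l) :
    ∃ (f : Fin n → CSpace n) (𝓔 : CSpace n → CSpace n →L[ℂ] CSpace n),
      (∀ j, delForm r z₀ (f j) = 0) ∧
      (∀ i ∈ midIdx n l, ∀ j ∈ midIdx n l, leviL r z₀ (f i) (f j) = if i = j then 1 else 0) ∧
      ContDiff ℝ ∞ 𝓔 ∧ (∀ z a, 𝓔 z (blockProj (lastIdx n l) a) = 𝓔 z a) ∧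
      (∀ᶠ z in 𝓝 z₀, ∀ a, 𝓔 z a ∈ nullSpace r z) ∧
      (∀ᶠ z in 𝓝 z₀, ∀ a b, fderiv ℝ 𝓔 z (𝓔 z a) b = fderiv ℝ 𝓔 z (𝓔 z b) a) ∧
      ∀ ζ : CSpace n, ζ 0 • v + ∑ j ∈ midIdx n l, ζ j • f j + 𝓔 z₀ ζ = 0 → ζ = 0 := by
  obtain ⟨hpsd, hN⟩ := hlev.self_of_nhds
  obtain ⟨f, φ, hf, hff, hφf, hinj⟩ :=
    exists_levi_coordinates hl (hr.contDiffAt.of_le (by norm_cast)) hv hpsd hN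
  have hωv : ∀ᶠ y in 𝓝 z₀, delForm r y v ≠ 0 :=
    (contDiffAt_delForm_apply hr v z₀).continuousAt.eventually_ne hv
  let comp : CSpace n → Fin n → CSpace n →L[ℂ] ℂ := fun z j =>
    if j = 0 then (delForm r z v)⁻¹ • delForm r z
    else if j ∈ midIdx n l then leviL r z (tangentField r v (f j) z) else φ j
  let A : CSpace n → CSpace n →L[ℂ] CSpace n := fun z => ofComponents (comp z)
  have hA : SmoothNear A z₀ := by
    filter_upwards [hωv] with z hz
    refine contDiffAt_ofComponents fun j => ?_
    by_cases h0 : j = 0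
    · simp only [comp, h0, if_true]
      exact ((contDiffAt_delForm_apply hr v z).inv hz).smul (contDiff_delForm hr).contDiffAt
    · by_cases hm : j ∈ midIdx n l
      · simp only [comp, h0, hm, if_true, if_false]
        exact contDiffAt_leviL hr contDiffAt_id (contDiffAt_tangentField hr hz)
      · simp only [comp, h0, hm, if_false]
        exact contDiffAt_const
  have hA0 : ∀ z X, A z X 0 = (delForm r z v)⁻¹ * delForm r z X := fun z X => by
    simp [A, ofComponents_apply, comp]
  have hAm : ∀ z X, ∀ j ∈ midIdx n l, A z X j = leviL r z (tangentField r v (f j) z) X := by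
    intro z X j hj
    have h0 : j ≠ 0 := fun h => zero_notMem_midIdx (h ▸ hj)
    simp [A, ofComponents_apply, comp, h0, hj]
  have hAl : ∀ z X, ∀ j ∈ lastIdx n l, A z X j = φ j X := by
    intro z X j hj
    have h0 : j ≠ 0 := fun h => zero_notMem_lastIdx hl (h ▸ hj)
    have h1 : j ∉ midIdx n l := fun h => notMem_lastIdx_of_mem_midIdx h hj
    simp [A, ofComponents_apply, comp, h0, h1]
  have hfz : ∀ j, tangentField r v (f j) z₀ = f j := fun j => by simp [tangentField, hf]
  have hAinv : (A z₀).IsInvertible := by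
    refine isInvertible_of_forall_eq_zero fun X hX => hinj X ?_ ?_ ?_
    · have h1 := hA0 z₀ X
      rw [hX] at h1
      have h2 : (delForm r z₀ v)⁻¹ * delForm r z₀ X = 0 := by rw [← h1]; rfl
      simpa [hv] using h2
    · intro j hj
      have h1 := hAm z₀ X j hj
      rw [hX, hfz] at h1
      rw [← h1]; rfl
    · intro j hj
      have h1 := hAl z₀ X j hj
      rw [hX] at h1
      rw [← h1]; rfl
  obtain ⟨hAe, hAs⟩ := hA.clm_inverse hAinv
  obtain ⟨G, hG, hGA⟩ := hAs.exists_contDiff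
  let Q := blockProj (lastIdx n l)
  let 𝓔 : CSpace n → CSpace n →L[ℂ] CSpace n := fun z => G z ∘L Q
  have h𝓔 : ContDiff ℝ ∞ 𝓔 :=
    (((ContinuousLinearMap.compL ℂ (CSpace n) (CSpace n) (CSpace n)).flip
      Q).restrictScalars ℝ).contDiff.comp hG
  have h𝓔A : ∀ᶠ z in 𝓝 z₀, ∀ a, A z (𝓔 z a) = Q a := by
    filter_upwards [hGA, hAe] with z h1 h2 a
    simp only [𝓔, h1, ContinuousLinearMap.comp_apply]
    exact h2.self_apply_inverse _
  -- Null vectors have only components with index in the last block.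
  have hnull : ∀ᶠ z in 𝓝 z₀, ∀ X ∈ nullSpace r z, Q (A z X) = A z X := by
    filter_upwards [hωv] with z hz X hX
    ext j
    rw [blockProj_apply]
    split_ifs with hj
    · rfl
    · rcases index_cases (l := l) j with h | h | h
      · rw [h, hA0, hX.1, mul_zero]
      · rw [hAm z X j h, hX.2 _ (delForm_tangentField hz)]
      · exact absurd h hj
  have hrange : Module.finrank ℂ (LinearMap.range (Q : CSpace n →ₗ[ℂ] CSpace n)) ≤ l := by
    have h1 : LinearMap.range (Q : CSpace n →ₗ[ℂ] CSpace n) ≤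
        Submodule.span ℂ ((lastIdx n l).image fun j => (EuclideanSpace.single j 1 : CSpace n)) := by
      rintro _ ⟨a, rfl⟩
      change Q a ∈ _
      rw [blockProj_eq]
      exact Submodule.sum_mem _ fun j hj => Submodule.smul_mem _ _
        (Submodule.subset_span (by simpa using ⟨j, hj, rfl⟩))
    refine (Submodule.finrank_mono h1).trans ((finrank_span_finset_le_card _).trans ?_)
    exact Finset.card_image_le.trans (card_lastIdx hl).le
  have hmem : ∀ᶠ z in 𝓝 z₀, ∀ a, 𝓔 z a ∈ nullSpace r z := by
    filter_upwards [hlev, hnull, h𝓔A, hAe] with z h1 h2 h3 h4 a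
    let M := (nullSpace r z).map (A z : CSpace n →ₗ[ℂ] CSpace n)
    have h5 : M ≤ LinearMap.range (Q : CSpace n →ₗ[ℂ] CSpace n) := by
      rintro _ ⟨X, hX, rfl⟩
      exact ⟨A z X, h2 X hX⟩
    have h6 : Module.finrank ℂ M = l := by
      rw [← h1.2]
      exact (Submodule.equivMapOfInjective _ h4.injective (nullSpace r z)).finrank_eq.symm
    have h7 := Submodule.eq_of_le_of_finrank_le h5 (hrange.trans h6.ge)
    have h8 : A z (𝓔 z a) ∈ M := by
      rw [h7, h3]; exact ⟨a, rfl⟩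
    obtain ⟨X, hX, hXa⟩ := h8
    rwa [← h4.injective hXa]
  refine ⟨f, 𝓔, hf, hff, h𝓔, fun z a => ?_, hmem, ?_, fun ζ hζ => ?_⟩
  · simp only [𝓔, ContinuousLinearMap.comp_apply, Q, blockProj_idem]
  · filter_upwards [hmem.eventually_nhds, hnull, h𝓔A.eventually_nhds, hAe, hωv]
      with z h1 h2 h3 h4 h5 a b
    have hd : DifferentiableAt ℝ 𝓔 z := h𝓔.differentiable (by simp) z
    have hde : ∀ a, HasFDerivAt (fun z => 𝓔 z a) (((ContinuousLinearMap.apply ℂ (CSpace n)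
        a).restrictScalars ℝ) ∘L fderiv ℝ 𝓔 z) z := fun a =>
      ((ContinuousLinearMap.apply ℂ (CSpace n) a).restrictScalars ℝ).hasFDerivAt.comp z
        hd.hasFDerivAt
    have hbr := lieBracket_mem_nullSpace hr h5 (X := fun z => 𝓔 z a) (Y := fun z => 𝓔 z b)
      (hde a).differentiableAt (hde b).differentiableAt (h1.mono fun y h => h a)
      (h1.mono fun y h => h b)
    rw [(hde a).fderiv, (hde b).fderiv] at hbr
    change fderiv ℝ 𝓔 z (𝓔 z a) b - fderiv ℝ 𝓔 z (𝓔 z b) a ∈ nullSpace r z at hbr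
    set B := fderiv ℝ 𝓔 z (𝓔 z a) b - fderiv ℝ 𝓔 z (𝓔 z b) a with hB
    -- The functionals `φ k` are constant along the frame.
    have hφ : ∀ k ∈ lastIdx n l, ∀ a u, φ k (fderiv ℝ 𝓔 z u a) = 0 := by
      intro k hk a u
      have e1 := ((φ k).restrictScalars ℝ).hasFDerivAt.comp z (hde a)
      have e2 : (fun z => φ k (𝓔 z a)) =ᶠ[𝓝 z] fun _ => Q a k := by
        filter_upwards [h3] with y hy
        rw [← hAl y _ k hk, hy]
      have e3 := e1.congr_of_eventuallyEq e2.symm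
      have e4 := e3.unique (hasFDerivAt_const (Q a k) z)
      exact congrArg (fun T : CSpace n →L[ℝ] ℂ => T u) e4
    have hAB : A z B = 0 := by
      rw [← h2 B hbr]
      ext k
      rw [blockProj_apply]
      split_ifs with hk
      · rw [hAl z B k hk, hB, map_sub, hφ k hk, hφ k hk, sub_zero]; rfl
      · rfl
    have hB0 : B = 0 := h4.injective (by rw [hAB, map_zero])
    exact sub_eq_zero.1 hB0
  · have hE := hmem.self_of_nhds ζ
    have h0 : ζ 0 = 0 := by
      have h1 := congrArg (delForm r z₀) hζ
      simpa [map_add, map_sum, map_smul, hf, hE.1, hv] using h1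
    have hm : ∀ i ∈ midIdx n l, ζ i = 0 := by
      intro i hi
      have h1 := congrArg (leviL r z₀ (f i)) hζ
      rw [h0, zero_smul, zero_add, map_add, map_sum, hE.2 _ (hf i), add_zero, map_zero] at h1
      rw [Finset.sum_congr rfl (fun j hj => by rw [map_smul, hff i hi j hj])] at h1
      simpa [hi] using h1
    have h2 : 𝓔 z₀ ζ = 0 := by
      rw [h0, zero_smul, zero_add, Finset.sum_eq_zero (fun i hi => by rw [hm i hi, zero_smul]),
        zero_add] at hζ
      exact hζ
    have h3 := h𝓔A.self_of_nhds ζ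
    rw [h2, map_zero] at h3
    ext k
    rcases index_cases (l := l) k with h | h | h
    · rw [h, h0]; rfl
    · rw [hm k h]; rfl
    · have h4 : Q ζ k = ζ k := by rw [blockProj_apply, if_pos h]
      rw [← h4, ← h3]

end NullFrame

/-! ### Integral manifolds of commuting fields -/

section Leaves

variable {E : Type} [NormedAddCommGroup E] [NormedSpace ℝ E]

theorem contDiff_pairing_superposition {K : Type} [TopologicalSpace K] [CompactSpace K]
    {𝓔 : C(E, E →L[ℝ] E)} (h : ContDiff ℝ ∞ 𝓔) :
    ContDiff ℝ ∞ fun q : C(K, E) × C(K, E) => curvePairing K E E (𝓔.comp q.1) q.2 := by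
  have h1 : ContDiff ℝ ∞ fun q : C(K, E) × C(K, E) => 𝓔.comp q.1 :=
    (contDiff_superposition_infty 𝓔 h).comp contDiff_fst
  exact ((curvePairing K E E).contDiff.comp h1).clm_apply contDiff_snd

theorem hasDerivAt_pairing_superposition {K : Type} [TopologicalSpace K] [CompactSpace K]
    {𝓔 : C(E, E →L[ℝ] E)} {D𝓔 : C(E, E →L[ℝ] E →L[ℝ] E)} (h : ∀ z, HasFDerivAt 𝓔 (D𝓔 z) z)
    {x y : ℝ → C(K, E)} {x' y' : C(K, E)} {t : ℝ} (hx : HasDerivAt x x' t)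
    (hy : HasDerivAt y y' t) :
    HasDerivAt (fun t => curvePairing K E E (𝓔.comp (x t)) (y t))
      (curvePairing K E E (curvePairing K E (E →L[ℝ] E) (D𝓔.comp (x t)) x') (y t)
        + curvePairing K E E (𝓔.comp (x t)) y') t := by
  have h4 := (hasFDerivAt_superposition (K := K) 𝓔 D𝓔 h (x t)).comp_hasDerivAt t hx
  have h5 : HasDerivAt (fun t => curvePairing K E E (𝓔.comp (x t))) _ t :=
    (curvePairing K E E).hasFDerivAt.comp_hasDerivAt t h4
  exact h5.clm_apply hy

/-- Constant curves, as a linear map. -/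
noncomputable def constCurve (E : Type) [NormedAddCommGroup E] [NormedSpace ℝ E] :
    E →L[ℝ] C(unitInterval, E) :=
  LinearMap.mkContinuous
    { toFun := fun a => ContinuousMap.const _ a
      map_add' := fun _ _ => rfl
      map_smul' := fun _ _ => rfl } 1
    (fun a => by
      rw [one_mul, ContinuousMap.norm_le _ (by positivity)]
      exact fun _ => le_rfl)

@[simp] theorem constCurve_apply (a : E) (t : unitInterval) : constCurve E a t = a := rfl

/-- The integral operator of the equation `x' = 𝓔(x) a`. -/
noncomputable def leafOp (𝓔 : C(E, E →L[ℝ] E)) (q : (E × E) × C(unitInterval, E)) :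
    C(unitInterval, E) :=
  primitiveOp E (curvePairing unitInterval E E (𝓔.comp q.2) (constCurve E q.1.2))

theorem leafOp_apply (𝓔 : C(E, E →L[ℝ] E)) (q : (E × E) × C(unitInterval, E)) (t : unitInterval) :
    leafOp 𝓔 q t = ∫ s in (0 : ℝ)..t, 𝓔 (q.2 (Set.projIcc 0 1 zero_le_one s)) q.1.2 := rfl

theorem contDiff_leafOp {𝓔 : C(E, E →L[ℝ] E)} (h : ContDiff ℝ ∞ 𝓔) : ContDiff ℝ ∞ (leafOp 𝓔) := by
  have h2 : ContDiff ℝ ∞ fun q : (E × E) × C(unitInterval, E) => constCurve E q.1.2 :=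
    (constCurve E).contDiff.comp (contDiff_snd.comp contDiff_fst)
  exact (primitiveOp E).contDiff.comp
    ((contDiff_pairing_superposition h).comp (contDiff_snd.prodMk h2))

theorem hasFDerivAt_leafOp {𝓔 : C(E, E →L[ℝ] E)} {D𝓔 : C(E, E →L[ℝ] E →L[ℝ] E)}
    (h : ∀ z, HasFDerivAt 𝓔 (D𝓔 z) z) (q : (E × E) × C(unitInterval, E))
    {c : ℝ → (E × E) × C(unitInterval, E)} {c' : (E × E) × C(unitInterval, E)}
    (hc : HasDerivAt c c' 0) (hc0 : c 0 = q) :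
    HasDerivAt (fun t => leafOp 𝓔 (c t))
      (primitiveOp E (curvePairing unitInterval E E (curvePairing unitInterval E (E →L[ℝ] E)
          (D𝓔.comp q.2) c'.2) (constCurve E q.1.2)
        + curvePairing unitInterval E E (𝓔.comp q.2) (constCurve E c'.1.2))) 0 := by
  have h2 : HasDerivAt (fun t => (c t).2) c'.2 0 :=
    (ContinuousLinearMap.snd ℝ (E × E) C(unitInterval, E)).hasFDerivAt.comp_hasDerivAt 0 hc
  have h3 : HasDerivAt (fun t => (c t).1.2) c'.1.2 0 :=
    ((ContinuousLinearMap.snd ℝ E E) ∘L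
      (ContinuousLinearMap.fst ℝ (E × E) C(unitInterval, E))).hasFDerivAt.comp_hasDerivAt 0 hc
  have h6 := hasDerivAt_pairing_superposition h h2
    ((constCurve E).hasFDerivAt.comp_hasDerivAt (0 : ℝ) h3)
  have h7 := (primitiveOp E).hasFDerivAt.comp_hasDerivAt (0 : ℝ) h6
  simp only [Function.comp_apply, hc0] at h7
  exact h7

variable [CompleteSpace E]

/-- The solution of the variational equation along an integral curve of `z ↦ 𝓔 z a`. -/
theorem variation_eq {𝓔 : C(E, E →L[ℝ] E)} {D𝓔 : C(E, E →L[ℝ] E →L[ℝ] E)}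
    (h : ∀ z, HasFDerivAt 𝓔 (D𝓔 z) z) {p a b : E} {x w : C(unitInterval, E)}
    (hx : x = constCurve E p + leafOp 𝓔 ((p, a), x))
    (hcomm : ∀ t, D𝓔 (x t) (𝓔 (x t) a) b = D𝓔 (x t) (𝓔 (x t) b) a)
    (hsmall : ∀ t, ‖D𝓔 (x t)‖ * ‖a‖ ≤ 1 / 2)
    (hw : w = primitiveOp E (curvePairing unitInterval E E (curvePairing unitInterval E (E →L[ℝ] E)
          (D𝓔.comp x) w) (constCurve E a)
        + curvePairing unitInterval E E (𝓔.comp x) (constCurve E b))) :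
    w 1 = 𝓔 (x 1) b := by
  let v : C(unitInterval, E) := ⟨fun t => (t : ℝ) • 𝓔 (x t) b, by fun_prop⟩
  have hv : v = primitiveOp E (curvePairing unitInterval E E
      (curvePairing unitInterval E (E →L[ℝ] E) (D𝓔.comp x) v) (constCurve E a)
        + curvePairing unitInterval E E (𝓔.comp x) (constCurve E b)) := by
    ext t
    rw [primitiveOp_apply]
    have hcont : Continuous fun s : ℝ => 𝓔 (x (Set.projIcc 0 1 zero_le_one s)) a := by fun_prop
    let X : ℝ → E := fun s => p + ∫ σ in (0 : ℝ)..s, 𝓔 (x (Set.projIcc 0 1 zero_le_one σ)) a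
    have hX : ∀ s, HasDerivAt X (𝓔 (x (Set.projIcc 0 1 zero_le_one s)) a) s := fun s =>
      (intervalIntegral.integral_hasDerivAt_right (hcont.intervalIntegrable _ _)
        (hcont.stronglyMeasurableAtFilter _ _) hcont.continuousAt).const_add p
    have hXx : ∀ s : unitInterval, X s = x s := fun s => by
      conv_rhs => rw [hx]
      rfl
    have hd : ∀ s ∈ Set.uIcc (0 : ℝ) t, HasDerivAt (fun s => s • 𝓔 (X s) b)
        ((curvePairing unitInterval E E (curvePairing unitInterval E (E →L[ℝ] E)
          (D𝓔.comp x) v) (constCurve E a) + curvePairing unitInterval E E (𝓔.comp x)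
          (constCurve E b)) (Set.projIcc 0 1 zero_le_one s)) s := by
      intro s hs
      rw [Set.uIcc_of_le t.2.1] at hs
      have hs' : s ∈ Set.Icc (0 : ℝ) 1 := ⟨hs.1, hs.2.trans t.2.2⟩
      have h1 := (h (X s)).comp_hasDerivAt s (hX s)
      have h2 := (hasDerivAt_id s).smul (h1.clm_apply (hasDerivAt_const s b))
      refine h2.congr_deriv ?_
      have h3 : Set.projIcc 0 1 zero_le_one s = ⟨s, hs'⟩ := Set.projIcc_of_mem _ hs'
      have h4 : X s = x ⟨s, hs'⟩ := hXx ⟨s, hs'⟩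
      rw [h3]
      change s • (D𝓔 (X s) (𝓔 (x ⟨s, hs'⟩) a) b + 𝓔 (X s) 0) + (1 : ℝ) • 𝓔 (X s) b =
        D𝓔 (x ⟨s, hs'⟩) (s • 𝓔 (x ⟨s, hs'⟩) b) a + 𝓔 (x ⟨s, hs'⟩) b
      rw [h4, hcomm, map_smul, smul_apply, map_zero, add_zero, one_smul]
    rw [intervalIntegral.integral_eq_sub_of_hasDerivAt hd (Continuous.intervalIntegrable (by fun_prop) _ _)]
    simp [v, hXx]
  have hd : w - v = primitiveOp E (curvePairing unitInterval E E
      (curvePairing unitInterval E (E →L[ℝ] E) (D𝓔.comp x) (w - v)) (constCurve E a)) := by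
    conv_lhs => rw [hw, hv]
    rw [← map_sub, map_sub]
    ext t
    simp
  have hle : ‖w - v‖ ≤ 1 / 2 * ‖w - v‖ := by
    conv_lhs => rw [hd]
    refine (norm_primitiveOp_le _).trans ?_
    rw [ContinuousMap.norm_le _ (by positivity)]
    intro t
    simp only [curvePairing_apply, ContinuousMap.comp_apply, constCurve_apply]
    have h1 := (D𝓔 (x t) ((w - v) t)).le_opNorm a
    have h2 := (D𝓔 (x t)).le_opNorm ((w - v) t)
    have h3 := (w - v).norm_coe_le_norm t
    have h4 := hsmall t
    calc _ ≤ ‖D𝓔 (x t) ((w - v) t)‖ * ‖a‖ := h1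
      _ ≤ (‖D𝓔 (x t)‖ * ‖(w - v) t‖) * ‖a‖ := by gcongr
      _ = (‖D𝓔 (x t)‖ * ‖a‖) * ‖(w - v) t‖ := by ring
      _ ≤ _ := by gcongr
  have h0 : w - v = 0 := norm_le_zero_iff.1 (by linarith [norm_nonneg (w - v)])
  have h1 : w = v := sub_eq_zero.1 h0
  rw [h1]
  simp [v]

theorem eventually_norm_lt {X W : Type*} [TopologicalSpace X] [NormedAddCommGroup W] {f : X → W}
    {x : X} (hf : ContinuousAt f x) : ∀ᶠ y in 𝓝 x, ‖f y‖ < ‖f x‖ + 1 :=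
  hf.norm.eventually_lt_const (lt_add_one _)

/-- Through every point near `z₀` there passes an integral manifold of the commuting fields
`z ↦ 𝓔 z b`. -/
theorem exists_leaves {𝓔 : E → E →L[ℝ] E} (h𝓔 : ContDiff ℝ ∞ 𝓔) {z₀ : E}
    (hcomm : ∀ᶠ z in 𝓝 z₀, ∀ a b, fderiv ℝ 𝓔 z (𝓔 z a) b = fderiv ℝ 𝓔 z (𝓔 z b) a) :
    ∃ Ψ : E × E → E, SmoothNear Ψ (z₀, 0) ∧ (∀ᶠ p in 𝓝 z₀, Ψ (p, 0) = p) ∧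
      ∀ᶠ q in 𝓝 (z₀, (0 : E)), HasFDerivAt (fun a => Ψ (q.1, a)) (𝓔 (Ψ q)) q.2 := by
  have hD : ContDiff ℝ ∞ (fderiv ℝ 𝓔) := h𝓔.fderiv_right (by simp)
  let 𝓔c : C(E, E →L[ℝ] E) := ⟨𝓔, h𝓔.continuous⟩
  let D𝓔 : C(E, E →L[ℝ] E →L[ℝ] E) := ⟨fderiv ℝ 𝓔, hD.continuous⟩
  have hder : ∀ z, HasFDerivAt 𝓔c (D𝓔 z) z := fun z =>
    (h𝓔.differentiable (by simp) z).hasFDerivAt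
  let F : (E × E) × C(unitInterval, E) → C(unitInterval, E) := fun q =>
    q.2 - constCurve E q.1.1 - leafOp 𝓔c q
  have hF : ContDiff ℝ ∞ F := (contDiff_snd.sub ((constCurve E).contDiff.comp
    (contDiff_fst.comp contDiff_fst))).sub (contDiff_leafOp h𝓔)
  have hF0 : ∀ p x, F ((p, 0), x) = x - constCurve E p := by
    intro p x
    ext t
    simp [F, leafOp_apply]
  set u : (E × E) × C(unitInterval, E) := ((z₀, 0), constCurve E z₀) with hu
  have hpart : (fderiv ℝ F u ∘L .inr ℝ (E × E) C(unitInterval, E)) = .id ℝ _ := by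
    have h1 : HasFDerivAt F (fderiv ℝ F u) (((z₀, 0), constCurve E z₀)) :=
      (hF.differentiable (by simp) u).hasFDerivAt
    have h2 : HasFDerivAt (fun x : C(unitInterval, E) => (((z₀, (0 : E)) : E × E), x))
        (.inr ℝ (E × E) C(unitInterval, E)) (constCurve E z₀) := hasFDerivAt_prodMk_right _ _
    have h3 := h1.comp (constCurve E z₀) h2
    have h4 : (F ∘ fun x : C(unitInterval, E) => (((z₀, (0 : E)) : E × E), x)) =
        fun x => x - constCurve E z₀ := funext fun x => hF0 z₀ x
    rw [h4] at h3
    exact h3.unique ((hasFDerivAt_id _).sub_const _)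
  obtain ⟨φ, hφ, hφu, hFφ, huniq⟩ := exists_smooth_implicitFunction (hF.smoothNear u)
    (by rw [hu, hF0, sub_self]) (by rw [hpart]; exact ⟨.refl ℝ _, rfl⟩)
  have hev1 : ContDiff ℝ ∞ (fun x : C(unitInterval, E) => x 1) :=
    ContinuousLinearMap.contDiff (E := C(unitInterval, E)) (ContinuousMap.evalCLM ℝ (1 : unitInterval))
  refine ⟨fun q => φ q 1, (hev1.smoothNear (φ (z₀, 0))).comp hφ, ?_, ?_⟩
  · have h1 : Tendsto (fun p => (((p, 0) : E × E), constCurve E p)) (𝓝 z₀) (𝓝 u) :=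
      (by fun_prop : Continuous fun p => (((p, 0) : E × E), constCurve E p)).tendsto z₀
    filter_upwards [h1.eventually huniq] with p hp
    have h2 := hp (by rw [hF0, sub_self])
    exact congrArg (fun x : C(unitInterval, E) => x 1) h2
  · set M := ‖fderiv ℝ 𝓔 z₀‖ + 1 with hM
    have hbd : ∀ᶠ z in 𝓝 z₀, ‖fderiv ℝ 𝓔 z‖ < M := by
      have h1 : Continuous (fderiv ℝ 𝓔) := hD.continuous
      exact eventually_norm_lt (W := E →L[ℝ] E →L[ℝ] E) h1.continuousAt
    obtain ⟨ε, hε, hball⟩ := Metric.eventually_nhds_iff_ball.1 (hbd.and hcomm)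
    have hclose : ∀ᶠ q in 𝓝 (z₀, (0 : E)), dist (φ q) (constCurve E z₀) < ε := by
      have := hφ.continuousAt
      rw [ContinuousAt, hφu] at this
      exact this.eventually (Metric.ball_mem_nhds _ hε)
    have hMpos : 0 < M := by positivity
    have hsmall : ∀ᶠ q in 𝓝 (z₀, (0 : E)), ‖q.2‖ < 1 / (2 * M) :=
      (continuous_snd.norm.continuousAt (x := (z₀, (0 : E)))).eventually_lt_const
        (by simpa using hMpos)
    filter_upwards [hclose, hsmall, hFφ.eventually_nhds, hφ] with q h1 h2 h3 h4
    have hin : ∀ t, φ q t ∈ Metric.ball z₀ ε := fun t =>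
      (ContinuousMap.dist_apply_le_dist (f := φ q) (g := constCurve E z₀) t).trans_lt h1
    have hφd : HasFDerivAt φ (fderiv ℝ φ q) (q.1, q.2) :=
      (h4.differentiableAt (by simp)).hasFDerivAt
    have hφq : φ q = constCurve E q.1 + leafOp 𝓔c ((q.1, q.2), φ q) := by
      have := h3.self_of_nhds
      simp only [F] at this
      rw [sub_sub, sub_eq_zero] at this
      exact this
    have hg := ((ContinuousMap.evalCLM ℝ (1 : unitInterval)).hasFDerivAt.comp q.2
      (hφd.comp q.2 (hasFDerivAt_prodMk_right q.1 q.2)))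
    refine hg.congr_fderiv ?_
    ext b
    change fderiv ℝ φ q (0, b) 1 = 𝓔 (φ q 1) b
    refine variation_eq hder hφq (fun t => (hball _ (hin t)).2 q.2 b) (fun t => ?_) ?_
    · have h5 := (hball _ (hin t)).1
      calc ‖fderiv ℝ 𝓔 (φ q t)‖ * ‖q.2‖ ≤ M * (1 / (2 * M)) := by gcongr
        _ = 1 / 2 := by field_simp
    · -- Differentiate the integral equation in the direction `b`.
      have hline : HasDerivAt (fun t : ℝ => (q.1, q.2 + t • b)) (0, b) 0 :=
        (hasDerivAt_const (0 : ℝ) q.1).prodMk (by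
          simpa using ((hasDerivAt_id (0 : ℝ)).smul_const b).const_add q.2)
      have hq0 : (q.1, q.2 + (0 : ℝ) • b) = q := by simp
      have h5 : HasDerivAt (fun t : ℝ => φ (q.1, q.2 + t • b)) (fderiv ℝ φ q (0, b)) 0 := by
        refine HasFDerivAt.comp_hasDerivAt (0 : ℝ) ?_ hline
        rw [hq0]; exact hφd
      have h6 := hasFDerivAt_leafOp hder (((q.1, q.2), φ q)) (hline.prodMk h5) (by simp)
      have h7 := (h5.sub (hasDerivAt_const (0 : ℝ) (constCurve E q.1))).sub h6
      have h8 : Tendsto (fun t : ℝ => (q.1, q.2 + t • b)) (𝓝 0) (𝓝 q) := by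
        have := hline.continuousAt.tendsto
        rwa [hq0] at this
      have h9 := h7.unique ((hasDerivAt_const (0 : ℝ) (0 : C(unitInterval, E))).congr_of_eventuallyEq
        ((h8.eventually h3).mono fun t ht => ht))
      rw [sub_zero, sub_eq_zero] at h9
      exact h9

end Leaves

/-! ### Orthonormal fields for the Levi form -/

section Orthonormal

variable {n : ℕ} {r : CSpace n → ℝ}

theorem contDiffAt_tangentField_comp (hr : ContDiff ℝ ∞ r) {X : Type*} [NormedAddCommGroup X]
    [NormedSpace ℝ X] {v : CSpace n} {f z : X → CSpace n} {x : X} (h : delForm r (z x) v ≠ 0)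
    (hf : ContDiffAt ℝ ∞ f x) (hz : ContDiffAt ℝ ∞ z x) :
    ContDiffAt ℝ ∞ (fun x => tangentField r v (f x) (z x)) x := by
  have h1 : ContDiffAt ℝ ∞ (fun x => delForm r (z x) (f x)) x := by
    have h0 : ContDiffAt ℝ ∞ (fun x => delForm r (z x)) x :=
      (contDiff_delForm hr).contDiffAt.comp x hz
    have h0' : ContDiffAt ℝ ∞ (fun x => (delForm r (z x)).restrictScalars ℝ) x :=
      (ContinuousLinearMap.restrictScalarsL ℂ (CSpace n) ℂ ℝ ℝ).contDiff.contDiffAt.comp x h0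
    exact h0'.clm_apply hf
  have h2 : ContDiffAt ℝ ∞ (fun x => delForm r (z x) v) x :=
    (contDiffAt_delForm_apply hr v (z x)).comp x hz
  have h3 : ContDiffAt ℝ ∞ (fun x => delForm r (z x) (f x) / delForm r (z x) v) x := by
    simp only [div_eq_mul_inv]
    exact h1.mul (h2.inv h)
  exact hf.sub (h3.smul contDiffAt_const)

theorem contDiffAt_leviL_apply (hr : ContDiff ℝ ∞ r) {X : Type*} [NormedAddCommGroup X]
    [NormedSpace ℝ X] {z Y W : X → CSpace n} {x : X} (hz : ContDiffAt ℝ ∞ z x)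
    (hY : ContDiffAt ℝ ∞ Y x) (hW : ContDiffAt ℝ ∞ W x) :
    ContDiffAt ℝ ∞ (fun x => leviL r (z x) (Y x) (W x)) x := by
  have h0 : ContDiffAt ℝ ∞ (fun x => (leviL r (z x) (Y x)).restrictScalars ℝ) x :=
    (ContinuousLinearMap.restrictScalarsL ℂ (CSpace n) ℂ ℝ ℝ).contDiff.contDiffAt.comp x
      (contDiffAt_leviL hr hz hY)
  exact h0.clm_apply hW

/-- Gram–Schmidt orthonormalization with respect to the Levi form, smooth in the point. -/
theorem exists_levi_orthonormal {ι : Type*} [DecidableEq ι] {z₀ v : CSpace n}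
    (hr : ContDiff ℝ ∞ r) (hv : delForm r z₀ v ≠ 0) (f : ι → CSpace n) (s : Finset ι) :
    (∀ j ∈ s, delForm r z₀ (f j) = 0) →
    (∀ i ∈ s, ∀ j ∈ s, leviL r z₀ (f i) (f j) = if i = j then 1 else 0) →
    ∃ g : ι → CSpace n → CSpace n, (∀ j ∈ s, SmoothNear (g j) z₀ ∧ g j z₀ = f j) ∧
      ∀ᶠ p in 𝓝 z₀, (∀ j ∈ s, delForm r p (g j p) = 0) ∧
        ∀ i ∈ s, ∀ j ∈ s, leviL r p (g i p) (g j p) = if i = j then 1 else 0 := by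
  induction s using Finset.induction_on with
  | empty => exact fun _ _ => ⟨fun _ _ => 0, by simp, by simp⟩
  | insert k s hk ih =>
    intro hf hff
    obtain ⟨g, hg, hgp⟩ := ih (fun j hj => hf j (Finset.mem_insert_of_mem hj))
      fun i hi j hj => hff i (Finset.mem_insert_of_mem hi) j (Finset.mem_insert_of_mem hj)
    have hfk := hf k (Finset.mem_insert_self k s)
    let t : CSpace n → CSpace n := tangentField r v (f k)
    let u : CSpace n → CSpace n := fun p => t p - ∑ i ∈ s, leviL r p (g i p) (t p) • g i p
    let N : CSpace n → ℝ := fun p => (leviL r p (u p) (u p)).re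
    have hωv : ∀ᶠ y in 𝓝 z₀, delForm r y v ≠ 0 :=
      (contDiffAt_delForm_apply hr v z₀).continuousAt.eventually_ne hv
    have ht0 : t z₀ = f k := by simp [t, tangentField, hfk]
    have hu0 : u z₀ = f k := by
      simp only [u, ht0]
      rw [Finset.sum_eq_zero, sub_zero]
      intro i hi
      rw [(hg i hi).2, hff i (Finset.mem_insert_of_mem hi) k (Finset.mem_insert_self k s),
        if_neg (fun h : i = k => hk (h ▸ hi)), zero_smul]
    have hN0 : N z₀ = 1 := by
      simp [N, hu0, hff k (Finset.mem_insert_self k s) k (Finset.mem_insert_self k s)]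
    have hus : SmoothNear u z₀ := by
      filter_upwards [hωv, (Finset.eventually_all s).2 fun i hi => (hg i hi).1] with p hp h2
      have h1 : ContDiffAt ℝ ∞ t p := contDiffAt_tangentField hr hp
      refine h1.sub (ContDiffAt.sum fun i hi => ?_)
      exact (contDiffAt_leviL_apply hr contDiffAt_id (h2 i hi) h1).smul (h2 i hi)
    have hNs : SmoothNear N z₀ := by
      filter_upwards [hus] with p hp
      exact Complex.reCLM.contDiff.contDiffAt.comp p
        (contDiffAt_leviL_apply hr contDiffAt_id hp hp)
    have hNpos : ∀ᶠ p in 𝓝 z₀, 0 < N p :=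
      hNs.continuousAt.eventually_const_lt (by rw [hN0]; exact one_pos)
    refine ⟨Function.update g k fun p => (Real.sqrt (N p))⁻¹ • u p, ?_, ?_⟩
    · intro j hj
      rcases eq_or_ne j k with rfl | hjk
      · rw [Function.update_self]
        refine ⟨?_, by simp [hN0, hu0]⟩
        filter_upwards [hus, hNs, hNpos] with p h1 h2 h3
        exact ((h2.sqrt h3.ne').inv (Real.sqrt_pos.2 h3).ne').smul h1
      · rw [Function.update_of_ne hjk]
        exact hg j ((Finset.mem_insert.1 hj).resolve_left hjk)
    · filter_upwards [hωv, hNpos, hgp] with p hp hNp ⟨h1, h2⟩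
      have htp : delForm r p (t p) = 0 := delForm_tangentField hp
      have hr2 : ContDiffAt ℝ 2 r p := hr.contDiffAt.of_le (by norm_cast)
      have hup : delForm r p (u p) = 0 := by
        simp only [u, map_sub, map_sum, map_smul, htp]
        rw [Finset.sum_eq_zero fun i hi => by rw [h1 i hi, smul_zero], sub_zero]
      have hgu : ∀ i ∈ s, leviL r p (g i p) (u p) = 0 := by
        intro i hi
        simp only [u, map_sub, map_sum, map_smul]
        rw [Finset.sum_congr rfl fun j hj => by rw [h2 i hi j hj]]
        simp [hi]
      have hug : ∀ i ∈ s, leviL r p (u p) (g i p) = 0 := fun i hi =>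
        leviL_eq_zero_symm hr (hgu i hi)
      have huu : leviL r p (u p) (u p) = (N p : ℂ) :=
        Complex.ext rfl (by rw [leviL_self_im hr2, Complex.ofReal_im])
      have hcoe : ∀ (c : ℝ) (x : CSpace n), c • x = (c : ℂ) • x := fun _ _ => rfl
      constructor
      · intro j hj
        rcases eq_or_ne j k with rfl | hjk
        · rw [Function.update_self, hcoe, map_smul, hup, smul_zero]
        · rw [Function.update_of_ne hjk]
          exact h1 j ((Finset.mem_insert.1 hj).resolve_left hjk)
      · intro i hi j hj
        rcases eq_or_ne i k with rfl | hik
        · rcases eq_or_ne j i with rfl | hji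
          · rw [Function.update_self, hcoe, leviL_smul, map_smul, smul_apply, huu, if_pos rfl,
              Complex.conj_ofReal, smul_eq_mul, smul_eq_mul]
            rw [← Complex.ofReal_mul, ← Complex.ofReal_mul, ← Complex.ofReal_one]
            congr 1
            have hs := Real.mul_self_sqrt hNp.le
            have hs' := (Real.sqrt_pos.2 hNp).ne'
            field_simp
            nlinarith
          · have hjs := (Finset.mem_insert.1 hj).resolve_left hji
            rw [Function.update_self, Function.update_of_ne hji, hcoe, leviL_smul, smul_apply,
              hug j hjs, smul_zero, if_neg hji.symm]
        · have his := (Finset.mem_insert.1 hi).resolve_left hik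
          rcases eq_or_ne j k with rfl | hjk
          · rw [Function.update_self, Function.update_of_ne hik, hcoe, map_smul, hgu i his,
              smul_zero, if_neg hik]
          · have hjs := (Finset.mem_insert.1 hj).resolve_left hjk
            rw [Function.update_of_ne hik, Function.update_of_ne hjk, h2 i his j hjs]

/-- The complex linear part in `X` of the derivative of `∂r` in the direction `X`. -/
noncomputable def pureL (r : CSpace n → ℝ) (z X : CSpace n) : CSpace n →L[ℂ] ℂ :=
  fderiv ℝ (delForm r) z X - leviL r z X

theorem pureL_add (z X X' : CSpace n) : pureL r z (X + X') = pureL r z X + pureL r z X' := by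
  simp only [pureL, map_add, leviL_add]; abel

theorem pureL_smul (z X : CSpace n) (c : ℂ) : pureL r z (c • X) = c • pureL r z X := by
  ext Y
  simp only [pureL, sub_apply, smul_apply, smul_eq_mul, fderiv_delForm_smul, leviL_smul]
  ring

theorem pureL_sum (z : CSpace n) {ι : Type*} (s : Finset ι) (X : ι → CSpace n) :
    pureL r z (∑ i ∈ s, X i) = ∑ i ∈ s, pureL r z (X i) := by
  classical
  induction s using Finset.induction_on with
  | empty => ext; simp [pureL, leviL]
  | insert a s ha ih => rw [Finset.sum_insert ha, Finset.sum_insert ha, pureL_add, ih]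

theorem contDiffAt_pureL_apply (hr : ContDiff ℝ ∞ r) {X : Type*} [NormedAddCommGroup X]
    [NormedSpace ℝ X] {z Y W : X → CSpace n} {x : X} (hz : ContDiffAt ℝ ∞ z x)
    (hY : ContDiffAt ℝ ∞ Y x) (hW : ContDiffAt ℝ ∞ W x) :
    ContDiffAt ℝ ∞ (fun x => pureL r (z x) (Y x) (W x)) x := by
  have h1 : ContDiffAt ℝ ∞ (fun x => fderiv ℝ (delForm r) (z x)) x :=
    ((contDiff_delForm hr).fderiv_right (m := ∞) (by simp)).contDiffAt.comp x hz
  have h2 : ContDiffAt ℝ ∞ (fun x => pureL r (z x) (Y x)) x :=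
    (h1.clm_apply hY).sub (contDiffAt_leviL hr hz hY)
  have h3 : ContDiffAt ℝ ∞ (fun x => (pureL r (z x) (Y x)).restrictScalars ℝ) x :=
    (ContinuousLinearMap.restrictScalarsL ℂ (CSpace n) ℂ ℝ ℝ).contDiff.contDiffAt.comp x h2
  exact h3.clm_apply hW

theorem fderiv_tangentField (hr : ContDiff ℝ ∞ r) {v f z : CSpace n}
    (hv : delForm r z v ≠ 0) (u : CSpace n) :
    fderiv ℝ (tangentField r v f) z u = -(((fderiv ℝ (delForm r) z u f * delForm r z v
      - delForm r z f * fderiv ℝ (delForm r) z u v) / delForm r z v ^ 2) • v) := by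
  have h1 := hasDerivAt_along ((contDiff_delForm hr).differentiable (by simp) z) u
  have hD : ∀ Y : CSpace n, HasDerivAt (fun t : ℝ => delForm r (z + t • u) Y)
      (fderiv ℝ (delForm r) z u Y) 0 := fun Y => by
    simpa using hasDerivAt_apply h1 (hasDerivAt_const (0 : ℝ) Y)
  have hz : z + (0 : ℝ) • u = z := by rw [zero_smul, add_zero]
  have h2 := ((hD f).fun_div (hD v) (by rwa [hz])).smul_const v
  have h3 := h2.const_sub f
  have h4 := hasDerivAt_along ((contDiffAt_tangentField (f := f) hr hv).differentiableAt (by simp)) u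
  rw [hz] at h3
  exact h4.unique h3

/-- At a Levi null vector, the derivative of `tangentField r v f` is complex linear. -/
theorem fderiv_tangentField_I_smul (hr : ContDiff ℝ ∞ r) {v f z X : CSpace n}
    (hv : delForm r z v ≠ 0) (hX : X ∈ nullSpace r z) :
    fderiv ℝ (tangentField r v f) z (Complex.I • X) =
      Complex.I • fderiv ℝ (tangentField r v f) z X := by
  have h1 : leviL r z X (tangentField r v f z) = 0 :=
    leviL_eq_zero_symm hr (hX.2 _ (delForm_tangentField hv))
  rw [tangentField, map_sub, map_smul, smul_eq_mul, sub_eq_zero] at h1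
  rw [fderiv_tangentField hr hv, fderiv_tangentField hr hv, fderiv_delForm_I_smul,
    fderiv_delForm_I_smul, smul_neg, smul_smul, h1]
  congr 2
  field_simp
  ring

end Orthonormal

/-! ### The normalizing map -/

section NormalMap

variable {n : ℕ}

theorem exists_restrictScalars_eq {F : Type*} [NormedAddCommGroup F] [NormedSpace ℂ F]
    {T : CSpace n →L[ℝ] F} (h : ∀ X, T (Complex.I • X) = Complex.I • T X) :
    ∃ T' : CSpace n →L[ℂ] F, T'.restrictScalars ℝ = T := by
  refine ⟨LinearMap.toContinuousLinearMap
    { toFun := T, map_add' := T.map_add, map_smul' := fun c X => ?_ }, by ext; rfl⟩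
  have h1 : c • X = c.re • X + c.im • (Complex.I • X) := by
    conv_lhs => rw [← Complex.re_add_im c]
    rw [add_smul, mul_smul]; rfl
  have h2 : ∀ Y : F, c • Y = c.re • Y + c.im • (Complex.I • Y) := fun Y => by
    conv_lhs => rw [← Complex.re_add_im c]
    rw [add_smul, mul_smul]; rfl
  rw [h1, map_add, map_smul, map_smul, h, RingHom.id_apply, h2]

theorem tendsto_fst_nhds (z₀ : CSpace n) :
    Tendsto (fun q : CSpace n × CSpace n => q.1) (𝓝 (z₀, 0)) (𝓝 z₀) :=
  continuous_fst.tendsto (z₀, (0 : CSpace n))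

theorem tendsto_last (l : ℕ) (z₀ : CSpace n) :
    Tendsto (fun q : CSpace n × CSpace n => (q.1, blockProj (lastIdx n l) q.2)) (𝓝 (z₀, 0))
      (𝓝 (z₀, 0)) := by
  have h1 : Continuous fun q : CSpace n × CSpace n => (q.1, blockProj (lastIdx n l) q.2) := by
    fun_prop
  simpa using h1.tendsto (z₀, (0 : CSpace n))

theorem contDiff_blockProj (s : Finset (Fin n)) : ContDiff ℝ ∞ (blockProj s : CSpace n → CSpace n) :=
  ((blockProj s).restrictScalars ℝ).contDiff

variable [NeZero n]

/-- Data from which normal coordinates near the boundary point `z₀` are built: a function `r` with a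
transversal vector `v`, fields `g j` orthonormal for the Levi form, commuting fields `z ↦ 𝓔 z a` of
Levi null vectors, and their integral manifolds `a ↦ Ψ (p, a)`. -/
structure IsAdapted (l : ℕ) (r : CSpace n → ℝ) (v z₀ : CSpace n) (g : Fin n → CSpace n → CSpace n)
    (𝓔 : CSpace n → CSpace n →L[ℂ] CSpace n) (Ψ : CSpace n × CSpace n → CSpace n) : Prop where
  smooth : ContDiff ℝ ∞ r
  transversal : ∀ᶠ z in 𝓝 z₀, fderiv ℝ r z v = 1
  smooth_g : ∀ j ∈ midIdx n l, SmoothNear (g j) z₀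
  tangent : ∀ᶠ p in 𝓝 z₀, ∀ j ∈ midIdx n l, delForm r p (g j p) = 0
  orthonormal : ∀ᶠ p in 𝓝 z₀, ∀ i ∈ midIdx n l, ∀ j ∈ midIdx n l,
    leviL r p (g i p) (g j p) = if i = j then 1 else 0
  null : ∀ᶠ z in 𝓝 z₀, ∀ a, 𝓔 z a ∈ nullSpace r z
  last : ∀ z a, 𝓔 z (blockProj (lastIdx n l) a) = 𝓔 z a
  smooth_leaf : SmoothNear Ψ (z₀, 0)
  leaf_zero : ∀ᶠ p in 𝓝 z₀, Ψ (p, 0) = p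
  leaf_fderiv : ∀ᶠ q in 𝓝 (z₀, (0 : CSpace n)),
    HasFDerivAt (fun a => Ψ (q.1, a)) ((𝓔 (Ψ q)).restrictScalars ℝ) q.2
  injective : ∀ ζ : CSpace n,
    ζ 0 • v + ∑ j ∈ midIdx n l, ζ j • g j z₀ + 𝓔 z₀ ζ = 0 → ζ = 0

/-- The point with coordinates `ζ''` on the integral manifold through `p`. -/
noncomputable def leafPoint (l : ℕ) (Ψ : CSpace n × CSpace n → CSpace n) (q : CSpace n × CSpace n) : CSpace n :=
  Ψ (q.1, blockProj (lastIdx n l) q.2)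

/-- The inverse of the normal coordinates centred at `p`, as a function of `(p, ζ)`: one moves along
the integral manifold through `p` by `ζ''`, then in the tangent directions `g j` by `ζ'`, and finally
along `v`, with a quadratic correction that removes the pure second order terms in `ζ'`. -/
noncomputable def normalMap (l : ℕ) (r : CSpace n → ℝ) (v : CSpace n)
    (g : Fin n → CSpace n → CSpace n) (Ψ : CSpace n × CSpace n → CSpace n)
    (q : CSpace n × CSpace n) : CSpace n :=
  leafPoint l Ψ q + ∑ j ∈ midIdx n l, q.2 j • tangentField r v (g j q.1) (leafPoint l Ψ q)
    + ((2 * delForm r q.1 v)⁻¹ * (q.2 0 - ∑ i ∈ midIdx n l, ∑ j ∈ midIdx n l,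
        q.2 i * q.2 j * pureL r q.1 (g i q.1) (g j q.1))) • v

variable {l : ℕ} {r : CSpace n → ℝ} {v z₀ : CSpace n} {g : Fin n → CSpace n → CSpace n}
  {𝓔 : CSpace n → CSpace n →L[ℂ] CSpace n} {Ψ : CSpace n × CSpace n → CSpace n}

namespace IsAdapted

theorem delForm_ne (h : IsAdapted l r v z₀ g 𝓔 Ψ) : ∀ᶠ z in 𝓝 z₀, delForm r z v ≠ 0 := by
  filter_upwards [h.transversal] with z hz h0
  have := delForm_re r z v
  rw [h0, hz] at this
  simp at this

theorem smoothNear_leafPoint (h : IsAdapted l r v z₀ g 𝓔 Ψ) :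
    SmoothNear (leafPoint l Ψ) (z₀, 0) := by
  have h1 : ContDiff ℝ ∞ fun q : CSpace n × CSpace n => (q.1, blockProj (lastIdx n l) q.2) :=
    contDiff_fst.prodMk ((contDiff_blockProj _).comp contDiff_snd)
  refine SmoothNear.comp (f := fun q : CSpace n × CSpace n => (q.1, blockProj (lastIdx n l) q.2))
    (g := Ψ) ?_ (h1.smoothNear _)
  simpa using h.smooth_leaf

theorem leafPoint_zero (h : IsAdapted l r v z₀ g 𝓔 Ψ) : ∀ᶠ p in 𝓝 z₀, leafPoint l Ψ (p, 0) = p := by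
  filter_upwards [h.leaf_zero] with p hp
  rwa [leafPoint, map_zero]

theorem tendsto_leafPoint (h : IsAdapted l r v z₀ g 𝓔 Ψ) :
    Tendsto (leafPoint l Ψ) (𝓝 (z₀, 0)) (𝓝 z₀) := by
  have h1 := h.smoothNear_leafPoint.continuousAt.tendsto
  rwa [h.leafPoint_zero.self_of_nhds] at h1

theorem leafPoint_fderiv (h : IsAdapted l r v z₀ g 𝓔 Ψ) : ∀ᶠ q in 𝓝 (z₀, (0 : CSpace n)),
    HasFDerivAt (fun ζ => leafPoint l Ψ (q.1, ζ)) (𝓔 (leafPoint l Ψ q)) q.2 := by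
  filter_upwards [(tendsto_last l z₀).eventually h.leaf_fderiv] with q hq
  have h1 : HasFDerivAt (fun ζ => leafPoint l Ψ (q.1, ζ)) ((𝓔 (leafPoint l Ψ q)).restrictScalars ℝ
      ∘L (blockProj (lastIdx n l)).restrictScalars ℝ) q.2 :=
    hq.comp q.2 ((blockProj (lastIdx n l)).restrictScalars ℝ).hasFDerivAt
  refine hasFDerivAt_of_restrictScalars ℝ h1 ?_
  ext X
  simp [h.last]

/-- The defining function is constant on the integral manifolds. -/
theorem r_leafPoint (h : IsAdapted l r v z₀ g 𝓔 Ψ) : ∀ᶠ q in 𝓝 (z₀, (0 : CSpace n)),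
    r (leafPoint l Ψ q) = r q.1 := by
  have h1 := (h.leafPoint_fderiv.and (h.tendsto_leafPoint.eventually h.null)).and
    ((tendsto_fst_nhds z₀).eventually h.leafPoint_zero)
  obtain ⟨ε, hε, hb⟩ := Metric.eventually_nhds_iff_ball.1 h1
  filter_upwards [Metric.ball_mem_nhds _ hε] with q hq
  have hp : q.1 ∈ Metric.ball z₀ ε := by
    rw [← ball_prod_same] at hq; exact hq.1
  have hζ : q.2 ∈ Metric.ball (0 : CSpace n) ε := by
    rw [← ball_prod_same] at hq; exact hq.2
  have hmem : ∀ ζ ∈ Metric.ball (0 : CSpace n) ε, (q.1, ζ) ∈ Metric.ball (z₀, (0 : CSpace n)) ε := by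
    intro ζ hζ
    rw [← ball_prod_same]; exact ⟨hp, hζ⟩
  have hd : ∀ ζ ∈ Metric.ball (0 : CSpace n) ε,
      HasFDerivAt (fun ζ => r (leafPoint l Ψ (q.1, ζ))) (0 : CSpace n →L[ℝ] ℝ) ζ := by
    intro ζ hζ
    obtain ⟨⟨e1, e2⟩, -⟩ := hb _ (hmem ζ hζ)
    have e3 := (h.smooth.differentiable (by simp) (leafPoint l Ψ (q.1, ζ))).hasFDerivAt.comp ζ
      (e1.restrictScalars ℝ)
    refine e3.congr_fderiv ?_
    ext X
    change fderiv ℝ r _ (𝓔 _ X) = 0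
    rw [fderiv_eq_two_mul_re, (e2 X).1]
    simp
  have h2 := Metric.isOpen_ball.is_const_of_fderiv_eq_zero (𝕜 := ℝ)
    (convex_ball (0 : CSpace n) ε).isPreconnected
    (fun ζ hζ => (hd ζ hζ).differentiableAt.differentiableWithinAt)
    (fun ζ hζ => (hd ζ hζ).fderiv) hζ (Metric.mem_ball_self hε)
  have h3 := (hb _ hq).2
  exact h2.trans (congrArg r h3)

theorem smoothNear_normalMap (h : IsAdapted l r v z₀ g 𝓔 Ψ) :
    SmoothNear (normalMap l r v g Ψ) (z₀, 0) := by
  have hg := (Finset.eventually_all (midIdx n l)).2 h.smooth_g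
  filter_upwards [(tendsto_fst_nhds z₀).eventually hg, h.smoothNear_leafPoint,
    h.tendsto_leafPoint.eventually h.delForm_ne, (tendsto_fst_nhds z₀).eventually h.delForm_ne]
    with q h1 h2 h3 h4
  have hc : ∀ j, ContDiffAt ℝ ∞ (fun q : CSpace n × CSpace n => q.2 j) q := fun j =>
    (((EuclideanSpace.proj j : CSpace n →L[ℂ] ℂ).restrictScalars ℝ).contDiff.comp
      contDiff_snd).contDiffAt
  have hgq : ∀ j ∈ midIdx n l, ContDiffAt ℝ ∞ (fun q : CSpace n × CSpace n => g j q.1) q :=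
    fun j hj => (h1 j hj).comp q contDiffAt_fst
  have hω : ContDiffAt ℝ ∞ (fun q : CSpace n × CSpace n => delForm r q.1 v) q :=
    (contDiffAt_delForm_apply h.smooth v q.1).comp q contDiffAt_fst
  have hQ : ContDiffAt ℝ ∞ (fun q : CSpace n × CSpace n => ∑ i ∈ midIdx n l, ∑ j ∈ midIdx n l,
      q.2 i * q.2 j * pureL r q.1 (g i q.1) (g j q.1)) q :=
    ContDiffAt.sum fun i hi => ContDiffAt.sum fun j hj => ((hc i).mul (hc j)).mul
      (contDiffAt_pureL_apply h.smooth contDiffAt_fst (hgq i hi) (hgq j hj))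
  have hκ : ContDiffAt ℝ ∞ (fun q : CSpace n × CSpace n => (2 * delForm r q.1 v)⁻¹) q :=
    (contDiffAt_const.mul hω).inv (mul_ne_zero two_ne_zero h4)
  exact (h2.add (ContDiffAt.sum fun j hj => (hc j).smul
    (contDiffAt_tangentField_comp h.smooth h3 (hgq j hj) h2))).add
      ((hκ.mul ((hc 0).sub hQ)).smul contDiffAt_const)

/-- `tangentField` is holomorphic along the integral manifolds. -/
theorem differentiableAt_tangentField (h : IsAdapted l r v z₀ g 𝓔 Ψ) :
    ∀ᶠ q in 𝓝 (z₀, (0 : CSpace n)), ∀ f : CSpace n,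
      DifferentiableAt ℂ (fun ζ => tangentField r v f (leafPoint l Ψ (q.1, ζ))) q.2 := by
  filter_upwards [h.leafPoint_fderiv, h.tendsto_leafPoint.eventually h.delForm_ne,
    h.tendsto_leafPoint.eventually h.null] with q h1 h2 h3 f
  have h4 : HasFDerivAt (tangentField r v f) (fderiv ℝ (tangentField r v f) (leafPoint l Ψ q))
      (leafPoint l Ψ q) :=
    ((contDiffAt_tangentField h.smooth h2).differentiableAt (by simp)).hasFDerivAt
  have h5 := HasFDerivAt.comp (g := tangentField r v f) q.2 h4 (h1.restrictScalars ℝ)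
  obtain ⟨T, hT⟩ := exists_restrictScalars_eq (T := fderiv ℝ (tangentField r v f) (leafPoint l Ψ q)
      ∘L (𝓔 (leafPoint l Ψ q)).restrictScalars ℝ) (fun X => by
    change fderiv ℝ (tangentField r v f) _ (𝓔 _ (Complex.I • X)) =
      Complex.I • fderiv ℝ (tangentField r v f) _ (𝓔 _ X)
    rw [map_smul, fderiv_tangentField_I_smul h.smooth h2 (h3 X)])
  exact (hasFDerivAt_of_restrictScalars ℝ h5 hT).differentiableAt

theorem differentiableAt_normalMap (h : IsAdapted l r v z₀ g 𝓔 Ψ) :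
    ∀ᶠ q in 𝓝 (z₀, (0 : CSpace n)),
      DifferentiableAt ℂ (fun ζ => normalMap l r v g Ψ (q.1, ζ)) q.2 := by
  filter_upwards [h.leafPoint_fderiv, h.differentiableAt_tangentField] with q h1 h2
  have hc : ∀ j, DifferentiableAt ℂ (fun ζ : CSpace n => ζ j) q.2 := fun j =>
    (EuclideanSpace.proj j : CSpace n →L[ℂ] ℂ).differentiableAt
  have hQ : DifferentiableAt ℂ (fun ζ : CSpace n => ∑ i ∈ midIdx n l, ∑ j ∈ midIdx n l,
      ζ i * ζ j * pureL r q.1 (g i q.1) (g j q.1)) q.2 :=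
    DifferentiableAt.fun_sum fun i _ => DifferentiableAt.fun_sum fun j _ =>
      ((hc i).fun_mul (hc j)).mul_const (pureL r q.1 (g i q.1) (g j q.1))
  exact (h1.differentiableAt.fun_add (DifferentiableAt.fun_sum fun j _ => (hc j).fun_smul
    (h2 (g j q.1)))).fun_add ((((hc 0).fun_sub hQ).const_mul (2 * delForm r q.1 v)⁻¹).smul_const v)

/-- The derivative of `normalMap` at points with `ζ' = 0`. -/
theorem normalMap_fderiv (h : IsAdapted l r v z₀ g 𝓔 Ψ) :
    ∀ᶠ q in 𝓝 (z₀, (0 : CSpace n)), (∀ j ∈ midIdx n l, q.2 j = 0) →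
      ∃ T : CSpace n →L[ℂ] CSpace n, HasFDerivAt (fun ζ => normalMap l r v g Ψ (q.1, ζ)) T q.2 ∧
        ∀ X, T X = 𝓔 (leafPoint l Ψ q) X
          + ∑ j ∈ midIdx n l, X j • tangentField r v (g j q.1) (leafPoint l Ψ q)
          + ((2 * delForm r q.1 v)⁻¹ * X 0) • v := by
  filter_upwards [h.leafPoint_fderiv, h.differentiableAt_tangentField] with q h1 h2 h0
  have hc : ∀ j, HasFDerivAt (fun ζ : CSpace n => ζ j) (EuclideanSpace.proj j : CSpace n →L[ℂ] ℂ)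
      q.2 := fun j => (EuclideanSpace.proj j : CSpace n →L[ℂ] ℂ).hasFDerivAt
  have h3 := HasFDerivAt.fun_sum fun j (_ : j ∈ midIdx n l) => (hc j).fun_smul
    (h2 (g j q.1)).hasFDerivAt
  have h4 := HasFDerivAt.fun_sum fun i (_ : i ∈ midIdx n l) => HasFDerivAt.fun_sum
    fun j (_ : j ∈ midIdx n l) => ((hc i).fun_mul (hc j)).mul_const
      (pureL r q.1 (g i q.1) (g j q.1))
  have h5 := (((hc 0).fun_sub h4).const_mul (2 * delForm r q.1 v)⁻¹).smul_const v
  refine ⟨_, (h1.fun_add h3).fun_add h5, fun X => ?_⟩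
  have e1 : (∑ i ∈ midIdx n l, ∑ j ∈ midIdx n l, pureL r q.1 (g i q.1) (g j q.1) •
      (q.2 i • (EuclideanSpace.proj j : CSpace n →L[ℂ] ℂ) + q.2 j • EuclideanSpace.proj i)) = 0 :=
    Finset.sum_eq_zero fun i hi => Finset.sum_eq_zero fun j hj => by
      ext; simp [h0 i hi, h0 j hj]
  rw [e1]
  simp only [add_apply, sum_apply, smul_apply, sub_zero, ContinuousLinearMap.smulRight_apply,
    smul_eq_mul, PiLp.proj_apply]
  congr 2
  refine Finset.sum_congr rfl fun j hj => ?_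
  rw [h0 j hj, zero_smul, zero_add]

end IsAdapted
end NormalMap

/-! ### The defining function in normal coordinates -/

section NormalForm

variable {n : ℕ} {r : CSpace n → ℝ} {g : Fin n → CSpace n → CSpace n}

theorem levi_sum_orthonormal {p : CSpace n} {s : Finset (Fin n)}
    (h : ∀ i ∈ s, ∀ j ∈ s, leviL r p (g i p) (g j p) = if i = j then 1 else 0) (X : CSpace n) :
    leviL r p (∑ j ∈ s, X j • g j p) (∑ j ∈ s, X j • g j p) = ((∑ j ∈ s, ‖X j‖ ^ 2 : ℝ) : ℂ) := by
  rw [leviL_sum, sum_apply, Complex.ofReal_sum]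
  refine Finset.sum_congr rfl fun i hi => ?_
  rw [leviL_smul, smul_apply, map_sum,
    Finset.sum_congr rfl fun j hj => by rw [map_smul, h i hi j hj]]
  simp only [smul_eq_mul, mul_ite, mul_one, mul_zero, Finset.sum_ite_eq, hi, if_true]
  rw [mul_comm, Complex.mul_conj, Complex.normSq_eq_norm_sq]

theorem hasDerivAt_comp_line {V : Type*} [NormedAddCommGroup V] [NormedSpace ℝ V] {f : V → ℝ}
    (hf : ContDiff ℝ ∞ f) (x u : V) (t : ℝ) :
    HasDerivAt (fun t : ℝ => f (x + t • u)) (fderiv ℝ f (x + t • u) u) t := by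
  have e1 : HasDerivAt (fun t : ℝ => x + t • u) u t := by
    simpa using ((hasDerivAt_id t).smul_const u).const_add x
  exact (hf.differentiable (by simp) _).hasFDerivAt.comp_hasDerivAt t e1

theorem hasDerivAt_fderiv_line {V : Type*} [NormedAddCommGroup V] [NormedSpace ℝ V] {f : V → ℝ}
    (hf : ContDiff ℝ ∞ f) (x u w : V) :
    HasDerivAt (fun t : ℝ => fderiv ℝ f (x + t • u) w) (fderiv ℝ (fderiv ℝ f) x u w) 0 := by
  have e1 : HasDerivAt (fun t : ℝ => x + t • u) u 0 := by
    simpa using ((hasDerivAt_id (0 : ℝ)).smul_const u).const_add x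
  have e2 : HasFDerivAt (fun y => fderiv ℝ f y w) ((ContinuousLinearMap.apply ℝ ℝ w) ∘L
      fderiv ℝ (fderiv ℝ f) x) (x + (0 : ℝ) • u) := by
    rw [zero_smul, add_zero]
    exact (ContinuousLinearMap.apply ℝ ℝ w).hasFDerivAt.comp x
      ((hf.fderiv_right (m := ∞) (by simp)).differentiable (by simp) x).hasFDerivAt
  exact e2.comp_hasDerivAt (0 : ℝ) e1

theorem eq_two_mul_levi_of_curve (hr : ContDiff ℝ ∞ r) {p w v : CSpace n} {k k' : ℝ → ℝ} {m : ℝ}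
    (hω : delForm r p v ≠ 0) (hk : ∀ t, HasDerivAt k (k' t) t) (hk'd : HasDerivAt k' m 0)
    (hk0 : k 0 = 0) (hk'0 : k' 0 = 0)
    (hrc : ∀ᶠ t : ℝ in 𝓝 0, r (p + (t : ℂ) • w +
      ((2 * delForm r p v)⁻¹ * (-(k t : ℂ) - (t : ℂ) ^ 2 * pureL r p w w)) • v) = r p) :
    m = 2 * (leviL r p w w).re := by
  set Q := pureL r p w w with hQ
  set κ := (2 * delForm r p v)⁻¹ with hκ
  let c : ℝ → CSpace n := fun t => p + (t : ℂ) • w + (κ * (-(k t : ℂ) - (t : ℂ) ^ 2 * Q)) • v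
  let c' : ℝ → CSpace n := fun t => w + (κ * (-(k' t : ℂ) - 2 * (t : ℂ) * Q)) • v
  have hof : ∀ t : ℝ, HasDerivAt (fun t : ℝ => (t : ℂ)) 1 t := fun t => by
    simpa using (hasDerivAt_id t).ofReal_comp
  have hc : ∀ t, HasDerivAt c (c' t) t := by
    intro t
    have e1 := ((((hk t).ofReal_comp.neg.sub (((hof t).pow 2).mul_const Q)).const_mul κ).smul_const
      v)
    have e2 := (((hof t).smul_const w).const_add p).add e1
    refine e2.congr_deriv ?_
    simp [c']
  have hc' : HasDerivAt c' ((κ * (-(m : ℂ)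
      - 2 * Q)) • v) 0 := by
    have e1 := (((hk'd.ofReal_comp.neg.sub (((hof 0).const_mul 2).mul_const Q)).const_mul
      κ).smul_const v).const_add w
    refine e1.congr_deriv ?_
    simp
  have hc0 : c 0 = p := by simp [c, hk0]
  have hc'0 : c' 0 = w := by simp [c', hk'0]
  have hrd : ∀ᶠ t in 𝓝 (0 : ℝ), fderiv ℝ r (c t) (c' t) = 0 := by
    filter_upwards [hrc.eventually_nhds] with t ht
    exact ((hr.differentiable (by simp) (c t)).hasFDerivAt.comp_hasDerivAt t (hc t)).unique
      ((hasDerivAt_const t (r p)).congr_of_eventuallyEq ht)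
  have hdd : DifferentiableAt ℝ (fderiv ℝ r) (c 0) :=
    (hr.fderiv_right (m := ∞) (by simp)).differentiable (by simp) _
  have e1 := ((hdd.hasFDerivAt.comp_hasDerivAt (0 : ℝ) (hc 0)).clm_apply hc').unique
    ((hasDerivAt_const (0 : ℝ) (0 : ℝ)).congr_of_eventuallyEq hrd)
  simp only [Function.comp_apply] at e1
  rw [hc'0, hc0] at e1
  rw [hc0] at hdd
  rw [hessian_eq_two_mul_re hdd, fderiv_eq_two_mul_re, map_smul, smul_eq_mul] at e1
  have e2 : fderiv ℝ (delForm r) p w w = Q + leviL r p w w := by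
    rw [hQ, pureL, sub_apply, sub_add_cancel]
  have e3 : κ * (-(m : ℂ) - 2 * Q) * delForm r p v = ((2⁻¹ : ℝ) : ℂ) * (-(m : ℂ) - 2 * Q) := by
    rw [hκ]; push_cast; field_simp
  rw [e2, e3, Complex.add_re, Complex.re_ofReal_mul] at e1
  simp at e1
  linarith

variable [NeZero n] {l : ℕ} {v z₀ : CSpace n} {𝓔 : CSpace n → CSpace n →L[ℂ] CSpace n}
  {Ψ : CSpace n × CSpace n → CSpace n}

/-- The second derivative of the defining function in the directions `ζ'`. -/
theorem hessian_mid {ρ : CSpace n × CSpace n → ℝ} {p X : CSpace n} (hl : l < n)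
    (hr : ContDiff ℝ ∞ r) (hρ : ContDiff ℝ ∞ ρ) (hω : delForm r p v ≠ 0)
    (h4 : ∀ i ∈ midIdx n l, ∀ j ∈ midIdx n l, leviL r p (g i p) (g j p) = if i = j then 1 else 0)
    (h2 : ∀ ζ : CSpace n, blockProj (lastIdx n l) ζ = 0 → normalMap l r v g Ψ (p, ζ) =
      p + ∑ j ∈ midIdx n l, ζ j • g j p + ((2 * delForm r p v)⁻¹ * (ζ 0 -
        pureL r p (∑ j ∈ midIdx n l, ζ j • g j p) (∑ j ∈ midIdx n l, ζ j • g j p))) • v)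
    (h6 : ρ (p, 0) = 0) (h3 : ∀ X : CSpace n, fderiv ℝ ρ (p, 0) (0, X) = (X 0).re)
    (hX : blockProj (midIdx n l) X = X)
    (h1 : ∀ᶠ t : ℝ in 𝓝 0, r (normalMap l r v g Ψ
      (p, t • X - ρ (p, t • X) • EuclideanSpace.single 0 1)) = r p) :
    fderiv ℝ (fderiv ℝ ρ) (p, 0) (0, X) (0, X) = 2 * ∑ j ∈ midIdx n l, ‖X j‖ ^ 2 := by
  set e0 : CSpace n := EuclideanSpace.single 0 1 with he0
  set w := ∑ j ∈ midIdx n l, X j • g j p with hw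
  have hX0 : X 0 = 0 := by rw [← hX, blockProj_apply, if_neg zero_notMem_midIdx]
  have hXl : blockProj (lastIdx n l) X = 0 := by
    ext j
    rw [blockProj_apply, ← hX, blockProj_apply]
    split_ifs with e1 e2
    · exact absurd e1 (notMem_lastIdx_of_mem_midIdx e2)
    · rfl
    · rfl
  have he0l : blockProj (lastIdx n l) e0 = 0 := by
    ext j
    rw [blockProj_apply]
    split_ifs with e1
    · have : j ≠ 0 := fun e => zero_notMem_lastIdx hl (e ▸ e1)
      simp [he0, this]
    · rfl
  let k : ℝ → ℝ := fun t => ρ (p, t • X)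
  let k' : ℝ → ℝ := fun t => fderiv ℝ ρ ((p, 0) + t • (0, X)) (0, X)
  have hline : ∀ t : ℝ, ((p, 0) + t • (0, X) : CSpace n × CSpace n) = (p, t • X) := fun t => by
    simp
  have hk : ∀ t, HasDerivAt k (k' t) t := fun t => by
    have e1 := hasDerivAt_comp_line hρ ((p, 0) : CSpace n × CSpace n) (0, X) t
    simp only [hline] at e1
    simp only [k', hline]
    exact e1
  have hk'd : HasDerivAt k' (fderiv ℝ (fderiv ℝ ρ) (p, 0) (0, X) (0, X)) 0 :=
    hasDerivAt_fderiv_line hρ ((p, 0) : CSpace n × CSpace n) (0, X) (0, X)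
  have hk0 : k 0 = 0 := by
    simpa [k] using h6
  have hk'0 : k' 0 = 0 := by
    have e1 := h3 X
    rw [hX0] at e1
    simp only [k', hline, zero_smul]
    exact e1
  have hrc : ∀ᶠ t : ℝ in 𝓝 0, r (p + (t : ℂ) • w +
      ((2 * delForm r p v)⁻¹ * (-(k t : ℂ) - (t : ℂ) ^ 2 * pureL r p w w)) • v) = r p := by
    filter_upwards [h1] with t ht
    have e2 : blockProj (lastIdx n l) (t • X - k t • e0) = 0 := by
      have : ∀ (a : ℝ) (Y : CSpace n), a • Y = (a : ℂ) • Y := fun _ _ => rfl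
      rw [map_sub, this t, this (k t), map_smul, map_smul, hXl, he0l, smul_zero, smul_zero,
        sub_zero]
    have e3 := h2 _ e2
    have e4 : ∑ j ∈ midIdx n l, (t • X - k t • e0) j • g j p = (t : ℂ) • w := by
      rw [hw, Finset.smul_sum]
      refine Finset.sum_congr rfl fun j hj => ?_
      have : j ≠ 0 := fun e => zero_notMem_midIdx (e ▸ hj)
      rw [smul_smul]
      simp [he0, this]
    have e5 : (t • X - k t • e0) 0 = -(k t : ℂ) := by simp [he0, hX0]
    rw [e4, e5, pureL_smul, smul_apply, map_smul, smul_smul, smul_eq_mul, ← pow_two] at e3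
    rw [← e3]
    exact ht
  have e1 := eq_two_mul_levi_of_curve hr hω hk hk'd hk0 hk'0 hrc
  rw [e1, hw, levi_sum_orthonormal h4, Complex.ofReal_re]

namespace IsAdapted

theorem normalMap_of_last_eq_zero (h : IsAdapted l r v z₀ g 𝓔 Ψ) : ∀ᶠ p in 𝓝 z₀, ∀ ζ : CSpace n,
    blockProj (lastIdx n l) ζ = 0 → normalMap l r v g Ψ (p, ζ) =
      p + ∑ j ∈ midIdx n l, ζ j • g j p + ((2 * delForm r p v)⁻¹ * (ζ 0 -
        pureL r p (∑ j ∈ midIdx n l, ζ j • g j p) (∑ j ∈ midIdx n l, ζ j • g j p))) • v := by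
  filter_upwards [h.leaf_zero, h.tangent] with p h1 h2 ζ hζ
  have h3 : leafPoint l Ψ (p, ζ) = p := by rw [leafPoint, hζ]; exact h1
  have h4 : ∀ j ∈ midIdx n l, tangentField r v (g j p) p = g j p := fun j hj => by
    simp [tangentField, h2 j hj]
  simp only [normalMap, h3]
  rw [Finset.sum_congr rfl fun j hj => by rw [h4 j hj]]
  congr 5
  rw [pureL_sum, sum_apply]
  refine Finset.sum_congr rfl fun i hi => ?_
  rw [pureL_smul, smul_apply, map_sum, Finset.smul_sum]
  refine Finset.sum_congr rfl fun j hj => ?_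
  rw [map_smul, smul_smul, smul_eq_mul]

theorem normalMap_of_eq_last {q : CSpace n × CSpace n} (hl : l < n)
    (hq : blockProj (lastIdx n l) q.2 = q.2) :
    (∀ j ∈ midIdx n l, q.2 j = 0) ∧ normalMap l r v g Ψ q = leafPoint l Ψ q := by
  have h1 : ∀ j ∈ midIdx n l, q.2 j = 0 := fun j hj => by
    rw [← hq, blockProj_apply, if_neg (notMem_lastIdx_of_mem_midIdx hj)]
  have h2 : q.2 0 = 0 := by rw [← hq, blockProj_apply, if_neg (zero_notMem_lastIdx hl)]
  refine ⟨h1, ?_⟩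
  rw [normalMap, h2, Finset.sum_eq_zero fun j hj => by rw [h1 j hj, zero_smul],
    Finset.sum_eq_zero fun i hi => Finset.sum_eq_zero fun j hj => by
      rw [h1 i hi, zero_mul, zero_mul]]
  simp

/-- The defining function pulled back by the normalizing map, minus its value at the centre. -/
theorem smoothNear_pullback (h : IsAdapted l r v z₀ g 𝓔 Ψ) :
    SmoothNear (fun q => r (normalMap l r v g Ψ q) - r q.1) (z₀, 0) := by
  filter_upwards [h.smoothNear_normalMap] with q hq
  exact (h.smooth.contDiffAt.comp q hq).sub (h.smooth.contDiffAt.comp q contDiffAt_fst)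

theorem pullback_fderiv (h : IsAdapted l r v z₀ g 𝓔 Ψ) (hl : l < n) :
    ∀ᶠ q in 𝓝 (z₀, (0 : CSpace n)), blockProj (lastIdx n l) q.2 = q.2 → ∀ X,
      fderiv ℝ (fun q => r (normalMap l r v g Ψ q) - r q.1) q (0, X) =
        ((delForm r q.1 v)⁻¹ * X 0 * delForm r (leafPoint l Ψ q) v).re := by
  filter_upwards [h.smoothNear_pullback, h.normalMap_fderiv,
    h.tendsto_leafPoint.eventually h.null, h.tendsto_leafPoint.eventually h.delForm_ne]
    with q h1 h2 h3 h4 hq X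
  obtain ⟨hm, hN⟩ := normalMap_of_eq_last (r := r) (v := v) (g := g) (Ψ := Ψ) hl hq
  obtain ⟨T, hT, hTX⟩ := h2 hm
  have e1 : HasFDerivAt (fun ζ : CSpace n => r (normalMap l r v g Ψ (q.1, ζ)) - r q.1)
      (fderiv ℝ (fun q => r (normalMap l r v g Ψ q) - r q.1) q ∘L .inr ℝ (CSpace n) (CSpace n))
      q.2 :=
    HasFDerivAt.comp (g := fun q => r (normalMap l r v g Ψ q) - r q.1) q.2
      (h1.differentiableAt (by simp)).hasFDerivAt (hasFDerivAt_prodMk_right q.1 q.2)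
  have e2 : HasFDerivAt (fun ζ : CSpace n => r (normalMap l r v g Ψ (q.1, ζ)) - r q.1)
      (fderiv ℝ r (normalMap l r v g Ψ q) ∘L T.restrictScalars ℝ) q.2 :=
    (HasFDerivAt.comp (g := r) q.2 (h.smooth.differentiable (by simp) _).hasFDerivAt
      (hT.restrictScalars ℝ)).sub_const _
  have e3 := congrArg (fun S : CSpace n →L[ℝ] ℝ => S X) (e1.unique e2)
  change fderiv ℝ _ q (0, X) = fderiv ℝ r (normalMap l r v g Ψ q) (T X) at e3
  rw [e3, hTX, hN, fderiv_eq_two_mul_re, map_add, map_add, (h3 X).1, zero_add, map_sum,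
    Finset.sum_eq_zero fun j hj => by rw [map_smul, delForm_tangentField h4, smul_zero],
    zero_add, map_smul, smul_eq_mul, mul_inv]
  have e4 : (2 : ℂ)⁻¹ * (delForm r q.1 v)⁻¹ * X 0 * delForm r (leafPoint l Ψ q) v =
      ((2⁻¹ : ℝ) : ℂ) * ((delForm r q.1 v)⁻¹ * X 0 * delForm r (leafPoint l Ψ q) v) := by
    push_cast; ring
  rw [e4, Complex.re_ofReal_mul]
  ring

/-- The defining function `ρ` in normal coordinates, normalized so that translation in the direction
`Re ζ_1` shifts its values. It vanishes together with its derivatives in the directions `X 0 = 0` on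
the leaf, and its Hessian in `ζ'` at the centre is that of `∑ |ζ_j|²`. -/
theorem exists_normal_form (h : IsAdapted l r v z₀ g 𝓔 Ψ) (hl : l < n) :
    ∃ ρ : CSpace n × CSpace n → ℝ, ContDiff ℝ ∞ ρ ∧
      (∀ᶠ q in 𝓝 (z₀, (0 : CSpace n)), (ρ q < 0 ↔ r (normalMap l r v g Ψ q) < r q.1) ∧
        (ρ q = 0 ↔ r (normalMap l r v g Ψ q) = r q.1)) ∧
      (∀ᶠ x in 𝓝 ((z₀, (0 : CSpace n)), (0 : ℝ)),
        ρ (x.1.1, x.1.2 + x.2 • EuclideanSpace.single 0 1) = ρ x.1 + x.2) ∧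
      (∀ᶠ q in 𝓝 (z₀, (0 : CSpace n)), blockProj (lastIdx n l) q.2 = q.2 →
        ρ q = 0 ∧ ∀ X : CSpace n, X 0 = 0 → fderiv ℝ ρ q (0, X) = 0) ∧
      (∀ᶠ p in 𝓝 z₀, ∀ X : CSpace n, fderiv ℝ ρ (p, 0) (0, X) = (X 0).re) ∧
      ∀ᶠ p in 𝓝 z₀, ∀ X : CSpace n, blockProj (midIdx n l) X = X →
        fderiv ℝ (fderiv ℝ ρ) (p, 0) (0, X) (0, X) = 2 * ∑ j ∈ midIdx n l, ‖X j‖ ^ 2 := by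
  set G : CSpace n × CSpace n → ℝ := fun q => r (normalMap l r v g Ψ q) - r q.1 with hGdef
  set e0 : CSpace n := EuclideanSpace.single 0 1 with he0
  have hG : SmoothNear G (z₀, 0) := h.smoothNear_pullback
  have hGd := h.pullback_fderiv hl
  have hleaf0 := h.leafPoint_zero
  have hG0 : ∀ᶠ q in 𝓝 (z₀, (0 : CSpace n)), blockProj (lastIdx n l) q.2 = q.2 → G q = 0 := by
    filter_upwards [h.r_leafPoint] with q h1 hq
    rw [hGdef]
    simp only
    rw [(normalMap_of_eq_last hl hq).2, h1, sub_self]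
  have hωz₀ := h.delForm_ne.self_of_nhds
  have hGe : 0 < fderiv ℝ G (z₀, 0) (0, e0) := by
    rw [hGd.self_of_nhds (map_zero _), hleaf0.self_of_nhds]
    simp [he0, hωz₀]
  obtain ⟨s, hs, hs0, hGs, hsgn, htr⟩ :=
    exists_graph_function hG (hG0.self_of_nhds (map_zero _)) hGe
  obtain ⟨ρ, hρ, hρs⟩ := hs.exists_contDiff
  have hz : Tendsto (fun p : CSpace n => (p, (0 : CSpace n))) (𝓝 z₀) (𝓝 (z₀, 0)) :=
    (by fun_prop : Continuous fun p : CSpace n => (p, (0 : CSpace n))).tendsto z₀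
  have hsgn' : ∀ᶠ q in 𝓝 (z₀, (0 : CSpace n)), (ρ q < 0 ↔ r (normalMap l r v g Ψ q) < r q.1) ∧
        (ρ q = 0 ↔ r (normalMap l r v g Ψ q) = r q.1) := by
    filter_upwards [hsgn, hρs] with q h1 h2
    rw [h2, ← h1.1, ← h1.2, hGdef]
    exact ⟨sub_neg, sub_eq_zero⟩
  have hGρ : ∀ᶠ q in 𝓝 (z₀, (0 : CSpace n)), G (q.1, q.2 - ρ q • e0) = 0 := by
    filter_upwards [hGs, hρs] with q h1 h2
    rw [h2, h1]
  have hρ0 : ∀ᶠ q in 𝓝 (z₀, (0 : CSpace n)), blockProj (lastIdx n l) q.2 = q.2 → ρ q = 0 := by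
    filter_upwards [hG0, hsgn'] with q h1 h2 hq
    exact h2.2.2 (sub_eq_zero.1 (h1 hq))
  -- Implicit differentiation of `G (p, ζ - ρ(p, ζ) e₀) = 0` at points of the leaf.
  have hρd : ∀ᶠ q in 𝓝 (z₀, (0 : CSpace n)), blockProj (lastIdx n l) q.2 = q.2 → ∀ X : CSpace n,
      fderiv ℝ G q (0, X) = fderiv ℝ ρ q (0, X) * fderiv ℝ G q (0, e0) := by
    filter_upwards [hGρ.eventually_nhds, hρ0, hG] with q h1 h2 h3 hq X
    have h2q := h2 hq
    have e1 := hasDerivAt_along (hρ.differentiable (by simp) q) ((0, X) : CSpace n × CSpace n)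
    have e2 : HasDerivAt (fun t : ℝ => (q.1, q.2 + t • X - ρ (q + t • (0, X)) • e0))
        ((0, X - fderiv ℝ ρ q (0, X) • e0) : CSpace n × CSpace n) 0 :=
      (hasDerivAt_const _ _).prodMk ((hasDerivAt_line q.2 X).sub (e1.smul_const e0))
    have e3 : HasFDerivAt G (fderiv ℝ G q)
        (q.1, q.2 + (0 : ℝ) • X - ρ (q + (0 : ℝ) • (0, X)) • e0) := by
      have : (q.1, q.2 + (0 : ℝ) • X - ρ (q + (0 : ℝ) • (0, X)) • e0) = q := by
        rw [zero_smul, zero_smul, add_zero, add_zero, h2q, zero_smul, sub_zero]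
      rw [this]
      exact (h3.differentiableAt (by simp)).hasFDerivAt
    have e4 := e3.comp_hasDerivAt (0 : ℝ) e2
    have e5 : Tendsto (fun t : ℝ => q + t • ((0, X) : CSpace n × CSpace n)) (𝓝 0) (𝓝 q) := by
      have : Continuous fun t : ℝ => q + t • ((0, X) : CSpace n × CSpace n) := by fun_prop
      simpa using this.tendsto 0
    have e6 := e4.unique ((hasDerivAt_const (0 : ℝ) (0 : ℝ)).congr_of_eventuallyEq
      ((e5.eventually h1).mono fun t ht => by
        simp only [Function.comp_apply, Prod.fst_add, Prod.snd_add, Prod.smul_mk, smul_zero,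
          add_zero] at ht ⊢
        exact ht))
    have e7 : ((0, X - fderiv ℝ ρ q (0, X) • e0) : CSpace n × CSpace n) =
        (0, X) - fderiv ℝ ρ q (0, X) • (0, e0) := by simp
    rw [e7, map_sub, map_smul, smul_eq_mul, sub_eq_zero] at e6
    exact e6
  have hne : ∀ᶠ q in 𝓝 (z₀, (0 : CSpace n)), fderiv ℝ G q (0, e0) ≠ 0 := by
    have h1 : ContinuousAt (fun q => fderiv ℝ G q (0, e0)) (z₀, 0) :=
      hG.fderiv.continuousAt.clm_apply continuousAt_const
    exact h1.eventually_ne hGe.ne'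
  have hD0 : ∀ᶠ p in 𝓝 z₀, ∀ X : CSpace n, fderiv ℝ ρ (p, 0) (0, X) = (X 0).re := by
    filter_upwards [hz.eventually hρd, hz.eventually hGd, hleaf0, h.delForm_ne] with p h1 h2 h3 h4 X
    have e1 := h1 (map_zero _) X
    rw [h2 (map_zero _), h2 (map_zero _), h3] at e1
    rw [mul_right_comm, inv_mul_cancel₀ h4, one_mul, mul_right_comm, inv_mul_cancel₀ h4] at e1
    simpa [he0] using e1.symm
  refine ⟨ρ, hρ, hsgn', ?_, ?_, hD0, ?_⟩
  · have h1 : Tendsto (fun x : (CSpace n × CSpace n) × ℝ => x.1) (𝓝 ((z₀, 0), 0)) (𝓝 (z₀, 0)) :=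
      continuous_fst.tendsto ((z₀, (0 : CSpace n)), (0 : ℝ))
    have h2 : Tendsto (fun x : (CSpace n × CSpace n) × ℝ => (x.1.1, x.1.2 + x.2 • e0))
        (𝓝 ((z₀, 0), 0)) (𝓝 (z₀, 0)) := by
      have : Continuous fun x : (CSpace n × CSpace n) × ℝ => (x.1.1, x.1.2 + x.2 • e0) := by
        fun_prop
      simpa using this.tendsto ((z₀, (0 : CSpace n)), (0 : ℝ))
    filter_upwards [htr, h1.eventually hρs, h2.eventually hρs] with x h3 h4 h5
    rw [h4, h5, h3]
  · filter_upwards [hρ0, hρd, hGd, hne] with q h1 h2 h3 h4 hq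
    refine ⟨h1 hq, fun X hX => ?_⟩
    have e1 := h2 hq X
    rw [h3 hq X, hX] at e1
    simpa [h4] using e1.symm
  · filter_upwards [(hz.eventually hGρ.eventually_nhds), h.normalMap_of_last_eq_zero, hD0,
      h.orthonormal, h.delForm_ne, hz.eventually hρ0] with p h1 h2 h3 h4 h5 h6 X hX
    have h1' : ∀ᶠ t : ℝ in 𝓝 0, r (normalMap l r v g Ψ (p, t • X - ρ (p, t • X) • e0)) = r p := by
      have e1 : Tendsto (fun t : ℝ => (p, t • X)) (𝓝 0) (𝓝 (p, 0)) := by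
        have : Continuous fun t : ℝ => (p, t • X) := by fun_prop
        simpa using this.tendsto 0
      filter_upwards [e1.eventually h1] with t ht using sub_eq_zero.1 ht
    exact hessian_mid hl h.smooth hρ h5 h4 h2 (h6 (map_zero _)) h3 hX h1'

end IsAdapted
end NormalForm

/-! ### The remainder in the normal form -/

section Remainder

theorem exists_lipschitz_fderiv {V : Type*} [NormedAddCommGroup V] [NormedSpace ℝ V] {f : V → ℝ}
    (hf : ContDiff ℝ ∞ f) (x : V) : ∃ K : ℝ, 0 ≤ K ∧ ∃ s ∈ 𝓝 x, ∀ y ∈ s, ∀ y' ∈ s, ∀ u,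
      |fderiv ℝ f y u - fderiv ℝ f y' u| ≤ K * ‖y - y'‖ * ‖u‖ := by
  have h1 : ContDiffAt ℝ 1 (fderiv ℝ f) x :=
    (hf.fderiv_right (m := 1) (by norm_cast)).contDiffAt
  obtain ⟨K, s, hs, hK⟩ := h1.exists_lipschitzOnWith
  refine ⟨K, K.2, s, hs, fun y hy y' hy' u => ?_⟩
  have h2 : ‖fderiv ℝ f y - fderiv ℝ f y'‖ ≤ K * ‖y - y'‖ :=
    (dist_eq_norm (fderiv ℝ f y) (fderiv ℝ f y')).symm.le.trans
      ((hK.dist_le_mul y hy y' hy').trans_eq (by rw [dist_eq_norm]))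
  have h3 := (fderiv ℝ f y - fderiv ℝ f y').le_of_opNorm_le h2 u
  rwa [sub_apply, Real.norm_eq_abs] at h3

theorem exists_lipschitz_hessian {V : Type*} [NormedAddCommGroup V] [NormedSpace ℝ V] {f : V → ℝ}
    (hf : ContDiff ℝ ∞ f) (x : V) : ∃ K : ℝ, 0 ≤ K ∧ ∃ s ∈ 𝓝 x, ∀ y ∈ s, ∀ y' ∈ s, ∀ u,
      |fderiv ℝ (fderiv ℝ f) y u u - fderiv ℝ (fderiv ℝ f) y' u u| ≤ K * ‖y - y'‖ * ‖u‖ ^ 2 := by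
  have h1 : ContDiffAt ℝ 1 (fderiv ℝ (fderiv ℝ f)) x :=
    ((hf.fderiv_right (m := ∞) (by simp)).fderiv_right (m := 1) (by norm_cast)).contDiffAt
  obtain ⟨K, s, hs, hK⟩ := h1.exists_lipschitzOnWith
  refine ⟨K, K.2, s, hs, fun y hy y' hy' u => ?_⟩
  have h2 : ‖fderiv ℝ (fderiv ℝ f) y - fderiv ℝ (fderiv ℝ f) y'‖ ≤ K * ‖y - y'‖ :=
    (dist_eq_norm (fderiv ℝ (fderiv ℝ f) y) (fderiv ℝ (fderiv ℝ f) y')).symm.le.trans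
      ((hK.dist_le_mul y hy y' hy').trans_eq (by rw [dist_eq_norm]))
  have h3 := (fderiv ℝ (fderiv ℝ f) y - fderiv ℝ (fderiv ℝ f) y').le_of_opNorm_le h2 u
  have h4 := ((fderiv ℝ (fderiv ℝ f) y - fderiv ℝ (fderiv ℝ f) y') u).le_of_opNorm_le h3 u
  rw [sub_apply, sub_apply, Real.norm_eq_abs] at h4
  calc _ ≤ _ := h4
    _ = _ := by ring

variable {n : ℕ}

theorem norm_le_of_forall_norm_le {X Y : CSpace n} (h : ∀ j, ‖X j‖ ≤ ‖Y j‖) : ‖X‖ ≤ ‖Y‖ := by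
  rw [EuclideanSpace.norm_eq, EuclideanSpace.norm_eq]
  refine Real.sqrt_le_sqrt (Finset.sum_le_sum fun j _ => ?_)
  have := h j
  gcongr

theorem norm_blockProj (s : Finset (Fin n)) (ζ : CSpace n) : ‖blockProj s ζ‖ = blockNorm s ζ := by
  rw [EuclideanSpace.norm_eq, blockNorm]
  congr 1
  rw [← Finset.sum_subset (Finset.subset_univ s)]
  · exact Finset.sum_congr rfl fun j hj => by rw [blockProj_apply, if_pos hj]
  · intro j _ hj
    rw [blockProj_apply, if_neg hj]; simp

theorem norm_blockProj_le (s : Finset (Fin n)) (ζ : CSpace n) : ‖blockProj s ζ‖ ≤ ‖ζ‖ := by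
  refine norm_le_of_forall_norm_le fun j => ?_
  rw [blockProj_apply]
  split_ifs <;> simp

variable [NeZero n] {l : ℕ} {z₀ : CSpace n}

theorem eq_add_blockProj (hl : l < n) (ζ : CSpace n) :
    ζ = ζ 0 • (EuclideanSpace.single 0 1 : CSpace n) + blockProj (midIdx n l) ζ
      + blockProj (lastIdx n l) ζ := by
  ext j
  simp only [PiLp.add_apply, PiLp.smul_apply, blockProj_apply, PiLp.single_apply, smul_eq_mul]
  rcases index_cases (l := l) j with h | h | h
  · subst h
    simp [zero_notMem_midIdx, zero_notMem_lastIdx hl]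
  · have h1 : j ≠ 0 := fun e => zero_notMem_midIdx (e ▸ h)
    simp [h, h1, notMem_lastIdx_of_mem_midIdx h]
  · have h1 : j ≠ 0 := fun e => zero_notMem_lastIdx hl (e ▸ h)
    have h2 : j ∉ midIdx n l := fun e => notMem_lastIdx_of_mem_midIdx e h
    simp [h, h1, h2]

set_option maxHeartbeats 1000000 in
/-- The expansion of the defining function in normal coordinates. -/
theorem exists_remainder_bound {ρ : CSpace n × CSpace n → ℝ} (hl : l < n) (hρ : ContDiff ℝ ∞ ρ)
    (ht : ∀ᶠ x in 𝓝 ((z₀, (0 : CSpace n)), (0 : ℝ)),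
        ρ (x.1.1, x.1.2 + x.2 • EuclideanSpace.single 0 1) = ρ x.1 + x.2)
    (hleaf : ∀ᶠ q in 𝓝 (z₀, (0 : CSpace n)), blockProj (lastIdx n l) q.2 = q.2 →
        ρ q = 0 ∧ ∀ X : CSpace n, X 0 = 0 → fderiv ℝ ρ q (0, X) = 0)
    (hd : ∀ᶠ p in 𝓝 z₀, ∀ X : CSpace n, fderiv ℝ ρ (p, 0) (0, X) = (X 0).re)
    (hh : ∀ᶠ p in 𝓝 z₀, ∀ X : CSpace n, blockProj (midIdx n l) X = X →
        fderiv ℝ (fderiv ℝ ρ) (p, 0) (0, X) (0, X) = 2 * ∑ j ∈ midIdx n l, ‖X j‖ ^ 2) :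
    ∃ A : ℝ, ∀ᶠ q in 𝓝 (z₀, (0 : CSpace n)),
      |ρ q - ((q.2 0).re + ∑ j ∈ midIdx n l, ‖q.2 j‖ ^ 2)| ≤
        A * (blockNorm (midIdx n l) q.2 ^ 2 * blockNorm (lastIdx n l) q.2
          + blockNorm (midIdx n l) q.2 ^ 3 + |(q.2 0).im| * ‖q.2‖) := by
  obtain ⟨K₁, hK₁, s₁, hs₁, h1⟩ := exists_lipschitz_fderiv hρ (z₀, 0)
  obtain ⟨K₂, hK₂, s₂, hs₂, h2⟩ := exists_lipschitz_hessian hρ (z₀, 0)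
  obtain ⟨ε, hε, hb⟩ := Metric.mem_nhds_iff.1 (inter_mem (inter_mem hs₁ hs₂) hleaf)
  obtain ⟨ε', hε', hb'⟩ := Metric.eventually_nhds_iff_ball.1 ht
  refine ⟨K₁ + K₂, ?_⟩
  have hmin : 0 < min ε ε' := lt_min hε hε'
  filter_upwards [Metric.ball_mem_nhds (z₀, (0 : CSpace n)) hmin,
    (tendsto_fst_nhds z₀).eventually hd, (tendsto_fst_nhds z₀).eventually hh] with q hq h3 h4
  obtain ⟨p, ζ⟩ := q
  rw [← ball_prod_same] at hq
  obtain ⟨hp, hζ⟩ := hq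
  simp only at hp hζ h3 h4 ⊢
  have hζn : ‖ζ‖ < min ε ε' := mem_ball_zero_iff.1 hζ
  have hmem : ∀ ξ : CSpace n, ‖ξ‖ ≤ ‖ζ‖ → (p, ξ) ∈ Metric.ball (z₀, (0 : CSpace n)) ε := by
    intro ξ hξ
    rw [← ball_prod_same]
    exact ⟨Metric.ball_subset_ball (min_le_left _ _) hp,
      mem_ball_zero_iff.2 (hξ.trans_lt (hζn.trans_le (min_le_left _ _)))⟩
  set e0 : CSpace n := EuclideanSpace.single 0 1 with he0
  set M := blockProj (midIdx n l) ζ with hM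
  set L := blockProj (lastIdx n l) ζ with hL
  set x := (ζ 0).re with hx
  set y := (ζ 0).im with hy
  have hM0 : M 0 = 0 := by rw [hM, blockProj_apply, if_neg zero_notMem_midIdx]
  have hL0 : L 0 = 0 := by rw [hL, blockProj_apply, if_neg (zero_notMem_lastIdx hl)]
  have hMj : ∀ j, j ≠ 0 → (M + L) j = ζ j := by
    intro j hj
    have e := congrArg (fun X : CSpace n => X j) (eq_add_blockProj hl ζ)
    simp only [PiLp.add_apply, PiLp.smul_apply, PiLp.single_apply, hj, if_false, smul_zero,
      zero_add] at e
    exact e.symm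
  have hdec : ζ = (M + L + y • (Complex.I • e0)) + x • e0 := by
    have e1 := eq_add_blockProj hl ζ
    have e2 : ζ 0 • e0 = x • e0 + y • (Complex.I • e0) := by
      conv_lhs => rw [← Complex.re_add_im (ζ 0)]
      rw [add_smul, mul_smul]; rfl
    rw [e2] at e1
    rw [e1]
    abel
  -- Translation in the direction `Re ζ₁`.
  have hxb : |x| ≤ ‖ζ‖ := (Complex.abs_re_le_norm _).trans (PiLp.norm_apply_le ζ 0)
  have hseg : ∀ s ∈ Set.Icc (0 : ℝ) 1, ‖M + L + s • (y • (Complex.I • e0))‖ ≤ ‖ζ‖ := by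
    intro s hs
    refine norm_le_of_forall_norm_le fun j => ?_
    by_cases hj : j = 0
    · subst hj
      have : (M + L + s • (y • (Complex.I • e0))) 0 = ((s * y : ℝ) : ℂ) * Complex.I := by
        simp [hM0, hL0, he0]; ring
      rw [this, norm_mul, Complex.norm_I, mul_one, Complex.norm_real, Real.norm_eq_abs, abs_mul,
        abs_of_nonneg hs.1]
      have := Complex.abs_im_le_norm (ζ 0)
      nlinarith [abs_nonneg y, hs.2]
    · have : (M + L + s • (y • (Complex.I • e0))) j = ζ j := by
        rw [← hMj j hj]; simp [he0, hj]
      rw [this]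
  have hstep1 : ρ (p, ζ) = ρ (p, M + L + y • (Complex.I • e0)) + x := by
    have e1 := hb' ((p, M + L + y • (Complex.I • e0)), x) (by
      rw [← ball_prod_same, ← ball_prod_same]
      have e2 := hseg 1 ⟨zero_le_one, le_rfl⟩
      rw [one_smul] at e2
      refine ⟨⟨Metric.ball_subset_ball (min_le_right _ _) hp, mem_ball_zero_iff.2
        (e2.trans_lt (hζn.trans_le (min_le_right _ _)))⟩, mem_ball_zero_iff.2 ?_⟩
      exact (Real.norm_eq_abs x).le.trans_lt (hxb.trans_lt (hζn.trans_le (min_le_right _ _))))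
    rw [← hdec] at e1
    exact e1
  -- The mean value theorem in the direction `Im ζ₁`.
  have hstep2 : |ρ (p, M + L + y • (Complex.I • e0)) - ρ (p, M + L)| ≤ K₁ * |y| * ‖ζ‖ := by
    have hline : ∀ s : ℝ, ((p, M + L) + s • (0, y • (Complex.I • e0)) : CSpace n × CSpace n) =
        (p, M + L + s • (y • (Complex.I • e0))) := fun s => by simp
    obtain ⟨c, hc, hcd⟩ := exists_hasDerivAt_eq_slope
      (fun s : ℝ => ρ ((p, M + L) + s • (0, y • (Complex.I • e0)))) _ zero_lt_one
      (Continuous.continuousOn (by have := hρ.continuous; fun_prop))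
      (fun s _ => hasDerivAt_comp_line hρ _ _ s)
    have e1 : fderiv ℝ ρ (p, 0) (0, y • (Complex.I • e0)) = 0 := by
      rw [h3]; simp [he0]
    have e2 := h1 _ (hb (hmem (M + L + c • (y • (Complex.I • e0)))
      (hseg c ⟨hc.1.le, hc.2.le⟩))).1.1 _ (hb (hmem 0 (by simp))).1.1 (0, y • (Complex.I • e0))
    rw [e1, sub_zero] at e2
    rw [hline, hline, hline] at hcd
    simp only [zero_smul, one_smul, add_zero, sub_zero, div_one] at hcd
    rw [hcd] at e2
    refine e2.trans ?_
    have e3 : ‖((p, M + L + c • (y • (Complex.I • e0))) - (p, 0) : CSpace n × CSpace n)‖ ≤ ‖ζ‖ := by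
      rw [Prod.mk_sub_mk, sub_self, sub_zero, Prod.norm_mk, norm_zero]
      exact max_le (norm_nonneg _) (hseg c ⟨hc.1.le, hc.2.le⟩)
    have e4 : ‖((0, y • (Complex.I • e0)) : CSpace n × CSpace n)‖ = |y| := by
      rw [Prod.norm_mk, norm_zero, norm_smul, norm_smul, Complex.norm_I, he0,
        PiLp.norm_single, norm_one, mul_one, mul_one, Real.norm_eq_abs,
        max_eq_right (abs_nonneg y)]
    rw [e4, mul_right_comm]
    gcongr
  -- Taylor's formula in the directions `ζ'`.
  have hLL : blockProj (lastIdx n l) L = L := blockProj_idem _ _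
  have hMM : blockProj (midIdx n l) M = M := blockProj_idem _ _
  have hLn : ‖L‖ ≤ ‖ζ‖ := norm_blockProj_le _ _
  have hMn : ∀ j ∈ midIdx n l, ‖M j‖ = ‖ζ j‖ := fun j hj => by rw [hM, blockProj_apply, if_pos hj]
  have hstep3 : |ρ (p, M + L) - ∑ j ∈ midIdx n l, ‖ζ j‖ ^ 2| ≤
      K₂ * (‖M‖ ^ 2 * ‖L‖ + ‖M‖ ^ 3) := by
    obtain ⟨θ, hθ, hT⟩ := exists_taylor_two (f := ρ) (x := (p, L)) (h := (0, M)) (fun s _ =>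
      hρ.contDiffAt.of_le (by norm_cast))
    obtain ⟨e1, e2⟩ := (hb (hmem L hLn)).2 hLL
    rw [e1, e2 M hM0, zero_add, zero_add, Prod.mk_add_mk, add_zero, add_comm L M] at hT
    have hθm : ‖L + θ • M‖ ≤ ‖ζ‖ := by
      refine norm_le_of_forall_norm_le fun j => ?_
      simp only [PiLp.add_apply, PiLp.smul_apply, hM, hL, blockProj_apply]
      by_cases hj : j ∈ midIdx n l
      · rw [if_neg (notMem_lastIdx_of_mem_midIdx hj), if_pos hj, zero_add, norm_smul,
          Real.norm_eq_abs, abs_of_nonneg hθ.1.le]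
        nlinarith [norm_nonneg (ζ j), hθ.2]
      · rw [if_neg hj, smul_zero, add_zero]
        split_ifs <;> simp
    have e3 := h2 _ (hb (hmem _ hθm)).1.2 _ (hb (hmem 0 (by simp))).1.2 (0, M)
    rw [h4 M hMM, Finset.sum_congr rfl fun j hj => by rw [hMn j hj]] at e3
    have e4 : ((p, L) + θ • (0, M) : CSpace n × CSpace n) = (p, L + θ • M) := by simp
    rw [e4] at hT
    have e5 : ‖((p, L + θ • M) - (p, 0) : CSpace n × CSpace n)‖ ≤ ‖L‖ + ‖M‖ := by
      rw [Prod.mk_sub_mk, sub_self, sub_zero, Prod.norm_mk, norm_zero]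
      refine max_le (by positivity) ((norm_add_le _ _).trans ?_)
      rw [norm_smul, Real.norm_eq_abs, abs_of_nonneg hθ.1.le]
      nlinarith [norm_nonneg M, hθ.2]
    have e6 : ‖((0, M) : CSpace n × CSpace n)‖ = ‖M‖ := by
      rw [Prod.norm_mk, norm_zero, max_eq_right (norm_nonneg M)]
    rw [e6] at e3
    rw [hT]
    have e7 : ∀ a b : ℝ, |a / 2 - b| = |a - 2 * b| / 2 := fun a b => by
      rw [show a / 2 - b = (a - 2 * b) / 2 by ring, abs_div, abs_two]
    rw [e7]
    have e8 : K₂ * ‖((p, L + θ • M) - (p, 0) : CSpace n × CSpace n)‖ * ‖M‖ ^ 2 ≤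
        K₂ * (‖L‖ + ‖M‖) * ‖M‖ ^ 2 := by gcongr
    have e9 := e3.trans e8
    have e10 : 0 ≤ K₂ * (‖L‖ + ‖M‖) * ‖M‖ ^ 2 := by positivity
    calc _ ≤ K₂ * (‖L‖ + ‖M‖) * ‖M‖ ^ 2 := by linarith
      _ = _ := by ring
  rw [← norm_blockProj, ← norm_blockProj, ← hM, ← hL, hstep1]
  have e1 : ρ (p, M + L + y • Complex.I • e0) + x - (x + ∑ j ∈ midIdx n l, ‖ζ j‖ ^ 2) =
      (ρ (p, M + L + y • (Complex.I • e0)) - ρ (p, M + L))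
        + (ρ (p, M + L) - ∑ j ∈ midIdx n l, ‖ζ j‖ ^ 2) := by ring
  rw [e1]
  refine (abs_add_le _ _).trans ((add_le_add hstep2 hstep3).trans ?_)
  have p1 : 0 ≤ K₁ * (‖M‖ ^ 2 * ‖L‖ + ‖M‖ ^ 3) := by positivity
  have p2 : 0 ≤ K₂ * (|y| * ‖ζ‖) := by positivity
  nlinarith

end Remainder

/-! ### The normal coordinates -/

section Inverse

variable {n : ℕ} {z₀ : CSpace n}

/-- The parametrized inverse function theorem. -/
theorem exists_parametrized_inverse {Θ : CSpace n × CSpace n → CSpace n}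
    (hΘ : SmoothNear Θ (z₀, 0)) (h0 : ∀ᶠ p in 𝓝 z₀, Θ (p, 0) = p) {T : CSpace n →L[ℂ] CSpace n}
    (hT : HasFDerivAt (fun ζ => Θ (z₀, ζ)) T 0) (hinj : ∀ X, T X = 0 → X = 0) :
    ∃ Φ : CSpace n × CSpace n → CSpace n, SmoothNear Φ (z₀, z₀) ∧
      (∀ᶠ p in 𝓝 z₀, Φ (p, p) = 0) ∧ (∀ᶠ x in 𝓝 (z₀, z₀), Θ (x.1, Φ x) = x.2) ∧
      ∀ᶠ q in 𝓝 (z₀, (0 : CSpace n)), Φ (q.1, Θ q) = q.2 := by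
  let F : (CSpace n × CSpace n) × CSpace n → CSpace n := fun x => Θ (x.1.1, x.2) - x.1.2
  have hsh : ContDiff ℝ ∞ fun x : (CSpace n × CSpace n) × CSpace n => (x.1.1, x.2) := by fun_prop
  have hF : SmoothNear F ((z₀, z₀), 0) := by
    have h1 : SmoothNear (fun x : (CSpace n × CSpace n) × CSpace n => Θ (x.1.1, x.2))
        ((z₀, z₀), 0) :=
      SmoothNear.comp (f := fun x : (CSpace n × CSpace n) × CSpace n => (x.1.1, x.2)) hΘ
        (hsh.smoothNear _)
    filter_upwards [h1] with x hx
    exact hx.sub (contDiff_snd.comp contDiff_fst).contDiffAt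
  have hpart : fderiv ℝ F ((z₀, z₀), 0) ∘L .inr ℝ (CSpace n × CSpace n) (CSpace n) =
      T.restrictScalars ℝ := by
    have h2 : HasFDerivAt (fun ζ : CSpace n => F ((z₀, z₀), ζ))
        (fderiv ℝ F ((z₀, z₀), 0) ∘L .inr ℝ (CSpace n × CSpace n) (CSpace n)) 0 :=
      (hF.contDiffAt.differentiableAt (by simp)).hasFDerivAt.comp (0 : CSpace n)
        (hasFDerivAt_prodMk_right (z₀, z₀) 0)
    exact h2.unique ((hT.restrictScalars ℝ).sub_const z₀)
  have hinv : (T.restrictScalars ℝ).IsInvertible := by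
    obtain ⟨e, he⟩ := isInvertible_of_forall_eq_zero hinj
    exact ⟨e.restrictScalars ℝ, by ext X : 1; rw [← he]; rfl⟩
  obtain ⟨Φ, hΦ, hΦ0, hΦF, huniq⟩ := exists_smooth_implicitFunction hF
    (by simp [F, h0.self_of_nhds]) (by rw [hpart]; exact hinv)
  refine ⟨Φ, hΦ, ?_, ?_, ?_⟩
  · have h1 : Tendsto (fun p : CSpace n => ((p, p), (0 : CSpace n))) (𝓝 z₀) (𝓝 ((z₀, z₀), 0)) :=
      (by fun_prop : Continuous fun p : CSpace n => ((p, p), (0 : CSpace n))).tendsto z₀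
    filter_upwards [h1.eventually huniq, h0] with p h2 h3
    exact h2 (sub_eq_zero.2 h3)
  · filter_upwards [hΦF] with x hx using sub_eq_zero.1 hx
  · have h1 : Tendsto (fun q : CSpace n × CSpace n => ((q.1, Θ q), q.2)) (𝓝 (z₀, 0))
        (𝓝 ((z₀, z₀), 0)) := by
      have h2 := hΘ.continuousAt.tendsto
      rw [h0.self_of_nhds] at h2
      exact ((continuous_fst.tendsto (z₀, (0 : CSpace n))).prodMk_nhds h2).prodMk_nhds
        (continuous_snd.tendsto (z₀, (0 : CSpace n)))
    filter_upwards [h1.eventually huniq] with q h2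
    exact h2 (sub_self _)

/-- A local inverse of a holomorphic map is holomorphic. -/
theorem differentiableAt_of_local_inverse {Θ Φ : CSpace n → CSpace n} {z : CSpace n}
    (hΘ : DifferentiableAt ℂ Θ (Φ z)) (hΦ : DifferentiableAt ℝ Φ z)
    (h1 : ∀ᶠ y in 𝓝 z, Θ (Φ y) = y) (h2 : ∀ᶠ ζ in 𝓝 (Φ z), Φ (Θ ζ) = ζ) :
    DifferentiableAt ℂ Φ z := by
  have hz : Θ (Φ z) = z := h1.self_of_nhds
  have hinj : ∀ X, fderiv ℂ Θ (Φ z) X = 0 → X = 0 := by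
    intro X hX
    have e1 : HasFDerivAt Φ (fderiv ℝ Φ z) (Θ (Φ z)) := by rw [hz]; exact hΦ.hasFDerivAt
    have e2 := e1.comp (Φ z) (hΘ.hasFDerivAt.restrictScalars ℝ)
    have e3 := e2.unique ((hasFDerivAt_id (Φ z)).congr_of_eventuallyEq h2)
    have e4 := congrArg (fun S : CSpace n →L[ℝ] CSpace n => S X) e3
    change fderiv ℝ Φ z (fderiv ℂ Θ (Φ z) X) = X at e4
    rw [← e4, hX, map_zero]
  obtain ⟨e, he⟩ := isInvertible_of_forall_eq_zero hinj
  have e1 : HasFDerivAt Θ (e : CSpace n →L[ℂ] CSpace n) (Φ z) := by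
    rw [he]; exact hΘ.hasFDerivAt
  exact (HasFDerivAt.of_local_left_inverse hΦ.continuousAt e1 h1).differentiableAt

end Inverse

section Family

variable {n : ℕ} [NeZero n] {l : ℕ} {Ω V : Set (CSpace n)} {z₀ : CSpace n}

theorem eventually_ball_of_nhds {X : Type*} [PseudoMetricSpace X] {x : X} {P : X → Prop}
    (h : ∀ᶠ y in 𝓝 x, P y) : ∀ᶠ ε in 𝓝[>] (0 : ℝ), ∀ y ∈ Metric.ball x ε, P y := by
  obtain ⟨ε, hε, hb⟩ := Metric.eventually_nhds_iff_ball.1 h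
  filter_upwards [Ioo_mem_nhdsGT hε] with s hs y hy
  exact hb y (Metric.ball_subset_ball hs.2.le hy)

/-- On all small balls, the inverse coordinates `Φ` and the function `ρ` form a normal family. -/
theorem isNormalFamily_ball {r : CSpace n → ℝ} {Θ Φ : CSpace n × CSpace n → CSpace n}
    {ρ : CSpace n × CSpace n → ℝ} {A : ℝ} (hV : IsOpen V) (hz₀ : z₀ ∈ V)
    (hdef : ∀ᶠ z in 𝓝 z₀, (r z < 0 ↔ z ∈ Ω) ∧ (r z = 0 ↔ z ∈ frontier Ω))
    (hΘ : SmoothNear Θ (z₀, 0))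
    (hhol : ∀ᶠ q in 𝓝 (z₀, (0 : CSpace n)), DifferentiableAt ℂ (fun ζ => Θ (q.1, ζ)) q.2)
    (hΦ : SmoothNear Φ (z₀, z₀)) (hΦ0 : ∀ᶠ p in 𝓝 z₀, Φ (p, p) = 0)
    (hΘΦ : ∀ᶠ x in 𝓝 (z₀, z₀), Θ (x.1, Φ x) = x.2)
    (hΦΘ : ∀ᶠ q in 𝓝 (z₀, (0 : CSpace n)), Φ (q.1, Θ q) = q.2)
    (hρ : ContDiff ℝ ∞ ρ)
    (hsgn : ∀ᶠ q in 𝓝 (z₀, (0 : CSpace n)), (ρ q < 0 ↔ r (Θ q) < r q.1) ∧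
        (ρ q = 0 ↔ r (Θ q) = r q.1))
    (ht : ∀ᶠ x in 𝓝 ((z₀, (0 : CSpace n)), (0 : ℝ)),
        ρ (x.1.1, x.1.2 + x.2 • EuclideanSpace.single 0 1) = ρ x.1 + x.2)
    (hA : ∀ᶠ q in 𝓝 (z₀, (0 : CSpace n)),
      |ρ q - ((q.2 0).re + ∑ j ∈ midIdx n l, ‖q.2 j‖ ^ 2)| ≤
        A * (blockNorm (midIdx n l) q.2 ^ 2 * blockNorm (lastIdx n l) q.2
          + blockNorm (midIdx n l) q.2 ^ 3 + |(q.2 0).im| * ‖q.2‖)) {η : ℝ} (hη : 0 < η) :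
    ∀ᶠ ε in 𝓝[>] (0 : ℝ), IsNormalFamily l Ω V z₀ (Metric.ball z₀ ε) (fun p z => Φ (p, z))
      (fun _ _ => 1) (fun p ζ => ρ (p, ζ)) ∧
      ∀ p ∈ frontier Ω ∩ Metric.ball z₀ ε, ∀ ζ ∈ (fun z => Φ (p, z)) '' (Ω ∩ Metric.ball z₀ ε),
        r p = 0 ∧ ‖ζ‖ < η ∧ ρ (p, ζ) < 0 := by
  have htr : ∀ᶠ q in 𝓝 (z₀, (0 : CSpace n)), fderiv ℝ (fun ζ => ρ (q.1, ζ)) q.2 ≠ 0 := by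
    have h1 : Tendsto (fun q : CSpace n × CSpace n => (q, (0 : ℝ))) (𝓝 (z₀, 0)) (𝓝 ((z₀, 0), 0)) :=
      (by fun_prop : Continuous fun q : CSpace n × CSpace n => (q, (0 : ℝ))).tendsto (z₀, 0)
    filter_upwards [h1.eventually ht.eventually_nhds] with q hq h0
    have h2 : Tendsto (fun t : ℝ => (q, t)) (𝓝 0) (𝓝 (q, 0)) :=
      (by fun_prop : Continuous fun t : ℝ => (q, t)).tendsto 0
    have h3 : HasDerivAt (fun t : ℝ => ρ (q.1, q.2 + t • EuclideanSpace.single 0 1))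
        (fderiv ℝ (fun ζ => ρ (q.1, ζ)) q.2 (EuclideanSpace.single 0 1)) 0 :=
      hasDerivAt_along ((hρ.comp (contDiff_prodMk_right q.1)).differentiable (by simp) q.2) _
    have h4 : HasDerivAt (fun t : ℝ => ρ q + t) 1 0 := (hasDerivAt_id (0 : ℝ)).const_add (ρ q)
    have h5 := h3.unique (h4.congr_of_eventuallyEq (h2.eventually hq))
    rw [h0] at h5
    simp at h5
  obtain ⟨s, hs, hgood⟩ := Metric.eventually_nhds_iff_ball.1
    ((hΘ.and hhol).and ((hΦΘ.and hsgn).and (htr.and hA)))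
  have hdiag : Tendsto (fun p : CSpace n => (p, p)) (𝓝 z₀) (𝓝 (z₀, z₀)) :=
    (by fun_prop : Continuous fun p : CSpace n => (p, p)).tendsto z₀
  have hm : 0 < min s (min η 1) := lt_min hs (lt_min hη one_pos)
  have hΦsmall : ∀ᶠ x in 𝓝 (z₀, z₀), ‖Φ x‖ < min s (min η 1) := by
    have h1 := hΦ.continuousAt.norm
    refine h1.eventually_lt_const ?_
    simp only [hΦ0.self_of_nhds, norm_zero, hm]
  obtain ⟨ε₀, hεV, hVb⟩ := Metric.isOpen_iff.1 hV z₀ hz₀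
  filter_upwards [eventually_ball_of_nhds (hdef.and hΦ0), eventually_ball_of_nhds
    ((hΦ.and hΘΦ.eventually_nhds).and hΦsmall), self_mem_nhdsWithin, Ioo_mem_nhdsGT hs,
    Ioo_mem_nhdsGT hεV] with ε h1 h2 hε hεs hεε
  set U := Metric.ball z₀ ε with hU
  have hpz : ∀ p ∈ U, ∀ z ∈ U, (p, z) ∈ Metric.ball (z₀, z₀) ε := fun p hp z hz => by
    rw [← ball_prod_same]; exact ⟨hp, hz⟩
  have hΦs : ∀ p ∈ U, ∀ z ∈ U, (p, Φ (p, z)) ∈ Metric.ball (z₀, (0 : CSpace n)) s := by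
    intro p hp z hz
    rw [← ball_prod_same]
    exact ⟨Metric.ball_subset_ball hεs.2.le hp, mem_ball_zero_iff.2
      ((h2 _ (hpz p hp z hz)).2.trans_le (min_le_left _ _))⟩
  have hinv : ∀ p ∈ U, ∀ z ∈ U, Θ (p, Φ (p, z)) = z := fun p hp z hz =>
    (h2 _ (hpz p hp z hz)).1.2.self_of_nhds
  have hsg : ∀ p ∈ frontier Ω ∩ U, ∀ z ∈ U, (ρ (p, Φ (p, z)) < 0 ↔ z ∈ Ω) ∧
      (ρ (p, Φ (p, z)) = 0 ↔ z ∈ frontier Ω) := by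
    intro p hp z hz
    have e1 := (hgood _ (hΦs p hp.2 z hz)).2.1.2
    have e2 : r p = 0 := (h1 p hp.2).1.2.2 hp.1
    have e3 := (h1 z hz).1
    rw [e1.1, e1.2, hinv p hp.2 z hz, ← e3.1, ← e3.2]
    simp only [e2, and_self]
  have hΦd : ∀ p ∈ U, ∀ z ∈ U, DifferentiableAt ℂ (fun z => Φ (p, z)) z := by
    intro p hp z hz
    have e1 := hgood _ (hΦs p hp z hz)
    have e2 := h2 _ (hpz p hp z hz)
    refine differentiableAt_of_local_inverse (Θ := fun ζ => Θ (p, ζ)) e1.1.2 ?_ ?_ ?_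
    · exact (e2.1.1.differentiableAt (by simp)).comp z
        (hasFDerivAt_prodMk_right p z).differentiableAt
    · have e3 : Tendsto (fun y : CSpace n => (p, y)) (𝓝 z) (𝓝 (p, z)) :=
        (by fun_prop : Continuous fun y : CSpace n => (p, y)).tendsto z
      exact e3.eventually e2.1.2
    · have e3 : Tendsto (fun y : CSpace n => (p, y)) (𝓝 (Φ (p, z))) (𝓝 (p, Φ (p, z))) :=
        (by fun_prop : Continuous fun y : CSpace n => (p, y)).tendsto _
      filter_upwards [e3.eventually (Metric.isOpen_ball.mem_nhds (hΦs p hp z hz))] with ζ hζ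
      exact (hgood _ hζ).2.1.1
  have hopen : ∀ p ∈ U, IsOpen ((fun z => Φ (p, z)) '' U) := by
    intro p hp
    rw [isOpen_iff_mem_nhds]
    rintro _ ⟨z, hz, rfl⟩
    have e3 : Tendsto (fun y : CSpace n => (p, y)) (𝓝 (Φ (p, z))) (𝓝 (p, Φ (p, z))) :=
      (by fun_prop : Continuous fun y : CSpace n => (p, y)).tendsto _
    have e4 : Tendsto (fun ζ => Θ (p, ζ)) (𝓝 (Φ (p, z))) (𝓝 z) := by
      have := ((hgood _ (hΦs p hp z hz)).1.1.continuousAt.tendsto).comp e3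
      rwa [hinv p hp z hz] at this
    filter_upwards [e3.eventually (Metric.isOpen_ball.mem_nhds (hΦs p hp z hz)),
      e4.eventually (Metric.isOpen_ball.mem_nhds hz)] with ζ hζ hζU
    exact ⟨Θ (p, ζ), hζU, (hgood _ hζ).2.1.1⟩
  refine ⟨?_, ?_⟩
  · refine
      { isOpen := Metric.isOpen_ball
        mem := Metric.mem_ball_self hε
        compact_closure := (isCompact_closedBall z₀ ε).of_isClosed_subset isClosed_closure
          Metric.closure_ball_subset_closedBall
        closure_subset := fun z hz => hVb (Metric.closedBall_subset_ball hεε.2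
          (Metric.closure_ball_subset_closedBall hz))
        biholo := fun p hp => ⟨fun z hz => (hΦd p hp.2 z hz).differentiableWithinAt, hopen p hp.2,
          fun ζ => Θ (p, ζ), ?_, fun z hz => hinv p hp.2 z hz⟩
        maps_ball := fun p hp z hz => mem_ball_zero_iff.2 ((h2 _ (hpz p hp.2 z hz)).2.trans_le
          ((min_le_right _ _).trans (min_le_right _ _)))
        center := fun p hp => (h1 p hp.2).2
        smooth := fun q hq => ((h2 q (hpz q.1 hq.1 q.2 hq.2)).1.1).contDiffWithinAt
        lam_pos := fun _ _ _ _ => one_pos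
        lam_smooth := fun _ _ => contDiffOn_const
        rho_smooth := fun p _ => (hρ.comp (contDiff_prodMk_right p)).contDiffOn
        rho_neg := fun p hp z hz => (hsg p hp z hz).1
        rho_zero := fun p hp z hz => (hsg p hp z hz).2
        rho_fderiv := fun p hp z hz => (hgood _ (hΦs p hp.2 z hz.2)).2.2.1
        rho_form := fun K hK _ => ⟨s, hs, A, fun p hp ζ _ hζ => ?_⟩ }
    · rintro _ ⟨z, hz, rfl⟩
      exact (hgood _ (hΦs p hp.2 z hz)).1.2.differentiableWithinAt
    · have e1 : (p, ζ) ∈ Metric.ball (z₀, (0 : CSpace n)) s := by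
        rw [← ball_prod_same]
        exact ⟨Metric.ball_subset_ball hεs.2.le (hK hp).2, mem_ball_zero_iff.2 hζ⟩
      have e2 := (hgood _ e1).2.2.2
      simpa only [one_mul] using e2
  · rintro p hp _ ⟨z, hz, rfl⟩
    refine ⟨(h1 p hp.2).1.2.2 hp.1, (h2 _ (hpz p hp.2 z hz.2)).2.trans_le
      ((min_le_right _ _).trans (min_le_left _ _)), (hsg p hp z hz.2).1.2 hz.1⟩

end Family

/-! ### The Levi form in normal coordinates -/

section LeviNormal

variable {n : ℕ}

theorem forms_eq_of_translate {f : CSpace n → ℝ} {z w : CSpace n} {t : ℝ}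
    (h : ∀ᶠ y in 𝓝 z, f (y + w) = f y + t) :
    delForm f (z + w) = delForm f z ∧ leviL f (z + w) = leviL f z := by
  have e2 : (fun y => fderiv ℝ f (y + w)) =ᶠ[𝓝 z] fderiv ℝ f := by
    filter_upwards [h.eventually_nhds] with y hy
    have h2 : fderiv ℝ (fun y => f (y + w)) y = fderiv ℝ (fun y => f y + t) y :=
      Filter.EventuallyEq.fderiv_eq hy
    rwa [fderiv_comp_add_right, fderiv_add_const] at h2
  have e3 : (fun y => delForm f (y + w)) =ᶠ[𝓝 z] delForm f := by
    filter_upwards [e2] with y hy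
    simp only [delForm, hy]
  have e4 : fderiv ℝ (delForm f) (z + w) = fderiv ℝ (delForm f) z := by
    have := e3.fderiv_eq (𝕜 := ℝ)
    rwa [fderiv_comp_add_right] at this
  refine ⟨e3.self_of_nhds, ?_⟩
  ext Y
  simp only [leviL, e4]

variable {ρ : CSpace n × CSpace n → ℝ}

theorem contDiff_partial {P W : Type*} [NormedAddCommGroup P] [NormedSpace ℝ P]
    [NormedAddCommGroup W] [NormedSpace ℝ W] {ρ : P × W → ℝ} (hρ : ContDiff ℝ ∞ ρ) (p : P) :
    ContDiff ℝ ∞ fun ζ => ρ (p, ζ) := hρ.comp (contDiff_prodMk_right p)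

theorem fderiv_partial {P W : Type*} [NormedAddCommGroup P] [NormedSpace ℝ P]
    [NormedAddCommGroup W] [NormedSpace ℝ W] {ρ : P × W → ℝ} (hρ : ContDiff ℝ ∞ ρ) (p : P)
    (ζ X : W) : fderiv ℝ (fun ζ => ρ (p, ζ)) ζ X = fderiv ℝ ρ (p, ζ) (0, X) := by
  have h1 : HasFDerivAt (fun ζ => ρ (p, ζ)) (fderiv ℝ ρ (p, ζ) ∘L .inr ℝ P W) ζ :=
    (hρ.differentiable (by simp) (p, ζ)).hasFDerivAt.comp ζ (hasFDerivAt_prodMk_right p ζ)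
  rw [h1.fderiv]; rfl

theorem fderiv_fderiv_partial {P W : Type*} [NormedAddCommGroup P] [NormedSpace ℝ P]
    [NormedAddCommGroup W] [NormedSpace ℝ W] {ρ : P × W → ℝ} (hρ : ContDiff ℝ ∞ ρ) (p : P)
    (ζ X Y : W) : fderiv ℝ (fderiv ℝ fun ζ => ρ (p, ζ)) ζ X Y =
      fderiv ℝ (fderiv ℝ ρ) (p, ζ) (0, X) (0, Y) := by
  have h1 := hasDerivAt_fderiv_line (contDiff_partial hρ p) ζ X Y
  have h2 := hasDerivAt_fderiv_line hρ (p, ζ) (0, X) (0, Y)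
  refine h1.unique (h2.congr_of_eventuallyEq (Eventually.of_forall fun t => ?_))
  change fderiv ℝ (fun ζ => ρ (p, ζ)) (ζ + t • X) Y = _
  rw [fderiv_partial hρ]
  simp

theorem norm_leviL_le {f : CSpace n → ℝ} {z : CSpace n} (hf : ContDiff ℝ ∞ f) {M : ℝ}
    (hM : ∀ X Y, |fderiv ℝ (fderiv ℝ f) z X Y| ≤ M * ‖X‖ * ‖Y‖) (X Y : CSpace n) :
    ‖leviL f z Y X‖ ≤ M * ‖Y‖ * ‖X‖ := by
  have hd : DifferentiableAt ℝ (fderiv ℝ f) z :=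
    (hf.fderiv_right (m := ∞) (by simp)).differentiable (by simp) z
  have hI : ∀ X : CSpace n, ‖Complex.I • X‖ = ‖X‖ := fun X => by simp [norm_smul]
  rw [leviL_apply hd, norm_div, Complex.norm_ofNat, div_le_iff₀ (by norm_num)]
  refine (norm_add_le _ _).trans ?_
  rw [norm_mul, Complex.norm_I, one_mul, Complex.norm_real, Complex.norm_real, Real.norm_eq_abs,
    Real.norm_eq_abs]
  have h1 := hM Y X
  have h2 := hM (Complex.I • Y) (Complex.I • X)
  have h3 := hM (Complex.I • Y) X
  have h4 := hM Y (Complex.I • X)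
  rw [hI] at h3 h4
  rw [hI, hI] at h2
  have h5 := abs_add_le (fderiv ℝ (fderiv ℝ f) z Y X)
    (fderiv ℝ (fderiv ℝ f) z (Complex.I • Y) (Complex.I • X))
  have h6 := abs_sub (fderiv ℝ (fderiv ℝ f) z (Complex.I • Y) X)
    (fderiv ℝ (fderiv ℝ f) z Y (Complex.I • X))
  linarith

theorem exists_bound_fderiv {V : Type*} [NormedAddCommGroup V] [NormedSpace ℝ V] {f : V → ℝ}
    (hf : ContDiff ℝ ∞ f) (x : V) : ∃ M : ℝ, 0 < M ∧ ∀ᶠ y in 𝓝 x, (∀ u, |fderiv ℝ f y u| ≤ M * ‖u‖) ∧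
      ∀ u w, |fderiv ℝ (fderiv ℝ f) y u w| ≤ M * ‖u‖ * ‖w‖ := by
  have h1 : ContDiff ℝ ∞ (fderiv ℝ f) := hf.fderiv_right (by simp)
  have h2 : ContDiff ℝ ∞ (fderiv ℝ (fderiv ℝ f)) := h1.fderiv_right (by simp)
  have e1 := eventually_norm_lt (W := V →L[ℝ] ℝ) (h1.continuous.continuousAt (x := x))
  have e2 := eventually_norm_lt (W := V →L[ℝ] V →L[ℝ] ℝ) (h2.continuous.continuousAt (x := x))
  refine ⟨‖fderiv ℝ f x‖ + 1 + (‖fderiv ℝ (fderiv ℝ f) x‖ + 1), by positivity, ?_⟩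
  filter_upwards [e1, e2] with y h3 h4
  constructor
  · intro u
    have := (fderiv ℝ f y).le_of_opNorm_le (c := ‖fderiv ℝ f x‖ + 1 + (‖fderiv ℝ (fderiv ℝ f) x‖ + 1))
      (h3.le.trans (le_add_of_nonneg_right (by positivity))) u
    exact this
  · intro u w
    have := (fderiv ℝ (fderiv ℝ f) y).le_of_opNorm_le
      (c := ‖fderiv ℝ f x‖ + 1 + (‖fderiv ℝ (fderiv ℝ f) x‖ + 1))
      (h4.le.trans (le_add_of_nonneg_left (by positivity))) u
    exact ((fderiv ℝ (fderiv ℝ f) y u).le_of_opNorm_le this w)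

theorem norm_delForm_le {f : CSpace n → ℝ} {z : CSpace n} {M : ℝ}
    (hM : ∀ X, |fderiv ℝ f z X| ≤ M * ‖X‖) (X : CSpace n) : ‖delForm f z X‖ ≤ M * ‖X‖ := by
  rw [delForm_apply, norm_div, Complex.norm_ofNat, div_le_iff₀ (by norm_num)]
  refine (norm_sub_le _ _).trans ?_
  rw [norm_mul, Complex.norm_I, one_mul, Complex.norm_real, Complex.norm_real, Real.norm_eq_abs,
    Real.norm_eq_abs]
  have h1 := hM X
  have h2 := hM (Complex.I • X)
  rw [norm_smul, Complex.norm_I, one_mul] at h2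
  linarith

/-- A Levi form that is nonnegative on the complex tangent space is bounded below by
`-C |∂f(Y)| |Y|`. -/
theorem levi_lower_bound {f : CSpace n → ℝ} {z e : CSpace n} (hf : ContDiff ℝ ∞ f) {M : ℝ}
    (hM0 : 0 ≤ M) (hM1 : ∀ X, |fderiv ℝ f z X| ≤ M * ‖X‖)
    (hM : ∀ X Y, |fderiv ℝ (fderiv ℝ f) z X Y| ≤ M * ‖X‖ * ‖Y‖) (he : ‖e‖ = 1)
    (hd : fderiv ℝ f z e = 1) (hpsd : ∀ X, delForm f z X = 0 → 0 ≤ (leviL f z X X).re)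
    (Y : CSpace n) :
    -(4 * M * (1 + M)) * ‖delForm f z Y‖ * ‖Y‖ ≤ (leviL f z Y Y).re := by
  have hne : 1 / 2 ≤ ‖delForm f z e‖ := by
    have h1 := Complex.abs_re_le_norm (delForm f z e)
    rwa [delForm_re, hd, abs_of_pos (by norm_num)] at h1
  have hne0 : delForm f z e ≠ 0 := fun h => by rw [h, norm_zero] at hne; linarith
  set c := delForm f z Y / delForm f z e with hc
  have hcn : ‖c‖ ≤ 2 * ‖delForm f z Y‖ := by
    rw [hc, norm_div, div_le_iff₀ (by linarith)]
    nlinarith [norm_nonneg (delForm f z Y)]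
  set T := Y - c • e with hT
  have hT0 : delForm f z T = 0 := by
    rw [hT, map_sub, map_smul, smul_eq_mul, hc]; field_simp; ring
  have hTn : ‖T‖ ≤ ‖Y‖ + ‖c‖ := by
    refine (norm_sub_le _ _).trans ?_
    rw [norm_smul, he, mul_one]
  have hY : Y = T + c • e := by rw [hT]; abel
  have h1 : leviL f z Y Y = leviL f z T T + (leviL f z (c • e) Y + leviL f z T (c • e)) := by
    conv_lhs => rw [hY, leviL_add, add_apply]
    rw [← hY]
    conv_lhs => rw [hY, map_add, ← hY]
    ring
  have h2 := norm_leviL_le hf hM Y (c • e)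
  have h3 := norm_leviL_le hf hM (c • e) T
  rw [norm_smul, he, mul_one] at h2 h3
  have h4 := Complex.abs_re_le_norm (leviL f z (c • e) Y + leviL f z T (c • e))
  have h5 := norm_add_le (leviL f z (c • e) Y) (leviL f z T (c • e))
  have h6 := hpsd T hT0
  have h7 := norm_delForm_le hM1 Y
  rw [h1, Complex.add_re]
  have h8 := neg_abs_le (leviL f z (c • e) Y + leviL f z T (c • e)).re
  set d := ‖delForm f z Y‖
  have hd0 : 0 ≤ d := norm_nonneg _
  have hY0 := norm_nonneg Y
  have hc0 := norm_nonneg c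
  have h9 : M * ‖c‖ * ‖Y‖ + M * ‖T‖ * ‖c‖ ≤ M * ‖c‖ * (2 * ‖Y‖ + ‖c‖) := by
    have : M * ‖T‖ * ‖c‖ ≤ M * (‖Y‖ + ‖c‖) * ‖c‖ := by gcongr
    linarith
  have h10 : M * ‖c‖ * (2 * ‖Y‖ + ‖c‖) ≤ M * (2 * d) * (2 * ‖Y‖ + 2 * (M * ‖Y‖)) := by
    gcongr
    linarith
  have h11 : M * (2 * d) * (2 * ‖Y‖ + 2 * (M * ‖Y‖)) = 4 * M * (1 + M) * d * ‖Y‖ := by ring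
  linarith

variable [NeZero n] {Ω : Set (CSpace n)} {z₀ : CSpace n}

/-- The Levi form of the defining function in normal coordinates is nonnegative on complex tangent
spaces, also at interior points, because the level sets are translates of the boundary. -/
theorem eventually_levi_nonneg {r : CSpace n → ℝ} {Θ : CSpace n × CSpace n → CSpace n}
    (hΩo : IsOpen Ω) (hΩp : IsPseudoconvex Ω)
    (hdef : ∀ᶠ z in 𝓝 z₀, (r z < 0 ↔ z ∈ Ω) ∧ (r z = 0 ↔ z ∈ frontier Ω))
    (hΘ : SmoothNear Θ (z₀, 0)) (hΘ0 : Θ (z₀, 0) = z₀)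
    (hhol : ∀ᶠ q in 𝓝 (z₀, (0 : CSpace n)), DifferentiableAt ℂ (fun ζ => Θ (q.1, ζ)) q.2)
    (hρ : ContDiff ℝ ∞ ρ) (hρ0 : ρ (z₀, 0) = 0)
    (hsgn : ∀ᶠ q in 𝓝 (z₀, (0 : CSpace n)), (ρ q < 0 ↔ r (Θ q) < r q.1) ∧
        (ρ q = 0 ↔ r (Θ q) = r q.1))
    (ht : ∀ᶠ x in 𝓝 ((z₀, (0 : CSpace n)), (0 : ℝ)),
        ρ (x.1.1, x.1.2 + x.2 • EuclideanSpace.single 0 1) = ρ x.1 + x.2) :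
    ∀ᶠ q in 𝓝 (z₀, (0 : CSpace n)),
      fderiv ℝ (fun ζ => ρ (q.1, ζ)) q.2 (EuclideanSpace.single 0 1) = 1 ∧
      (q.1 ∈ frontier Ω → ∀ X, delForm (fun ζ => ρ (q.1, ζ)) q.2 X = 0 →
        0 ≤ (leviL (fun ζ => ρ (q.1, ζ)) q.2 X X).re) := by
  set e0 : CSpace n := EuclideanSpace.single 0 1 with he0
  have h0 : Tendsto (fun q : CSpace n × CSpace n => (q, (0 : ℝ))) (𝓝 (z₀, 0)) (𝓝 ((z₀, 0), 0)) :=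
    (by fun_prop : Continuous fun q : CSpace n × CSpace n => (q, (0 : ℝ))).tendsto (z₀, 0)
  have h1 : Tendsto (fun q : CSpace n × CSpace n => (q, -ρ q)) (𝓝 (z₀, 0)) (𝓝 ((z₀, 0), 0)) := by
    have : Continuous fun q : CSpace n × CSpace n => (q, -ρ q) := by
      have := hρ.continuous; fun_prop
    simpa [hρ0] using this.tendsto (z₀, (0 : CSpace n))
  have h2 : Tendsto (fun q : CSpace n × CSpace n => (q.1, q.2 + (-ρ q) • e0)) (𝓝 (z₀, 0))
      (𝓝 (z₀, 0)) := by
    have : Continuous fun q : CSpace n × CSpace n => (q.1, q.2 + (-ρ q) • e0) := by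
      have := hρ.continuous; fun_prop
    simpa [hρ0] using this.tendsto (z₀, (0 : CSpace n))
  have hΘt : Tendsto Θ (𝓝 (z₀, 0)) (𝓝 z₀) := by
    have := hΘ.continuousAt.tendsto
    rwa [hΘ0] at this
  have hone : ∀ᶠ q in 𝓝 (z₀, (0 : CSpace n)), fderiv ℝ (fun ζ => ρ (q.1, ζ)) q.2 e0 = 1 := by
    filter_upwards [h0.eventually ht.eventually_nhds] with q hq
    have e2 : Tendsto (fun t : ℝ => (q, t)) (𝓝 0) (𝓝 (q, 0)) :=
      (by fun_prop : Continuous fun t : ℝ => (q, t)).tendsto 0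
    have e3 : HasDerivAt (fun t : ℝ => ρ (q.1, q.2 + t • e0))
        (fderiv ℝ (fun ζ => ρ (q.1, ζ)) q.2 e0) 0 :=
      hasDerivAt_along ((contDiff_partial hρ q.1).differentiable (by simp) q.2) _
    have e4 : HasDerivAt (fun t : ℝ => ρ q + t) 1 0 := (hasDerivAt_id (0 : ℝ)).const_add (ρ q)
    exact e3.unique (e4.congr_of_eventuallyEq (e2.eventually hq))
  filter_upwards [hone, h2.eventually hone, h1.eventually ht.eventually_nhds,
    h2.eventually (hhol.and (hsgn.and (hΘt.eventually hdef))).eventually_nhds,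
    (tendsto_fst_nhds z₀).eventually hdef] with q e1 e2 e3 e4 e5
  refine ⟨e1, fun hq X hX => ?_⟩
  obtain ⟨p, ζ⟩ := q
  simp only at e1 e2 e3 e4 e5 hq hX ⊢
  set t := -ρ (p, ζ) with htdef
  have hp0 : r p = 0 := e5.2.2 hq
  have etr : ∀ᶠ y in 𝓝 ζ, ρ (p, y + t • e0) = ρ (p, y) + t := by
    have : Tendsto (fun y : CSpace n => ((p, y), t)) (𝓝 ζ) (𝓝 ((p, ζ), t)) :=
      (by fun_prop : Continuous fun y : CSpace n => ((p, y), t)).tendsto ζ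
    exact this.eventually e3
  obtain ⟨f1, f2⟩ := forms_eq_of_translate (f := fun ζ => ρ (p, ζ)) etr
  have hz : ρ (p, ζ + t • e0) = 0 := by rw [etr.self_of_nhds, htdef]; ring
  have ey : Tendsto (fun y : CSpace n => (p, y)) (𝓝 (ζ + t • e0)) (𝓝 (p, ζ + t • e0)) :=
    (by fun_prop : Continuous fun y : CSpace n => (p, y)).tendsto _
  have e6 := ey.eventually e4
  have e7 := e4.self_of_nhds
  rw [← f2]
  rw [← f1] at hX
  refine levi_nonneg_of_pseudoconvex hΩo hΩp (Θ := fun ζ => Θ (p, ζ)) (e6.mono fun y hy => hy.1)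
    (contDiff_partial hρ p).contDiffAt (e6.mono fun y hy hneg => ?_) ?_ hz ?_ hX
  · rw [← hy.2.2.1, ← hp0]
    exact hy.2.1.1.1 hneg
  · rw [← e7.2.2.2, ← hp0]
    exact e7.2.1.2.1 hz
  · intro h
    rw [h] at e2
    simp at e2

end LeviNormal

/-! ### Levi forms of exponentials, and holomorphic linear changes of variables -/

section LeviExp

variable {n : ℕ}

/-- The Hessian, computed along a line. -/
theorem fderiv_fderiv_of_line {V : Type*} [NormedAddCommGroup V] [NormedSpace ℝ V] {h : V → ℝ}
    (hh : ContDiff ℝ ∞ h) {x u : V} {k' : ℝ → ℝ} {m : ℝ}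
    (h1 : ∀ t, HasDerivAt (fun s : ℝ => h (x + s • u)) (k' t) t) (h2 : HasDerivAt k' m 0) :
    fderiv ℝ (fderiv ℝ h) x u u = m := by
  refine (hasDerivAt_fderiv_line hh x u u).unique
    (h2.congr_of_eventuallyEq (Eventually.of_forall fun t => ?_))
  exact (hasDerivAt_comp_line hh x u t).unique (h1 t)

theorem norm_sq_add_smul (x u : CSpace n) : ∃ β : ℝ, ∀ t : ℝ,
    ‖x + t • u‖ ^ 2 = ‖x‖ ^ 2 + t * (2 * β) + t ^ 2 * ‖u‖ ^ 2 := by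
  refine ⟨(inner ℂ x u).re, fun t => ?_⟩
  have h1 := @norm_add_sq ℂ _ _ _ _ x ((t : ℂ) • u)
  rw [show t • u = (t : ℂ) • u from (Complex.coe_smul t u).symm, h1, inner_smul_right,
    norm_smul, Complex.norm_real, mul_pow, Real.norm_eq_abs, sq_abs]
  simp
  ring

theorem contDiff_norm_sq_complex : ContDiff ℝ ∞ fun x : CSpace n => ‖x‖ ^ 2 := by
  have h : (fun x : CSpace n => ‖x‖ ^ 2) = fun x => ∑ j, ((x j).re ^ 2 + (x j).im ^ 2) := by
    funext x
    rw [EuclideanSpace.norm_sq_eq]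
    refine Finset.sum_congr rfl fun j _ => ?_
    rw [← Complex.normSq_eq_norm_sq, Complex.normSq_apply]
    ring
  rw [h]
  refine ContDiff.sum fun j _ => ?_
  have h1 : ContDiff ℝ ∞ fun x : CSpace n => (x j).re :=
    (Complex.reCLM ∘L (EuclideanSpace.proj j : CSpace n →L[ℂ] ℂ).restrictScalars ℝ).contDiff
  have h2 : ContDiff ℝ ∞ fun x : CSpace n => (x j).im :=
    (Complex.imCLM ∘L (EuclideanSpace.proj j : CSpace n →L[ℂ] ℂ).restrictScalars ℝ).contDiff
  exact (h1.pow 2).add (h2.pow 2)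

theorem delForm_norm_sq (f : CSpace n → ℝ) (z X : CSpace n) :
    ‖delForm f z X‖ ^ 2 = (fderiv ℝ f z X ^ 2 + fderiv ℝ f z (Complex.I • X) ^ 2) / 4 := by
  rw [delForm_apply, ← Complex.normSq_eq_norm_sq, Complex.normSq_apply]
  simp
  ring

/-- The weight `(e^{c f} + K |z|²) / (K + 1)`, used with `c = 1 / δ`. The denominator makes it at most
`1` where `f ≤ 0` and `|z| ≤ 1`. -/
noncomputable def expWeight (c K : ℝ) (f : CSpace n → ℝ) (z : CSpace n) : ℝ :=
  (Real.exp (c * f z) + K * ‖z‖ ^ 2) / (K + 1)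

theorem contDiff_expWeight {f : CSpace n → ℝ} (hf : ContDiff ℝ ∞ f) (c K : ℝ) :
    ContDiff ℝ ∞ (expWeight c K f) :=
  ((contDiff_const.mul hf).exp.add (contDiff_const.mul contDiff_norm_sq_complex)).div_const _

theorem hessian_expWeight {f : CSpace n → ℝ} (hf : ContDiff ℝ ∞ f) (c K : ℝ) (z u : CSpace n) :
    fderiv ℝ (fderiv ℝ (expWeight c K f)) z u u =
      (Real.exp (c * f z) * (c * fderiv ℝ (fderiv ℝ f) z u u + (c * fderiv ℝ f z u) ^ 2)
        + 2 * K * ‖u‖ ^ 2) / (K + 1) := by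
  obtain ⟨β, hβ⟩ := norm_sq_add_smul z u
  have e1 : ∀ t, HasDerivAt (fun s : ℝ => Real.exp (c * f (z + s • u)))
      (Real.exp (c * f (z + t • u)) * (c * fderiv ℝ f (z + t • u) u)) t := fun t =>
    ((hasDerivAt_comp_line hf z u t).const_mul c).exp
  refine fderiv_fderiv_of_line (contDiff_expWeight hf c K)
    (k' := fun t => (Real.exp (c * f (z + t • u)) * (c * fderiv ℝ f (z + t • u) u)
      + K * (2 * β + 2 * t * ‖u‖ ^ 2)) / (K + 1)) (fun t => ?_) ?_
  · have e2 : HasDerivAt (fun s : ℝ => ‖z + s • u‖ ^ 2) (2 * β + 2 * t * ‖u‖ ^ 2) t := by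
      simp only [hβ]
      have := (((hasDerivAt_id' t).mul_const (2 * β)).const_add (‖z‖ ^ 2)).add
        (((hasDerivAt_id' t).pow 2).mul_const (‖u‖ ^ 2))
      exact this.congr_deriv (by simp)
    exact ((e1 t).add (e2.const_mul K)).div_const _
  · have e3 := (e1 0).mul ((hasDerivAt_fderiv_line hf z u u).const_mul c)
    have e4 : HasDerivAt (fun t : ℝ => 2 * β + 2 * t * ‖u‖ ^ 2) (2 * ‖u‖ ^ 2) 0 := by
      have := (((hasDerivAt_id' (0 : ℝ)).const_mul 2).mul_const (‖u‖ ^ 2)).const_add (2 * β)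
      exact this.congr_deriv (by simp)
    have e5 := (e3.add (e4.const_mul K)).div_const (K + 1)
    refine e5.congr_deriv ?_
    simp only [zero_smul, add_zero]
    ring

theorem levi_expWeight {f : CSpace n → ℝ} (hf : ContDiff ℝ ∞ f) (c K : ℝ) (z Y : CSpace n) :
    (leviL (expWeight c K f) z Y Y).re =
      (Real.exp (c * f z) * (c * (leviL f z Y Y).re + c ^ 2 * ‖delForm f z Y‖ ^ 2)
        + K * ‖Y‖ ^ 2) / (K + 1) := by
  have hd : ∀ {h : CSpace n → ℝ}, ContDiff ℝ ∞ h → DifferentiableAt ℝ (fderiv ℝ h) z :=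
    fun hh => (hh.fderiv_right (m := ∞) (by simp)).differentiable (by simp) z
  rw [leviL_self_re (hd (contDiff_expWeight hf c K)), leviL_self_re (hd hf),
    hessian_expWeight hf, hessian_expWeight hf, delForm_norm_sq, norm_smul, Complex.norm_I, one_mul]
  ring

/-- If the Levi form of `f` is nonnegative on complex tangent spaces, then the weight is
plurisubharmonic where `f < 0` as soon as `K` absorbs the square of the constant of
`levi_lower_bound`. -/
theorem levi_expWeight_nonneg {f : CSpace n → ℝ} (hf : ContDiff ℝ ∞ f) {c K C : ℝ} {z : CSpace n}
    (hc : 0 ≤ c) (hK : C ^ 2 / 4 ≤ K) (hz : f z ≤ 0) (Y : CSpace n)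
    (h : -C * ‖delForm f z Y‖ * ‖Y‖ ≤ (leviL f z Y Y).re) :
    0 ≤ (leviL (expWeight c K f) z Y Y).re := by
  rw [levi_expWeight hf]
  have hK0 : 0 ≤ K := le_trans (by positivity) hK
  refine div_nonneg ?_ (by linarith)
  set d := ‖delForm f z Y‖
  have h1 : Real.exp (c * f z) ≤ 1 := Real.exp_le_one_iff.2 (mul_nonpos_of_nonneg_of_nonpos hc hz)
  have h2 : -(K * ‖Y‖ ^ 2) ≤ c * (leviL f z Y Y).re + c ^ 2 * d ^ 2 := by
    have h3 := mul_le_mul_of_nonneg_left h hc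
    nlinarith [sq_nonneg (c * d - C / 2 * ‖Y‖), sq_nonneg ‖Y‖]
  have h4 := mul_le_mul_of_nonneg_left h2 (Real.exp_pos (c * f z)).le
  have h5 : Real.exp (c * f z) * (K * ‖Y‖ ^ 2) ≤ 1 * (K * ‖Y‖ ^ 2) := by gcongr
  linarith

theorem abs_expWeight_le_one {f : CSpace n → ℝ} {c K : ℝ} {z : CSpace n} (hc : 0 ≤ c) (hK : 0 ≤ K)
    (hz : f z ≤ 0) (hz1 : ‖z‖ ≤ 1) : |expWeight c K f z| ≤ 1 := by
  have h1 : Real.exp (c * f z) ≤ 1 := Real.exp_le_one_iff.2 (mul_nonpos_of_nonneg_of_nonpos hc hz)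
  have h2 : ‖z‖ ^ 2 ≤ 1 := pow_le_one₀ (norm_nonneg z) hz1
  have h3 : 0 ≤ expWeight c K f z := by unfold expWeight; positivity
  rw [abs_of_nonneg h3, expWeight, div_le_one (by linarith)]
  nlinarith

theorem delForm_comp_linear {f : CSpace n → ℝ} (hf : ContDiff ℝ ∞ f) (A : CSpace n →L[ℂ] CSpace n)
    (z X : CSpace n) : delForm (fun w => f (A w)) z X = delForm f (A z) (A X) := by
  have h : fderiv ℝ (fun w => f (A w)) z = fderiv ℝ f (A z) ∘L A.restrictScalars ℝ :=
    ((hf.differentiable (by simp) (A z)).hasFDerivAt.comp z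
      (A.restrictScalars ℝ).hasFDerivAt).fderiv
  rw [delForm_apply, delForm_apply, h]
  simp

theorem levi_comp_linear {f : CSpace n → ℝ} (hf : ContDiff ℝ ∞ f) (A : CSpace n →L[ℂ] CSpace n)
    (z X : CSpace n) :
    (leviL (fun w => f (A w)) z X X).re = (leviL f (A z) (A X) (A X)).re := by
  have hfA : ContDiff ℝ ∞ fun w => f (A w) := hf.comp (A.restrictScalars ℝ).contDiff
  have hd : ∀ {h : CSpace n → ℝ} {z}, ContDiff ℝ ∞ h → DifferentiableAt ℝ (fderiv ℝ h) z :=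
    fun hh => (hh.fderiv_right (m := ∞) (by simp)).differentiable (by simp) _
  have key : ∀ u, fderiv ℝ (fderiv ℝ fun w => f (A w)) z u u =
      fderiv ℝ (fderiv ℝ f) (A z) (A u) (A u) := fun u => by
    have e : ∀ s : ℝ, A (z + s • u) = A z + s • A u := fun s => by
      rw [map_add]
      exact congrArg _ ((A.restrictScalars ℝ).map_smul s u)
    refine fderiv_fderiv_of_line hfA (k' := fun t => fderiv ℝ f (A z + t • A u) (A u)) (fun t => ?_)
      (hasDerivAt_fderiv_line hf (A z) (A u) (A u))
    simp only [e]
    exact hasDerivAt_comp_line hf (A z) (A u) t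
  rw [leviL_self_re (hd hfA), leviL_self_re (hd hf), key, key, map_smul]

end LeviExp

/-! ### Mixed derivatives under anisotropic dilations -/

section MixedDeriv

variable {n : ℕ}

/-- An induction principle for `mixedDeriv β γ`: a predicate of operators with weights in a
commutative monoid which is compatible with composition and holds for `dz j` and `dzbar j` with
weight `s j` holds for `mixedDeriv β γ` with the weight `∏ j, s j ^ (β j + γ j)`. -/
theorem mixedDeriv_induction {M : Type*} [CommMonoid M]
    {P : ((CSpace n → ℂ) → CSpace n → ℂ) → M → Prop} {s : Fin n → M} (hid : P id 1)
    (hcomp : ∀ {A B a b}, P A a → P B b → P (A ∘ B) (a * b)) (hz : ∀ j, P (dz j) (s j))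
    (hzb : ∀ j, P (dzbar j) (s j)) (β γ : Fin n → ℕ) :
    P (mixedDeriv β γ) (∏ j, s j ^ (β j + γ j)) := by
  have hit : ∀ {A a}, P A a → ∀ k : ℕ, P A^[k] (a ^ k) := fun {A a} h k => by
    induction k with
    | zero => simpa using hid
    | succ k ih => rw [Function.iterate_succ, pow_succ]; exact hcomp ih h
  have hlist : ∀ (m : ℕ) (F : Fin m → ((CSpace n → ℂ) → CSpace n → ℂ)) (w : Fin m → M),
      (∀ j, P (F j) (w j)) →
        P (fun f => (List.ofFn F).foldr (fun D h => D h) f) (∏ j, w j) := fun m => by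
    induction m with
    | zero => intro F w _; rw [Fin.prod_univ_zero]; exact hid
    | succ m ih =>
      intro F w h
      rw [Fin.prod_univ_succ]
      simp only [List.ofFn_succ, List.foldr_cons]
      exact hcomp (h 0) (ih (fun j => F j.succ) (fun j => w j.succ) fun j => h _)
  refine hlist n _ _ fun j => ?_
  rw [pow_add]
  exact hcomp (hit (hz j) _) (hit (hzb j) _)

theorem mixedDeriv_eqOn {O : Set (CSpace n)} (hO : IsOpen O) {f h : CSpace n → ℂ}
    (hfh : Set.EqOn f h O) (β γ : Fin n → ℕ) :
    Set.EqOn (mixedDeriv β γ f) (mixedDeriv β γ h) O := by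
  have key : ∀ {f h : CSpace n → ℂ}, Set.EqOn f h O → ∀ z ∈ O, fderiv ℝ f z = fderiv ℝ h z :=
    fun hfh z hz => Filter.EventuallyEq.fderiv_eq (hfh.eventuallyEq_of_mem (hO.mem_nhds hz))
  refine mixedDeriv_induction (M := ℕ) (s := 1)
    (P := fun A _ => ∀ {f h : CSpace n → ℂ}, Set.EqOn f h O → Set.EqOn (A f) (A h) O) (fun h => h)
    (fun hA hB _ _ h => hA (hB h)) (fun j f h hfh z hz => ?_) (fun j f h hfh z hz => ?_) β γ hfh
  · simp only [dz, key hfh z hz]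
  · simp only [dzbar, key hfh z hz]

theorem exists_contDiff_mixedDeriv {Q : Type*} [NormedAddCommGroup Q] [NormedSpace ℝ Q]
    {F : Q × CSpace n → ℂ} (hF : ContDiff ℝ ∞ F) (β γ : Fin n → ℕ) :
    ∃ F₁ : Q × CSpace n → ℂ, ContDiff ℝ ∞ F₁ ∧
      ∀ q, mixedDeriv β γ (fun z => F (q, z)) = fun z => F₁ (q, z) := by
  have hpart : ∀ {F : Q × CSpace n → ℂ}, ContDiff ℝ ∞ F → ∀ q z X,
      fderiv ℝ (fun z => F (q, z)) z X = fderiv ℝ F (q, z) (0, X) := fun hF q z X => by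
    have h1 := ((hF.differentiable (by simp) (q, z)).hasFDerivAt.comp z
      (hasFDerivAt_prodMk_right q z)).fderiv
    exact congrArg (fun L => L X) h1
  have hsm : ∀ {F : Q × CSpace n → ℂ}, ContDiff ℝ ∞ F → ∀ X,
      ContDiff ℝ ∞ fun x => fderiv ℝ F x ((0 : Q), X) := fun hF X =>
    (ContinuousLinearMap.apply ℝ ℂ ((0 : Q), X)).contDiff.comp
      (hF.fderiv_right (m := ∞) (by simp))
  refine mixedDeriv_induction (M := ℕ) (s := 1)
    (P := fun A _ => ∀ {F : Q × CSpace n → ℂ}, ContDiff ℝ ∞ F → ∃ F₁ : Q × CSpace n → ℂ,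
      ContDiff ℝ ∞ F₁ ∧ ∀ q, A (fun z => F (q, z)) = fun z => F₁ (q, z))
    (fun {F} hF => ⟨F, hF, fun q => rfl⟩) (fun hA hB F hF => ?_) (fun j F hF => ?_)
    (fun j F hF => ?_) β γ hF
  · obtain ⟨F₁, h1, h2⟩ := hB hF
    obtain ⟨F₂, h3, h4⟩ := hA h1
    exact ⟨F₂, h3, fun q => by rw [Function.comp_apply, h2, h4]⟩
  · refine ⟨fun x => (fderiv ℝ F x (0, EuclideanSpace.single j 1)
      - Complex.I * fderiv ℝ F x (0, EuclideanSpace.single j Complex.I)) / 2,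
      ((hsm hF _).sub (contDiff_const.mul (hsm hF _))).div_const 2, fun q => ?_⟩
    funext z
    simp only [dz, hpart hF]
  · refine ⟨fun x => (fderiv ℝ F x (0, EuclideanSpace.single j 1)
      + Complex.I * fderiv ℝ F x (0, EuclideanSpace.single j Complex.I)) / 2,
      ((hsm hF _).add (contDiff_const.mul (hsm hF _))).div_const 2, fun q => ?_⟩
    funext z
    simp only [dzbar, hpart hF]

/-- The dilation `ζ_j ↦ s_j ζ_j`. -/
noncomputable def dilation (s : Fin n → ℝ) : CSpace n →L[ℂ] CSpace n :=
  ∑ j, (s j : ℂ) • blockProj {j}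

@[simp] theorem dilation_apply (s : Fin n → ℝ) (z : CSpace n) (j : Fin n) :
    dilation s z j = s j * z j := by
  simp [dilation, sum_apply, blockProj_apply]

theorem mixedDeriv_dilation {s : Fin n → ℝ} (hs : ∀ j, s j ≠ 0) (f : CSpace n → ℂ)
    (β γ : Fin n → ℕ) (z : CSpace n) :
    mixedDeriv β γ (fun w => f (dilation s w)) z =
      (∏ j, s j ^ (β j + γ j) : ℝ) * mixedDeriv β γ f (dilation s z) := by
  let e : CSpace n ≃L[ℝ] CSpace n := ContinuousLinearEquiv.equivOfInverse
    ((dilation s).restrictScalars ℝ) ((dilation fun j => (s j)⁻¹).restrictScalars ℝ)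
    (fun z => by ext j; simp [hs j]) (fun z => by ext j; simp [hs j])
  have he : ∀ z, e z = dilation s z := fun z => rfl
  have hsingle : ∀ (j : Fin n) (c : ℂ), dilation s (EuclideanSpace.single j c) =
      s j • EuclideanSpace.single j c := fun j c => by
    ext k
    by_cases h : k = j
    · subst h; simp
    · simp [h]
  have key : ∀ (f : CSpace n → ℂ) (a : ℂ) z X,
      fderiv ℝ (fun w => a * f (dilation s w)) z X = a * fderiv ℝ f (dilation s z) (dilation s X) :=
    fun f a z X => by
      have h1 : (fun w => a * f (dilation s w)) = a • (f ∘ e) := rfl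
      have h2 : fderiv ℝ (f ∘ e) z = fderiv ℝ f (e z) ∘L (e : CSpace n →L[ℝ] CSpace n) :=
        e.comp_right_fderiv
      rw [h1, fderiv_const_smul_field]
      change a * fderiv ℝ (f ∘ e) z X = _
      rw [h2]
      rfl
  have hmain := mixedDeriv_induction (M := ℝ) (s := s)
    (P := fun A c => ∀ (f : CSpace n → ℂ) (a : ℂ),
      A (fun w => a * f (dilation s w)) = fun w => (a * c) * A f (dilation s w))
    (fun f a => by simp) (fun {A B a b} hA hB f c => ?_) (fun j f a => ?_) (fun j f a => ?_) β γ f 1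
  · simpa using congrFun hmain z
  · rw [Function.comp_apply, hB, hA]
    funext w
    simp only [Function.comp_apply]
    push_cast
    ring
  · funext w
    simp only [dz, key, hsingle, map_smul, Complex.real_smul]
    ring
  · funext w
    simp only [dzbar, key, hsingle, map_smul, Complex.real_smul]
    ring

end MixedDeriv

/-! ### The dilated defining function -/

section Scaling

variable {n : ℕ}

theorem delForm_congr {f h : CSpace n → ℝ} {z : CSpace n} (hfh : f =ᶠ[𝓝 z] h) :
    delForm f z = delForm h z := by
  rw [delForm, delForm, Filter.EventuallyEq.fderiv_eq hfh]

theorem leviL_congr {f h : CSpace n → ℝ} {z : CSpace n} (hfh : f =ᶠ[𝓝 z] h) :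
    leviL f z = leviL h z := by
  have e : delForm f =ᶠ[𝓝 z] delForm h := by
    filter_upwards [hfh.eventuallyEq_nhds] with y hy using delForm_congr hy
  have e2 : fderiv ℝ (delForm f) z = fderiv ℝ (delForm h) z := Filter.EventuallyEq.fderiv_eq e
  ext Y
  simp only [leviL, e2]

theorem delForm_const_mul {f : CSpace n → ℝ} (hf : ContDiff ℝ ∞ f) (c : ℝ) (z X : CSpace n) :
    delForm (fun w => c * f w) z X = c * delForm f z X := by
  have h : fderiv ℝ (fun w => c * f w) z = c • fderiv ℝ f z :=
    fderiv_const_mul (hf.differentiable (by simp) z) c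
  rw [delForm_apply, delForm_apply, h]
  simp
  ring

/-- Taylor's formula of second order with integral remainder. -/
theorem taylor_integral {φ φ' φ'' : ℝ → ℝ} (h1 : ∀ t, HasDerivAt φ (φ' t) t)
    (h2 : ∀ t, HasDerivAt φ' (φ'' t) t) (hc : Continuous φ'') (τ : ℝ) :
    φ τ = φ 0 + τ * φ' 0 + τ ^ 2 * ∫ t in (0 : ℝ)..1, (1 - t) * φ'' (t * τ) := by
  have hm : ∀ t : ℝ, HasDerivAt (fun t => t * τ) τ t := fun t => by
    simpa using (hasDerivAt_id' t).mul_const τ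
  have e1 : ∀ t, HasDerivAt (fun t => φ (t * τ)) (φ' (t * τ) * τ) t := fun t =>
    (h1 (t * τ)).comp t (hm t)
  have e2 : ∀ t, HasDerivAt (fun t => φ' (t * τ)) (φ'' (t * τ) * τ) t := fun t =>
    (h2 (t * τ)).comp t (hm t)
  have e3 : ∀ t : ℝ, HasDerivAt (fun t => φ (t * τ) + (1 - t) * (τ * φ' (t * τ)))
      (τ ^ 2 * ((1 - t) * φ'' (t * τ))) t := fun t => by
    refine ((e1 t).add (((hasDerivAt_id' t).const_sub 1).mul ((e2 t).const_mul τ))).congr_deriv ?_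
    ring
  have e4 : Continuous fun t : ℝ => τ ^ 2 * ((1 - t) * φ'' (t * τ)) := by fun_prop
  have e5 := intervalIntegral.integral_eq_sub_of_hasDerivAt (a := 0) (b := 1)
    (fun t _ => e3 t) (e4.intervalIntegrable 0 1)
  rw [intervalIntegral.integral_const_mul] at e5
  rw [e5]
  simp

variable [NeZero n] {l : ℕ}

/-- The weights `(τ², τ, …, τ, 1, …, 1)` of the dilation which carries `P_{1, a}` onto
`P_{τ², a}`. -/
def dilationWeight (n l : ℕ) [NeZero n] (τ : ℝ) (j : Fin n) : ℝ :=
  if j = 0 then τ ^ 2 else if j ∈ midIdx n l then τ else 1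

theorem dilationWeight_ne_zero {τ : ℝ} (hτ : τ ≠ 0) (j : Fin n) : dilationWeight n l τ j ≠ 0 := by
  unfold dilationWeight
  split_ifs <;> simp [hτ]

theorem dilationWeight_mid (τ : ℝ) {j : Fin n} (hj : j ∈ midIdx n l) :
    dilationWeight n l τ j = τ := by
  have : j ≠ 0 := fun h => zero_notMem_midIdx (h ▸ hj)
  simp [dilationWeight, this, hj]

theorem dilationWeight_last (hl : l < n) (τ : ℝ) {j : Fin n} (hj : j ∈ lastIdx n l) :
    dilationWeight n l τ j = 1 := by
  have : j ≠ 0 := fun h => zero_notMem_lastIdx hl (h ▸ hj)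
  have h2 : j ∉ midIdx n l := fun h => notMem_lastIdx_of_mem_midIdx h hj
  simp [dilationWeight, this, h2]

theorem dilation_eq (hl : l < n) (τ : ℝ) (w : CSpace n) : dilation (dilationWeight n l τ) w =
    τ ^ 2 • w 0 • EuclideanSpace.single 0 1 + τ • blockProj (midIdx n l) w
      + blockProj (lastIdx n l) w := by
  ext j
  simp only [dilation_apply, PiLp.add_apply, PiLp.smul_apply, blockProj_apply,
    PiLp.single_apply, smul_eq_mul, Complex.real_smul]
  rcases index_cases (l := l) j with rfl | h | h
  · simp [dilationWeight, zero_notMem_midIdx, zero_notMem_lastIdx hl]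
  · have h0 : j ≠ 0 := fun h0 => zero_notMem_midIdx (h0 ▸ h)
    simp [dilationWeight_mid τ h, h, h0, notMem_lastIdx_of_mem_midIdx h]
  · have h0 : j ≠ 0 := fun h0 => zero_notMem_lastIdx hl (h0 ▸ h)
    have h2 : j ∉ midIdx n l := fun h2 => notMem_lastIdx_of_mem_midIdx h2 h
    simp [dilationWeight_last hl τ h, h, h0, h2]

theorem contDiff_dilation (hl : l < n) :
    ContDiff ℝ ∞ fun x : ℝ × CSpace n => dilation (dilationWeight n l x.1) x.2 := by
  have h : (fun x : ℝ × CSpace n => dilation (dilationWeight n l x.1) x.2) = fun x =>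
      x.1 ^ 2 • blockProj {0} x.2 + x.1 • blockProj (midIdx n l) x.2
        + blockProj (lastIdx n l) x.2 := by
    funext x
    rw [dilation_eq hl, blockProj_eq {0}, Finset.sum_singleton]
  have hb : ∀ s : Finset (Fin n), ContDiff ℝ ∞ fun x : ℝ × CSpace n => blockProj s x.2 := fun s =>
    ((blockProj s).restrictScalars ℝ).contDiff.comp contDiff_snd
  rw [h]
  exact (((contDiff_fst.pow 2).smul (hb _)).add (contDiff_fst.smul (hb _))).add (hb _)

/-- Taylor's formula in one of the variables, with a remainder that is smooth in all of them. -/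
theorem exists_taylor_param {P W : Type} [NormedAddCommGroup P] [NormedSpace ℝ P]
    [NormedAddCommGroup W] [NormedSpace ℝ W] {k : (P × ℝ) × W → ℝ} (hk : ContDiff ℝ ∞ k) :
    ∃ R : (P × ℝ) × W → ℝ, ContDiff ℝ ∞ R ∧ ∀ p w τ, k ((p, τ), w) =
      k ((p, 0), w) + τ * fderiv ℝ k ((p, 0), w) ((0, 1), 0) + τ ^ 2 * R ((p, τ), w) := by
  obtain ⟨u, hu⟩ : ∃ u : (P × ℝ) × W, u = ((0, 1), 0) := ⟨_, rfl⟩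
  obtain ⟨kd, hkd⟩ : ∃ kd : (P × ℝ) × W → ℝ, kd = fun x => fderiv ℝ k x u := ⟨_, rfl⟩
  obtain ⟨kdd, hkdd⟩ : ∃ kdd : (P × ℝ) × W → ℝ, kdd = fun x => fderiv ℝ kd x u := ⟨_, rfl⟩
  have s1 : ContDiff ℝ ∞ kd := hkd ▸
    (ContinuousLinearMap.apply ℝ ℝ u).contDiff.comp (hk.fderiv_right (m := ∞) (by simp))
  have s2 : ContDiff ℝ ∞ kdd := hkdd ▸
    (ContinuousLinearMap.apply ℝ ℝ u).contDiff.comp (s1.fderiv_right (m := ∞) (by simp))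
  have e : ContDiff ℝ ∞ fun y : ((P × ℝ) × W) × ℝ => ((y.1.1.1, y.2 * y.1.1.2), y.1.2) := by
    fun_prop
  have s3 : ContDiff ℝ ∞ fun y : ((P × ℝ) × W) × ℝ =>
      (1 - y.2) * kdd ((y.1.1.1, y.2 * y.1.1.2), y.1.2) :=
    (contDiff_const.sub contDiff_snd).mul (s2.comp e)
  refine ⟨fun x => ∫ t in (0 : ℝ)..1, (1 - t) * kdd ((x.1.1, t * x.1.2), x.2),
    contDiff_integral_param s3, fun p w τ => ?_⟩
  have hline : ∀ t : ℝ, ((p, t), w) = ((p, (0 : ℝ)), w) + t • u := fun t => by simp [hu]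
  have d1 : ∀ t : ℝ, HasDerivAt (fun t => k ((p, t), w)) (kd ((p, t), w)) t := fun t => by
    have := hasDerivAt_comp_line hk ((p, (0 : ℝ)), w) u t
    simpa only [← hline, hkd] using this
  have d2 : ∀ t : ℝ, HasDerivAt (fun t => kd ((p, t), w)) (kdd ((p, t), w)) t := fun t => by
    have := hasDerivAt_comp_line s1 ((p, (0 : ℝ)), w) u t
    simpa only [← hline, hkdd] using this
  have d3 : Continuous fun t : ℝ => kdd ((p, t), w) := by
    have e : Continuous fun t : ℝ => ((p, t), w) := by fun_prop
    exact s2.continuous.comp e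
  have key := taylor_integral d1 d2 d3 τ
  rw [← hu, key, hkd]

theorem contDiff_comp_pair {P W W' F : Type*} [NormedAddCommGroup P] [NormedSpace ℝ P]
    [NormedAddCommGroup W] [NormedSpace ℝ W] [NormedAddCommGroup W'] [NormedSpace ℝ W']
    [NormedAddCommGroup F] [NormedSpace ℝ F] {f : P × W' → F} (hf : ContDiff ℝ ∞ f)
    {D : ℝ × W → W'} (hD : ContDiff ℝ ∞ D) :
    ContDiff ℝ ∞ fun x : (P × ℝ) × W => f (x.1.1, D (x.1.2, x.2)) := by
  have a1 : ContDiff ℝ ∞ fun x : (P × ℝ) × W => (x.1.2, x.2) := by fun_prop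
  have a2 : ContDiff ℝ ∞ fun x : (P × ℝ) × W => D (x.1.2, x.2) := hD.comp a1
  have a3 : ContDiff ℝ ∞ fun x : (P × ℝ) × W => x.1.1 := by fun_prop
  exact hf.comp (a3.prodMk a2)

theorem contDiff_comp_dilation {ρ : CSpace n × CSpace n → ℝ} (hl : l < n) (hρ : ContDiff ℝ ∞ ρ) :
    ContDiff ℝ ∞ fun x : (CSpace n × ℝ) × CSpace n =>
      ρ (x.1.1, dilation (dilationWeight n l x.1.2) x.2) := by
  exact contDiff_comp_pair hρ (contDiff_dilation hl)

theorem dilation_zero (hl : l < n) (w : CSpace n) :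
    dilation (dilationWeight n l 0) w = blockProj (lastIdx n l) w := by
  rw [dilation_eq hl]
  simp

/-- At `τ = 0` the derivative in the dilation parameter only sees the middle block. -/
theorem hasDerivAt_comp_dilation {ρ : CSpace n × CSpace n → ℝ} (hl : l < n) (hρ : ContDiff ℝ ∞ ρ)
    (p w : CSpace n) : HasDerivAt (fun t => ρ (p, dilation (dilationWeight n l t) w))
      (fderiv ℝ ρ (p, blockProj (lastIdx n l) w) (0, blockProj (midIdx n l) w)) 0 := by
  have c1 : HasDerivAt (fun t : ℝ => (p, dilation (dilationWeight n l t) w))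
      (0, blockProj (midIdx n l) w) 0 := by
    refine (hasDerivAt_const (0 : ℝ) p).prodMk ?_
    simp only [dilation_eq hl]
    refine (((((hasDerivAt_id' (0 : ℝ)).pow 2).smul_const _).add
      ((hasDerivAt_id' (0 : ℝ)).smul_const _)).add_const _).congr_deriv ?_
    simp
  have c2 : HasFDerivAt ρ (fderiv ℝ ρ (p, blockProj (lastIdx n l) w))
      (p, dilation (dilationWeight n l 0) w) := by
    rw [dilation_zero hl]
    exact (hρ.differentiable (by simp) _).hasFDerivAt
  exact c2.comp_hasDerivAt 0 c1

/-- The dilated defining functions `τ⁻² ρ_p(τ² w_0, τ w', w'')` extend smoothly to `τ = 0`, because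
`ρ_p` and its derivative in the middle directions vanish on the leaf `{ζ_0 = 0, ζ' = 0}`. -/
theorem exists_dilated {ρ : CSpace n × CSpace n → ℝ} {z₀ : CSpace n} (hl : l < n)
    (hρ : ContDiff ℝ ∞ ρ)
    (hleaf : ∀ᶠ q in 𝓝 (z₀, (0 : CSpace n)), blockProj (lastIdx n l) q.2 = q.2 →
      ρ q = 0 ∧ ∀ X : CSpace n, X 0 = 0 → fderiv ℝ ρ q (0, X) = 0) :
    ∃ R : (CSpace n × ℝ) × CSpace n → ℝ, ContDiff ℝ ∞ R ∧
      ∀ᶠ q in 𝓝 (z₀, (0 : CSpace n)), ∀ τ : ℝ,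
        ρ (q.1, dilation (dilationWeight n l τ) q.2) = τ ^ 2 * R ((q.1, τ), q.2) := by
  have hk := contDiff_comp_dilation (l := l) hl hρ
  obtain ⟨R, hR, hkR⟩ := exists_taylor_param hk
  refine ⟨R, hR, ?_⟩
  have ht : Tendsto (fun q : CSpace n × CSpace n => (q.1, blockProj (lastIdx n l) q.2))
      (𝓝 (z₀, 0)) (𝓝 (z₀, 0)) := by
    have : Continuous fun q : CSpace n × CSpace n => (q.1, blockProj (lastIdx n l) q.2) := by
      fun_prop
    simpa using this.tendsto (z₀, (0 : CSpace n))
  filter_upwards [ht.eventually hleaf] with q hq τ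
  obtain ⟨h0, h1⟩ := hq (blockProj_idem _ _)
  have c1 := hasDerivAt_comp_line hk ((q.1, (0 : ℝ)), q.2) ((0, 1), 0) 0
  simp only [Prod.smul_mk, smul_zero, Prod.mk_add_mk, add_zero, smul_eq_mul, mul_one,
    zero_add] at c1
  rw [hkR q.1 q.2 τ, c1.unique (hasDerivAt_comp_dilation hl hρ q.1 q.2),
    h1 _ (by simp [blockProj_apply, zero_notMem_midIdx])]
  simp only [dilation_zero hl, h0]
  ring

end Scaling

/-! ### Positivity of the dilated weight -/

section ScaledWeight

variable {n : ℕ} [NeZero n] {l : ℕ} {ρ : CSpace n × CSpace n → ℝ} {z₀ : CSpace n}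

/-- The Hessian of the normal form at the centre, on dilated vectors: the leaf directions only
interact with the normal one. -/
theorem hessian_dilation_lower (hl : l < n) (hρ : ContDiff ℝ ∞ ρ)
    (hleaf : ∀ᶠ q in 𝓝 (z₀, (0 : CSpace n)), blockProj (lastIdx n l) q.2 = q.2 →
      ρ q = 0 ∧ ∀ X : CSpace n, X 0 = 0 → fderiv ℝ ρ q (0, X) = 0)
    (hh : ∀ᶠ p in 𝓝 z₀, ∀ X : CSpace n, blockProj (midIdx n l) X = X →
        fderiv ℝ (fderiv ℝ ρ) (p, 0) (0, X) (0, X) = 2 * ∑ j ∈ midIdx n l, ‖X j‖ ^ 2) :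
    ∃ M : ℝ, 0 ≤ M ∧ ∀ τ : ℝ, 0 < τ → ∀ Z : CSpace n,
      2 * τ ^ 2 * ‖blockProj (midIdx n l) Z‖ ^ 2 - τ ^ 2 * (M * τ ^ 2 * ‖Z 0‖ ^ 2
        + 2 * M * τ * ‖Z 0‖ * ‖blockProj (midIdx n l) Z‖
        + 2 * M * ‖Z 0‖ * ‖blockProj (lastIdx n l) Z‖) ≤
      fderiv ℝ (fderiv ℝ ρ) (z₀, 0) (0, dilation (dilationWeight n l τ) Z)
        (0, dilation (dilationWeight n l τ) Z) := by
  obtain ⟨M, hM0, hM⟩ := exists_bound_fderiv hρ (z₀, 0)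
  have hM1 := hM.self_of_nhds.2
  refine ⟨M, hM0.le, fun τ hτ Z => ?_⟩
  set H := fderiv ℝ (fderiv ℝ ρ) (z₀, 0) with hH
  have hsymm : ∀ u w, H u w = H w u := fun u w =>
    (isSymm_of_contDiffAt (hρ.contDiffAt.of_le (by norm_cast))) u w
  have hlast : ∀ X : CSpace n, X 0 = 0 → H (0, blockProj (lastIdx n l) Z) (0, X) = 0 := fun X hX => by
    have e1 := hasDerivAt_fderiv_line hρ (z₀, (0 : CSpace n)) (0, blockProj (lastIdx n l) Z) (0, X)
    have e2 : ∀ᶠ t : ℝ in 𝓝 0,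
        fderiv ℝ ρ ((z₀, 0) + t • (0, blockProj (lastIdx n l) Z)) (0, X) = 0 := by
      have ht : Tendsto (fun t : ℝ => (z₀, (0 : CSpace n)) + t • (0, blockProj (lastIdx n l) Z))
          (𝓝 0) (𝓝 (z₀, 0)) := by
        have : Continuous fun t : ℝ =>
            (z₀, (0 : CSpace n)) + t • ((0 : CSpace n), blockProj (lastIdx n l) Z) := by fun_prop
        simpa using this.tendsto 0
      filter_upwards [ht.eventually hleaf] with t h
      refine (h ?_).2 X hX
      simp only [Prod.smul_mk, Prod.mk_add_mk, zero_add]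
      have h2 := (blockProj (lastIdx n l)).map_smul (t : ℂ) (blockProj (lastIdx n l) Z)
      rw [blockProj_idem] at h2
      exact h2
    exact e1.unique ((hasDerivAt_const (0 : ℝ) (0 : ℝ)).congr_of_eventuallyEq e2)
  set A : CSpace n := Z 0 • EuclideanSpace.single 0 1 with hA
  set B := blockProj (midIdx n l) Z with hB
  set D := blockProj (lastIdx n l) Z with hD
  have hAn : ‖A‖ = ‖Z 0‖ := by simp [hA, norm_smul]
  have hB0 : B 0 = 0 := by simp [hB, blockProj_apply, zero_notMem_midIdx]
  have hD0 : D 0 = 0 := by simp [hD, blockProj_apply, zero_notMem_lastIdx hl]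
  have hn : ∀ X : CSpace n, ‖((0 : CSpace n), X)‖ = ‖X‖ := fun X => by simp [Prod.norm_def]
  have hBB : H (0, B) (0, B) = 2 * ‖B‖ ^ 2 := by
    rw [hh.self_of_nhds B (blockProj_idem _ _), hB, norm_blockProj, blockNorm,
      Real.sq_sqrt (Finset.sum_nonneg fun _ _ => sq_nonneg _)]
    exact congrArg _ (Finset.sum_congr rfl fun j hj => by rw [blockProj_apply, if_pos hj])
  have hexp : ((0 : CSpace n), dilation (dilationWeight n l τ) Z) =
      τ ^ 2 • ((0 : CSpace n), A) + τ • ((0 : CSpace n), B) + ((0 : CSpace n), D) := by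
    rw [dilation_eq hl]; simp [A, B, D]
  have h1 : H (0, dilation (dilationWeight n l τ) Z) (0, dilation (dilationWeight n l τ) Z) =
      τ ^ 4 * H (0, A) (0, A) + 2 * τ ^ 3 * H (0, A) (0, B) + 2 * τ ^ 2 * H (0, A) (0, D)
        + 2 * τ ^ 2 * ‖B‖ ^ 2 := by
    rw [hexp]
    simp only [map_add, map_smul, add_apply, smul_apply, smul_eq_mul]
    rw [hlast B hB0, hlast D hD0, hsymm (0, B) (0, D), hlast B hB0, hBB, hsymm (0, B) (0, A),
      hsymm (0, D) (0, A)]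
    ring
  have m1 := neg_le_of_abs_le (hM1 (0, A) (0, A))
  have m2 := neg_le_of_abs_le (hM1 (0, A) (0, B))
  have m3 := neg_le_of_abs_le (hM1 (0, A) (0, D))
  rw [hn, hAn] at m1 m2 m3
  rw [hn] at m2 m3
  rw [h1]
  have q1 := mul_le_mul_of_nonneg_left m1 (by positivity : 0 ≤ τ ^ 4)
  have q2 := mul_le_mul_of_nonneg_left m2 (by positivity : 0 ≤ 2 * τ ^ 3)
  have q3 := mul_le_mul_of_nonneg_left m3 (by positivity : 0 ≤ 2 * τ ^ 2)
  linarith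

theorem norm_dilation (hl : l < n) (τ : ℝ) (Z : CSpace n) :
    ‖blockProj (lastIdx n l) Z‖ ≤ ‖dilation (dilationWeight n l τ) Z‖ := by
  refine norm_le_of_forall_norm_le fun j => ?_
  rw [blockProj_apply, dilation_apply]
  split_ifs with h
  · rw [dilationWeight_last hl τ h]; simp
  · rw [norm_zero]; positivity

theorem norm_sq_eq_blocks (hl : l < n) (Z : CSpace n) : ‖Z‖ ^ 2 =
    ‖Z 0‖ ^ 2 + ‖blockProj (midIdx n l) Z‖ ^ 2 + ‖blockProj (lastIdx n l) Z‖ ^ 2 := by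
  simp only [EuclideanSpace.norm_sq_eq, blockProj_apply]
  rw [show ‖Z 0‖ ^ 2 = ∑ j, ‖if j = 0 then Z j else 0‖ ^ 2 by
    rw [Finset.sum_eq_single (0 : Fin n)] <;> simp +contextual, ← Finset.sum_add_distrib,
    ← Finset.sum_add_distrib]
  refine Finset.sum_congr rfl fun j _ => ?_
  rcases index_cases (l := l) j with rfl | h | h
  · simp [zero_notMem_midIdx, zero_notMem_lastIdx hl]
  · have h0 : j ≠ 0 := fun h0 => zero_notMem_midIdx (h0 ▸ h)
    simp [h, h0, notMem_lastIdx_of_mem_midIdx h]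
  · have h0 : j ≠ 0 := fun h0 => zero_notMem_lastIdx hl (h0 ▸ h)
    have h2 : j ∉ midIdx n l := fun h2 => notMem_lastIdx_of_mem_midIdx h2 h
    simp [h, h0, h2]

/-- The numerical inequality behind `levi_expWeight_center`: the cross terms are absorbed, those with
`b` because `M τ` is small and the one with `c` because `K` is large. -/
theorem center_estimate {a b c M τ K N H₁ H₂ : ℝ} (hK : 4 * M ^ 2 + 1 ≤ K) (hM0 : 0 ≤ M)
    (hτ : 0 < τ) (hτ1 : τ ≤ 1) (hτM : M * τ ≤ 1 / 8) (ha : 0 ≤ a) (hb : 0 ≤ b) (hc : 0 ≤ c)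
    (hN : c ≤ N)
    (h1 : 2 * τ ^ 2 * b ^ 2 - τ ^ 2 * (M * τ ^ 2 * a ^ 2 + 2 * M * τ * a * b + 2 * M * a * c) ≤ H₁)
    (h2 : 2 * τ ^ 2 * b ^ 2 - τ ^ 2 * (M * τ ^ 2 * a ^ 2 + 2 * M * τ * a * b + 2 * M * a * c) ≤ H₂) :
    1 / (16 * (K + 1)) * (a ^ 2 + b ^ 2 + c ^ 2) * (K + 1) ≤
      (τ ^ 2)⁻¹ * ((H₁ + H₂) / 4) + (τ ^ 2)⁻¹ ^ 2 * (τ ^ 4 * a ^ 2 / 4) + K * N ^ 2 := by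
  have hK0 : 0 ≤ K := le_trans (by positivity) hK
  have e1 : b ^ 2 - (M * τ ^ 2 * a ^ 2 + 2 * M * τ * a * b + 2 * M * a * c) / 2 ≤
      (τ ^ 2)⁻¹ * ((H₁ + H₂) / 4) := by
    rw [inv_mul_eq_div, le_div_iff₀ (by positivity)]
    linarith
  have e2 : (τ ^ 2)⁻¹ ^ 2 * (τ ^ 4 * a ^ 2 / 4) = a ^ 2 / 4 := by
    field_simp
  have e3 : K * c ^ 2 ≤ K * N ^ 2 := by gcongr
  have e4 : 1 / (16 * (K + 1)) * (a ^ 2 + b ^ 2 + c ^ 2) * (K + 1) =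
      (a ^ 2 + b ^ 2 + c ^ 2) / 16 := by
    field_simp
  have e5 : (4 * M ^ 2 + 1) * c ^ 2 ≤ K * c ^ 2 := by gcongr
  have e6 : M * τ ^ 2 * a ^ 2 ≤ 1 / 8 * a ^ 2 := by
    have : M * τ ^ 2 ≤ 1 / 8 := by nlinarith [mul_nonneg hM0 hτ.le]
    gcongr
  have e7 : M * τ * (a * b) ≤ 1 / 8 * (a * b) := by gcongr
  rw [e2, e4]
  nlinarith [sq_nonneg (a - b), sq_nonneg (a / 4 - 2 * M * c), sq_nonneg c, sq_nonneg b]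

/-- The Levi form of the weight at the centre, on dilated vectors. -/
theorem levi_expWeight_center (hl : l < n) (hρ : ContDiff ℝ ∞ ρ)
    (hleaf : ∀ᶠ q in 𝓝 (z₀, (0 : CSpace n)), blockProj (lastIdx n l) q.2 = q.2 →
      ρ q = 0 ∧ ∀ X : CSpace n, X 0 = 0 → fderiv ℝ ρ q (0, X) = 0)
    (hd : ∀ᶠ p in 𝓝 z₀, ∀ X : CSpace n, fderiv ℝ ρ (p, 0) (0, X) = (X 0).re)
    (hh : ∀ᶠ p in 𝓝 z₀, ∀ X : CSpace n, blockProj (midIdx n l) X = X →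
        fderiv ℝ (fderiv ℝ ρ) (p, 0) (0, X) (0, X) = 2 * ∑ j ∈ midIdx n l, ‖X j‖ ^ 2) :
    ∃ K₀ : ℝ, 0 ≤ K₀ ∧ ∀ K, K₀ ≤ K → ∀ᶠ τ in 𝓝[>] (0 : ℝ), ∀ Z : CSpace n,
      1 / (16 * (K + 1)) * ‖Z‖ ^ 2 ≤ (leviL (expWeight (τ ^ 2)⁻¹ K fun ζ => ρ (z₀, ζ)) 0
        (dilation (dilationWeight n l τ) Z) (dilation (dilationWeight n l τ) Z)).re := by
  obtain ⟨M, hM0, hM⟩ := hessian_dilation_lower hl hρ hleaf hh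
  refine ⟨4 * M ^ 2 + 1, by positivity, fun K hK => ?_⟩
  have hK0 : 0 ≤ K := le_trans (by positivity) hK
  have hev : ∀ᶠ τ in 𝓝[>] (0 : ℝ), M * τ < 1 / 8 := by
    have : Tendsto (fun τ : ℝ => M * τ) (𝓝[>] 0) (𝓝 0) := by
      have : Continuous fun τ : ℝ => M * τ := by fun_prop
      simpa using (this.tendsto 0).mono_left nhdsWithin_le_nhds
    exact this.eventually_lt_const (by norm_num)
  have hev1 : ∀ᶠ τ in 𝓝[>] (0 : ℝ), τ < 1 :=
    nhdsWithin_le_nhds (eventually_lt_nhds (by norm_num))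
  filter_upwards [hev, hev1, self_mem_nhdsWithin] with τ hτM hτ1 hτ Z
  have hτ : 0 < τ := hτ
  have hf := contDiff_partial hρ z₀
  have hρ0 : ρ (z₀, 0) = 0 := (hleaf.self_of_nhds (map_zero _)).1
  set X := dilation (dilationWeight n l τ) Z with hX
  have hX0 : X 0 = τ ^ 2 * Z 0 := by simp [hX, dilationWeight]
  have hdel : ‖delForm (fun ζ => ρ (z₀, ζ)) 0 X‖ ^ 2 = τ ^ 4 * ‖Z 0‖ ^ 2 / 4 := by
    rw [delForm_norm_sq, fderiv_partial hρ, fderiv_partial hρ, hd.self_of_nhds, hd.self_of_nhds,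
      PiLp.smul_apply, hX0, ← Complex.normSq_eq_norm_sq, Complex.normSq_apply]
    simp [← Complex.ofReal_pow]
    ring
  have hI : Complex.I • X = dilation (dilationWeight n l τ) (Complex.I • Z) := (map_smul _ _ _).symm
  have hIn : ∀ s, ‖blockProj s (Complex.I • Z)‖ = ‖blockProj s Z‖ := fun s => by
    rw [map_smul, norm_smul, Complex.norm_I, one_mul]
  have hIz : ‖(Complex.I • Z) 0‖ = ‖Z 0‖ := by simp
  have b1 := hM τ hτ Z
  have b2 := hM τ hτ (Complex.I • Z)
  rw [hIn, hIn, hIz, ← hI] at b2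
  rw [levi_expWeight hf, hdel, leviL_self_re ((hf.fderiv_right (m := ∞) (by simp)).differentiable
    (by simp) 0), fderiv_fderiv_partial hρ, fderiv_fderiv_partial hρ, hρ0, mul_zero, Real.exp_zero,
    one_mul, norm_sq_eq_blocks hl Z, le_div_iff₀ (by linarith)]
  exact center_estimate hK hM0 hτ hτ1.le hτM.le (norm_nonneg _) (norm_nonneg _) (norm_nonneg _)
    (norm_dilation hl τ Z) b1 b2

end ScaledWeight

/-! ### The plurisubharmonic functions -/

section Weight

variable {n : ℕ} [NeZero n] {l : ℕ} {ρ : CSpace n × CSpace n → ℝ} {z₀ : CSpace n}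

/-- The weight in dilated coordinates, as a function of `((p, τ), w)`. -/
noncomputable def dilatedWeight (l : ℕ) (K : ℝ) (R : (CSpace n × ℝ) × CSpace n → ℝ)
    (x : (CSpace n × ℝ) × CSpace n) : ℝ :=
  (Real.exp (R x) + K * ‖dilation (dilationWeight n l x.1.2) x.2‖ ^ 2) / (K + 1)

theorem contDiff_dilatedWeight (hl : l < n) (K : ℝ) {R : (CSpace n × ℝ) × CSpace n → ℝ}
    (hR : ContDiff ℝ ∞ R) : ContDiff ℝ ∞ (dilatedWeight l K R) := by
  have h : ContDiff ℝ ∞ fun q : CSpace n × CSpace n => ‖q.2‖ ^ 2 :=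
    contDiff_norm_sq_complex.comp contDiff_snd
  exact (hR.exp.add (contDiff_const.mul (contDiff_comp_dilation (l := l) hl h))).div_const _

theorem dilatedWeight_eq {R : (CSpace n × ℝ) × CSpace n → ℝ} (K : ℝ) {p w : CSpace n} {τ : ℝ}
    (hτ : τ ≠ 0)
    (h : ρ (p, dilation (dilationWeight n l τ) w) = τ ^ 2 * R ((p, τ), w)) :
    dilatedWeight l K R ((p, τ), w) =
      expWeight (τ ^ 2)⁻¹ K (fun ζ => ρ (p, ζ)) (dilation (dilationWeight n l τ) w) := by
  simp only [dilatedWeight, expWeight, h]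
  rw [inv_mul_cancel_left₀ (by positivity)]

theorem levi_dilatedWeight (hρ : ContDiff ℝ ∞ ρ) {R : (CSpace n × ℝ) × CSpace n → ℝ} (K : ℝ)
    {p w : CSpace n} {τ : ℝ} (hτ : τ ≠ 0)
    (h : ∀ᶠ w in 𝓝 w, ρ (p, dilation (dilationWeight n l τ) w) = τ ^ 2 * R ((p, τ), w))
    (Z : CSpace n) :
    (leviL (fun w => dilatedWeight l K R ((p, τ), w)) w Z Z).re =
      (leviL (expWeight (τ ^ 2)⁻¹ K fun ζ => ρ (p, ζ)) (dilation (dilationWeight n l τ) w)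
        (dilation (dilationWeight n l τ) Z) (dilation (dilationWeight n l τ) Z)).re := by
  rw [← levi_comp_linear (contDiff_expWeight (contDiff_partial hρ p) _ K), leviL_congr
    (h.mono fun w hw => dilatedWeight_eq K hτ hw)]

/-- Positivity at the points `((z₀, τ), 0)` with small `τ > 0` propagates to a full neighbourhood
of `((z₀, 0), 0)`, since the dilated weight is smooth there. -/
theorem eventually_levi_lower {R : (CSpace n × ℝ) × CSpace n → ℝ} (hl : l < n)
    (hR : ContDiff ℝ ∞ R) {K c : ℝ} (hc : 0 < c)
    (h : ∀ᶠ τ in 𝓝[>] (0 : ℝ), ∀ Z : CSpace n,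
      c * ‖Z‖ ^ 2 ≤ (leviL (fun w => dilatedWeight l K R ((z₀, τ), w)) 0 Z Z).re) :
    ∀ᶠ x in 𝓝 ((z₀, (0 : ℝ)), (0 : CSpace n)), ∀ Z : CSpace n,
      c / 2 * ‖Z‖ ^ 2 ≤ (leviL (fun w => dilatedWeight l K R (x.1, w)) x.2 Z Z).re := by
  have hG := contDiff_dilatedWeight (n := n) hl K hR
  obtain ⟨k, hk0, s, hs, hk⟩ := exists_lipschitz_hessian hG ((z₀, (0 : ℝ)), (0 : CSpace n))
  have hre : ∀ x : (CSpace n × ℝ) × CSpace n, ∀ Z : CSpace n,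
      (leviL (fun w => dilatedWeight l K R (x.1, w)) x.2 Z Z).re =
        (fderiv ℝ (fderiv ℝ (dilatedWeight l K R)) x (0, Z) (0, Z) +
          fderiv ℝ (fderiv ℝ (dilatedWeight l K R)) x (0, Complex.I • Z) (0, Complex.I • Z)) / 4 :=
    fun x Z => by
      rw [leviL_self_re (((contDiff_partial hG x.1).fderiv_right (m := ∞) (by simp)).differentiable
        (by simp) x.2), fderiv_fderiv_partial hG, fderiv_fderiv_partial hG]
  obtain ⟨ε, hε, hb⟩ := Metric.mem_nhds_iff.1 hs
  -- Two points of the ball of radius `d` have distance at most `2 d`, so their Hessians differ by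
  -- at most `2 d k ≤ c`.
  set d := min ε (c / (2 * (k + 1))) with hd
  have hd0 : 0 < d := lt_min hε (by positivity)
  obtain ⟨τ, hτ, hτd⟩ := (h.and (Ioo_mem_nhdsGT hd0)).exists
  have hball : ∀ x ∈ Metric.ball ((z₀, (0 : ℝ)), (0 : CSpace n)) d, x ∈ s := fun x hx =>
    hb (Metric.ball_subset_ball (min_le_left _ _) hx)
  have hτm : ((z₀, τ), (0 : CSpace n)) ∈ Metric.ball ((z₀, (0 : ℝ)), (0 : CSpace n)) d := by
    rw [← ball_prod_same, ← ball_prod_same]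
    refine ⟨⟨Metric.mem_ball_self hd0, ?_⟩, Metric.mem_ball_self hd0⟩
    rw [mem_ball_zero_iff, Real.norm_eq_abs, abs_of_pos hτd.1]
    exact hτd.2
  have hn : ∀ X : CSpace n, ‖((0 : CSpace n × ℝ), X)‖ = ‖X‖ := fun X => by simp [Prod.norm_def]
  filter_upwards [Metric.ball_mem_nhds _ hd0] with x hx Z
  have h1 := hre x Z
  have h2 := hre ((z₀, τ), 0) Z
  have h3 := hτ Z
  have hdist : k * ‖x - ((z₀, τ), 0)‖ ≤ c := by
    have e1 : ‖x - ((z₀, τ), 0)‖ ≤ 2 * d := by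
      rw [← dist_eq_norm]
      have := dist_triangle_right x ((z₀, τ), (0 : CSpace n)) ((z₀, (0 : ℝ)), (0 : CSpace n))
      rw [Metric.mem_ball] at hx hτm
      linarith
    have e2 : d * (2 * (k + 1)) ≤ c := (le_div_iff₀ (by positivity)).1 (min_le_right _ _)
    nlinarith
  have h4 := hk x (hball x hx) ((z₀, τ), 0) (hball _ hτm) (0, Z)
  have h5 := hk x (hball x hx) ((z₀, τ), 0) (hball _ hτm) (0, Complex.I • Z)
  rw [hn] at h4 h5
  rw [norm_smul, Complex.norm_I, one_mul] at h5
  have h6 := neg_le_of_abs_le h4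
  have h7 := neg_le_of_abs_le h5
  have h8 : k * ‖x - ((z₀, τ), 0)‖ * ‖Z‖ ^ 2 ≤ c * ‖Z‖ ^ 2 := by gcongr
  simp only at h1 h2 h3
  linarith

end Weight

section WeightEstimates

variable {n : ℕ}

/-- Mixed derivatives in some of the variables are bounded on compact sets, with constants that
depend only on the multi-index of total orders. -/
theorem exists_mixedDeriv_bound {Q : Type*} [NormedAddCommGroup Q] [NormedSpace ℝ Q]
    {F : Q × CSpace n → ℂ} (hF : ContDiff ℝ ∞ F) {S : Set (Q × CSpace n)} (hS : IsCompact S) :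
    ∃ Cα : (Fin n → ℕ) → ℝ, ∀ β γ : Fin n → ℕ, ∀ x ∈ S,
      ‖mixedDeriv β γ (fun w => F (x.1, w)) x.2‖ ≤ Cα (β + γ) := by
  have h : ∀ β γ : Fin n → ℕ, ∃ B : ℝ, 0 ≤ B ∧ ∀ x ∈ S,
      ‖mixedDeriv β γ (fun w => F (x.1, w)) x.2‖ ≤ B := fun β γ => by
    obtain ⟨F₁, h1, h2⟩ := exists_contDiff_mixedDeriv hF β γ
    obtain ⟨B, hB⟩ := hS.exists_bound_of_continuousOn h1.continuous.continuousOn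
    refine ⟨max B 0, le_max_right _ _, fun x hx => ?_⟩
    rw [h2]
    exact (hB x hx).trans (le_max_left _ _)
  choose B hB0 hB using h
  refine ⟨fun α => ∑ β ∈ Fintype.piFinset fun j => Finset.range (α j + 1), B β (α - β),
    fun β γ x hx => (hB β γ x hx).trans ?_⟩
  have hmem : β ∈ Fintype.piFinset fun j => Finset.range ((β + γ) j + 1) :=
    Fintype.mem_piFinset.2 fun j => Finset.mem_range.2 (by simp only [Pi.add_apply]; omega)
  have hsub : β + γ - β = γ := by
    funext j
    simp
  have := Finset.single_le_sum (f := fun β' => B β' (β + γ - β')) (fun β' _ => hB0 _ _) hmem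
  simpa only [hsub] using this

variable [NeZero n] {l : ℕ} {ρ : CSpace n × CSpace n → ℝ} {z₀ : CSpace n}

theorem prod_dilationWeight {δ : ℝ} (hδ : 0 < δ) (hl : l < n) (α : Fin n → ℕ) :
    ∏ j, dilationWeight n l (Real.sqrt δ) j ^ α j =
      δ ^ ((α 0 : ℝ) + (1 / 2) * ∑ j ∈ midIdx n l, (α j : ℝ)) := by
  have hs : Real.sqrt δ = δ ^ (1 / 2 : ℝ) := Real.sqrt_eq_rpow δ
  have h : ∀ j, dilationWeight n l (Real.sqrt δ) j ^ α j =
      δ ^ ((if j = 0 then (α j : ℝ) else 0) + 1 / 2 * if j ∈ midIdx n l then (α j : ℝ) else 0) := by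
    intro j
    rcases index_cases (l := l) j with rfl | h | h
    · rw [dilationWeight, if_pos rfl, Real.sq_sqrt hδ.le, if_pos rfl, if_neg zero_notMem_midIdx]
      simp
    · have h0 : j ≠ 0 := fun h0 => zero_notMem_midIdx (h0 ▸ h)
      rw [dilationWeight_mid _ h, if_neg h0, if_pos h, hs, ← Real.rpow_natCast, ← Real.rpow_mul hδ.le,
        zero_add]
    · have h0 : j ≠ 0 := fun h0 => zero_notMem_lastIdx hl (h0 ▸ h)
      have h2 : j ∉ midIdx n l := fun h2 => notMem_lastIdx_of_mem_midIdx h2 h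
      rw [dilationWeight_last hl _ h, if_neg h0, if_neg h2]
      simp
  simp only [h]
  rw [← Real.rpow_sum_of_pos hδ, Finset.sum_add_distrib, ← Finset.mul_sum]
  simp [Finset.sum_ite_mem]

theorem exists_dilation_of_mem_polydisc (hl : l < n) {δ a : ℝ} (hδ : 0 < δ)
    {ζ : CSpace n} (hζ : ζ ∈ polydisc l δ a) :
    ∃ w : CSpace n, dilation (dilationWeight n l (Real.sqrt δ)) w = ζ ∧ ‖w‖ ≤ n * a := by
  have hτ : Real.sqrt δ ≠ 0 := (Real.sqrt_pos.2 hδ).ne'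
  have hτ0 : 0 < Real.sqrt δ := Real.sqrt_pos.2 hδ
  obtain ⟨h1, h2, h3⟩ := hζ
  refine ⟨dilation (fun j => (dilationWeight n l (Real.sqrt δ) j)⁻¹) ζ, ?_, ?_⟩
  · ext j
    simp [dilationWeight_ne_zero hτ]
  · have hj : ∀ j, ‖dilation (fun j => (dilationWeight n l (Real.sqrt δ) j)⁻¹) ζ j‖ ≤ a := fun j => by
      rw [dilation_apply, norm_mul, Complex.norm_real, norm_inv, inv_mul_eq_div]
      rcases index_cases (l := l) j with rfl | h | h
      · rw [dilationWeight, if_pos rfl, Real.sq_sqrt hδ.le, Real.norm_eq_abs, abs_of_pos hδ,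
          div_le_iff₀ hδ]
        exact h1.le
      · rw [dilationWeight_mid _ h, Real.norm_eq_abs, abs_of_pos hτ0, div_le_iff₀ hτ0]
        exact (h2 j h).le
      · rw [dilationWeight_last hl _ h, norm_one, div_one]
        exact (h3 j h).le
    generalize dilation (fun j => (dilationWeight n l (Real.sqrt δ) j)⁻¹) ζ = w at hj
    rw [sum_smul_single w]
    refine (norm_sum_le _ _).trans ((Finset.sum_le_card_nsmul _ _ a fun j _ => ?_).trans ?_)
    · rw [norm_smul, PiLp.norm_single, norm_one, mul_one]
      exact hj j
    · simp

theorem exists_dilation_eq {τ : ℝ} (hτ : τ ≠ 0) (Y : CSpace n) :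
    ∃ Z, dilation (dilationWeight n l τ) Z = Y :=
  ⟨dilation (fun j => (dilationWeight n l τ j)⁻¹) Y, by
    ext j
    simp [dilationWeight_ne_zero hτ]⟩

/-- Undoing the dilation turns uniform positivity into the anisotropic lower bound. -/
theorem levi_anisotropic (hl : l < n) (hρ : ContDiff ℝ ∞ ρ)
    {R : (CSpace n × ℝ) × CSpace n → ℝ} (hR : ContDiff ℝ ∞ R) {K c M δ : ℝ} (hc : 0 < c)
    (hδ : 0 < δ) {p w : CSpace n}
    (h : ∀ᶠ w in 𝓝 w, ρ (p, dilation (dilationWeight n l (Real.sqrt δ)) w) =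
      Real.sqrt δ ^ 2 * R ((p, Real.sqrt δ), w))
    (hM : ∀ Z, ‖delForm (fun w => R ((p, Real.sqrt δ), w)) w Z‖ ≤ M * ‖Z‖)
    (hlev : ∀ Z : CSpace n,
      c * ‖Z‖ ^ 2 ≤ (leviL (fun w => dilatedWeight l K R ((p, Real.sqrt δ), w)) w Z Z).re)
    (Y : CSpace n) :
    1 / ((M ^ 2 + 2) / c) *
      (‖delForm (fun ζ => ρ (p, ζ)) (dilation (dilationWeight n l (Real.sqrt δ)) w) Y‖ ^ 2 / δ ^ 2
        + ∑ j ∈ midIdx n l, ‖Y j‖ ^ 2 / δ + ∑ j ∈ lastIdx n l, ‖Y j‖ ^ 2) ≤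
      (leviL (expWeight δ⁻¹ K fun ζ => ρ (p, ζ))
        (dilation (dilationWeight n l (Real.sqrt δ)) w) Y Y).re := by
  have hτ0 : 0 < Real.sqrt δ := Real.sqrt_pos.2 hδ
  have hτ2 : Real.sqrt δ ^ 2 = δ := Real.sq_sqrt hδ.le
  obtain ⟨Z, rfl⟩ := exists_dilation_eq (l := l) hτ0.ne' Y
  have h1 := hlev Z
  rw [levi_dilatedWeight hρ K hτ0.ne' h, hτ2] at h1
  refine le_trans ?_ h1
  have h2 : delForm (fun ζ => ρ (p, ζ)) (dilation (dilationWeight n l (Real.sqrt δ)) w)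
      (dilation (dilationWeight n l (Real.sqrt δ)) Z) =
        δ * delForm (fun w => R ((p, Real.sqrt δ), w)) w Z := by
    rw [← delForm_comp_linear (contDiff_partial hρ p), delForm_congr h,
      delForm_const_mul (contDiff_partial hR _), hτ2]
  have h3 : ‖delForm (fun ζ => ρ (p, ζ)) (dilation (dilationWeight n l (Real.sqrt δ)) w)
      (dilation (dilationWeight n l (Real.sqrt δ)) Z)‖ ^ 2 / δ ^ 2 ≤ M ^ 2 * ‖Z‖ ^ 2 := by
    rw [h2, norm_mul, Complex.norm_real, Real.norm_eq_abs, abs_of_pos hδ, mul_pow,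
      mul_div_cancel_left₀ _ (by positivity), ← mul_pow]
    exact pow_le_pow_left₀ (norm_nonneg _) (hM Z) 2
  have hsum : ∀ s : Finset (Fin n), ∑ j ∈ s, ‖Z j‖ ^ 2 ≤ ‖Z‖ ^ 2 := fun s => by
    rw [EuclideanSpace.norm_sq_eq]
    exact Finset.sum_le_sum_of_subset_of_nonneg (Finset.subset_univ _) fun _ _ _ => sq_nonneg _
  have h4 : ∑ j ∈ midIdx n l, ‖dilation (dilationWeight n l (Real.sqrt δ)) Z j‖ ^ 2 / δ ≤
      ‖Z‖ ^ 2 := by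
    refine le_trans (le_of_eq (Finset.sum_congr rfl fun j hj => ?_)) (hsum (midIdx n l))
    rw [dilation_apply, dilationWeight_mid _ hj, norm_mul, Complex.norm_real, Real.norm_eq_abs,
      abs_of_pos hτ0, mul_pow, hτ2, mul_div_cancel_left₀ _ hδ.ne']
  have h5 : ∑ j ∈ lastIdx n l, ‖dilation (dilationWeight n l (Real.sqrt δ)) Z j‖ ^ 2 ≤
      ‖Z‖ ^ 2 := by
    refine le_trans (le_of_eq (Finset.sum_congr rfl fun j hj => ?_)) (hsum (lastIdx n l))
    rw [dilation_apply, dilationWeight_last hl _ hj, Complex.ofReal_one, one_mul]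
  have h6 : 0 < 1 / ((M ^ 2 + 2) / c) := by positivity
  refine (mul_le_mul_of_nonneg_left (add_le_add (add_le_add h3 h4) h5) h6.le).trans (le_of_eq ?_)
  field_simp
  ring

/-- Undoing the dilation turns a bound for the mixed derivatives into one with powers of `δ`. -/
theorem mixedDeriv_weight_bound {R : (CSpace n × ℝ) × CSpace n → ℝ} {K δ B : ℝ} (hl : l < n)
    (hδ : 0 < δ) {p w : CSpace n} {O : Set (CSpace n)} (hO : IsOpen O) (hw : w ∈ O)
    (h : ∀ w ∈ O, ρ (p, dilation (dilationWeight n l (Real.sqrt δ)) w) =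
      Real.sqrt δ ^ 2 * R ((p, Real.sqrt δ), w)) (β γ : Fin n → ℕ)
    (hB : ‖mixedDeriv β γ (fun w => (dilatedWeight l K R ((p, Real.sqrt δ), w) : ℂ)) w‖ ≤ B) :
    ‖mixedDeriv β γ (toC (expWeight δ⁻¹ K fun ζ => ρ (p, ζ)))
      (dilation (dilationWeight n l (Real.sqrt δ)) w)‖ ≤
        B * δ ^ (-(((β + γ) 0 : ℝ) + (1 / 2) * ∑ j ∈ midIdx n l, ((β + γ) j : ℝ))) := by
  have hτ0 : Real.sqrt δ ≠ 0 := (Real.sqrt_pos.2 hδ).ne'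
  have h1 : mixedDeriv β γ (fun w => (dilatedWeight l K R ((p, Real.sqrt δ), w) : ℂ)) w =
      mixedDeriv β γ (fun w => toC (expWeight δ⁻¹ K fun ζ => ρ (p, ζ))
        (dilation (dilationWeight n l (Real.sqrt δ)) w)) w :=
    mixedDeriv_eqOn hO (fun w hw => by
      simp only [toC]
      rw [dilatedWeight_eq K hτ0 (h w hw), Real.sq_sqrt hδ.le]) β γ hw
  have h2 := prod_dilationWeight hδ hl (β + γ)
  simp only [Pi.add_apply] at h2 ⊢
  rw [h1, mixedDeriv_dilation (dilationWeight_ne_zero hτ0), h2, norm_mul, Complex.norm_real,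
    Real.norm_eq_abs, abs_of_pos (Real.rpow_pos_of_pos hδ _)] at hB
  rw [Real.rpow_neg hδ.le, ← div_eq_mul_inv, le_div_iff₀ (Real.rpow_pos_of_pos hδ _), mul_comm]
  exact hB

end WeightEstimates

section Weights

variable {n : ℕ}

theorem eventually_norm_delForm_le {R : (CSpace n × ℝ) × CSpace n → ℝ} (hR : ContDiff ℝ ∞ R)
    (x₀ : (CSpace n × ℝ) × CSpace n) : ∃ M : ℝ, ∀ᶠ x in 𝓝 x₀, ∀ Z : CSpace n,
      ‖delForm (fun w => R (x.1, w)) x.2 Z‖ ≤ M * ‖Z‖ := by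
  obtain ⟨M, hM0, hM⟩ := exists_bound_fderiv hR x₀
  refine ⟨M, ?_⟩
  have hn : ∀ X : CSpace n, ‖((0 : CSpace n × ℝ), X)‖ = ‖X‖ := fun X => by simp [Prod.norm_def]
  filter_upwards [hM] with x h1 Z
  refine norm_delForm_le (fun X => ?_) Z
  rw [fderiv_partial hR]
  simpa only [hn] using h1.1 (0, X)

theorem leviForm_expWeight_eq {f : CSpace n → ℝ} (hf : ContDiff ℝ ∞ f) (c K : ℝ)
    (ζ Y : CSpace n) :
    leviForm (expWeight c K f) ζ Y Y = leviL (expWeight c K f) ζ Y Y :=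
  leviForm_eq ((contDiff_expWeight hf c K).contDiffAt.of_le (by norm_cast)) Y Y

variable [NeZero n] {l : ℕ} {ρ : CSpace n × CSpace n → ℝ} {z₀ : CSpace n}

/-- A lower bound for the Levi forms of the functions `ρ_p`, uniform near the centre. -/
theorem eventually_levi_lower_bound {S : Set (CSpace n)} (hρ : ContDiff ℝ ∞ ρ)
    (hnn : ∀ᶠ q in 𝓝 (z₀, (0 : CSpace n)),
      fderiv ℝ (fun ζ => ρ (q.1, ζ)) q.2 (EuclideanSpace.single 0 1) = 1 ∧
      (q.1 ∈ S → ∀ X, delForm (fun ζ => ρ (q.1, ζ)) q.2 X = 0 →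
        0 ≤ (leviL (fun ζ => ρ (q.1, ζ)) q.2 X X).re)) :
    ∃ C : ℝ, ∀ᶠ q in 𝓝 (z₀, (0 : CSpace n)), q.1 ∈ S → ∀ Y : CSpace n,
      -C * ‖delForm (fun ζ => ρ (q.1, ζ)) q.2 Y‖ * ‖Y‖ ≤
        (leviL (fun ζ => ρ (q.1, ζ)) q.2 Y Y).re := by
  obtain ⟨M, hM0, hM⟩ := exists_bound_fderiv hρ (z₀, 0)
  refine ⟨4 * M * (1 + M), ?_⟩
  have hn : ∀ X : CSpace n, ‖((0 : CSpace n), X)‖ = ‖X‖ := fun X => by simp [Prod.norm_def]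
  filter_upwards [hnn, hM] with q h1 h2 hq Y
  refine levi_lower_bound (contDiff_partial hρ q.1) hM0.le (fun X => ?_) (fun X Y => ?_)
    (by rw [PiLp.norm_single, norm_one]) h1.1 (h1.2 hq) Y
  · rw [fderiv_partial hρ]
    simpa only [hn] using h2.1 (0, X)
  · rw [fderiv_fderiv_partial hρ]
    simpa only [hn] using h2.2 (0, X) (0, Y)

/-- The weights `(e^{ρ_p / δ} + K |ζ|²) / (K + 1)` have all the required properties, uniformly for
boundary points `p` near `z₀`. -/
theorem exists_weights {S : Set (CSpace n)} (hl : l < n) (hρ : ContDiff ℝ ∞ ρ)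
    (hleaf : ∀ᶠ q in 𝓝 (z₀, (0 : CSpace n)), blockProj (lastIdx n l) q.2 = q.2 →
      ρ q = 0 ∧ ∀ X : CSpace n, X 0 = 0 → fderiv ℝ ρ q (0, X) = 0)
    (hd : ∀ᶠ p in 𝓝 z₀, ∀ X : CSpace n, fderiv ℝ ρ (p, 0) (0, X) = (X 0).re)
    (hh : ∀ᶠ p in 𝓝 z₀, ∀ X : CSpace n, blockProj (midIdx n l) X = X →
        fderiv ℝ (fderiv ℝ ρ) (p, 0) (0, X) (0, X) = 2 * ∑ j ∈ midIdx n l, ‖X j‖ ^ 2)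
    (hnn : ∀ᶠ q in 𝓝 (z₀, (0 : CSpace n)),
      fderiv ℝ (fun ζ => ρ (q.1, ζ)) q.2 (EuclideanSpace.single 0 1) = 1 ∧
      (q.1 ∈ S → ∀ X, delForm (fun ζ => ρ (q.1, ζ)) q.2 X = 0 →
        0 ≤ (leviL (fun ζ => ρ (q.1, ζ)) q.2 X X).re)) :
    ∃ η > 0, ∃ a > 0, ∃ C > 0, ∃ Cα : (Fin n → ℕ) → ℝ, ∃ δ₀ > 0,
      ∀ p ∈ Metric.ball z₀ η, p ∈ S → ∀ δ : ℝ, 0 < δ → δ < δ₀ → ∃ g : CSpace n → ℝ,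
        ContDiff ℝ ∞ g ∧
        (∀ ζ, ‖ζ‖ < η → ρ (p, ζ) < 0 → |g ζ| ≤ 1 ∧ ∀ Y, 0 ≤ (leviL g ζ Y Y).re) ∧
        (∀ ζ ∈ polydisc l δ a, ∀ Y : CSpace n,
          (1 / C) * (‖delPairing (fun ζ => ρ (p, ζ)) ζ Y‖ ^ 2 / δ ^ 2
              + ∑ j ∈ midIdx n l, ‖Y j‖ ^ 2 / δ + ∑ j ∈ lastIdx n l, ‖Y j‖ ^ 2)
            ≤ (leviForm g ζ Y Y).re) ∧
        ∀ ζ ∈ polydisc l δ a, ∀ β γ : Fin n → ℕ,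
          ‖mixedDeriv β γ (toC g) ζ‖ ≤
            Cα (β + γ) * δ ^ (-(((β + γ) 0 : ℝ)
              + (1 / 2) * ∑ j ∈ midIdx n l, ((β + γ) j : ℝ))) := by
  obtain ⟨R, hR, hRρ⟩ := exists_dilated hl hρ hleaf
  obtain ⟨C₁, hC₁⟩ := eventually_levi_lower_bound hρ hnn
  obtain ⟨K₀, hK₀, hK⟩ := levi_expWeight_center hl hρ hleaf hd hh
  -- `K₀` makes the Levi form positive at the centre, `C₁ ^ 2 / 4` makes it nonnegative where `ρ < 0`.
  set K := max K₀ (C₁ ^ 2 / 4) with hKdef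
  have hK0 : 0 ≤ K := hK₀.trans (le_max_left _ _)
  have hc : 0 < 1 / (16 * (K + 1)) := by positivity
  have hRnear : ∀ᶠ w in 𝓝 (0 : CSpace n), ∀ τ : ℝ,
      ρ (z₀, dilation (dilationWeight n l τ) w) = τ ^ 2 * R ((z₀, τ), w) := by
    have : Tendsto (fun w : CSpace n => (z₀, w)) (𝓝 0) (𝓝 (z₀, 0)) :=
      (by fun_prop : Continuous fun w : CSpace n => (z₀, w)).tendsto 0
    exact this.eventually hRρ
  have hlow := eventually_levi_lower (K := K) hl hR hc (by
    filter_upwards [hK K (le_max_left _ _), self_mem_nhdsWithin] with τ h1 h2 Z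
    rw [levi_dilatedWeight hρ K (ne_of_gt h2) (hRnear.mono fun w hw => hw τ), map_zero]
    exact h1 Z)
  obtain ⟨M, hM⟩ := eventually_norm_delForm_le hR ((z₀, (0 : ℝ)), (0 : CSpace n))
  obtain ⟨ε₁, hε₁, h1⟩ := Metric.eventually_nhds_iff_ball.1 (hlow.and hM)
  obtain ⟨ε₂, hε₂, h2⟩ := Metric.eventually_nhds_iff_ball.1 (hRρ.and hC₁)
  set ε := min 1 (min ε₁ ε₂) with hεdef
  have hε : 0 < ε := lt_min one_pos (lt_min hε₁ hε₂)
  have hεε₁ : ε ≤ ε₁ := (min_le_right _ _).trans (min_le_left _ _)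
  have hεε₂ : ε ≤ ε₂ := (min_le_right _ _).trans (min_le_right _ _)
  have hFs : ContDiff ℝ ∞ fun x => (dilatedWeight l K R x : ℂ) :=
    Complex.ofRealCLM.contDiff.comp (contDiff_dilatedWeight hl K hR)
  obtain ⟨Cα, hCα⟩ := exists_mixedDeriv_bound hFs
    (isCompact_closedBall ((z₀, (0 : ℝ)), (0 : CSpace n)) 1)
  have ha : 0 < ε / (n + 1) := by positivity
  refine ⟨ε, hε, ε / (n + 1), ha, (M ^ 2 + 2) / (1 / (16 * (K + 1)) / 2), by positivity, Cα, ε ^ 2,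
    by positivity, fun p hp hpS δ hδ hδε => ?_⟩
  have hf := contDiff_partial hρ p
  have hτε : Real.sqrt δ < ε := (Real.sqrt_lt' hε).2 hδε
  have hτ0 : 0 < Real.sqrt δ := Real.sqrt_pos.2 hδ
  have hpw : ∀ w ∈ Metric.ball (0 : CSpace n) ε, (p, w) ∈ Metric.ball (z₀, (0 : CSpace n)) ε₂ :=
    fun w hw => Metric.ball_subset_ball hεε₂ (by rw [← ball_prod_same]; exact ⟨hp, hw⟩)
  have hpol : ∀ ζ ∈ polydisc l δ (ε / (n + 1)), ∃ w ∈ Metric.ball (0 : CSpace n) ε,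
      dilation (dilationWeight n l (Real.sqrt δ)) w = ζ := fun ζ hζ => by
    obtain ⟨w, hw, hw2⟩ := exists_dilation_of_mem_polydisc hl hδ hζ
    refine ⟨w, ?_, hw⟩
    rw [mem_ball_zero_iff]
    refine hw2.trans_lt ?_
    rw [mul_div_assoc', div_lt_iff₀ (by positivity)]
    nlinarith
  have hx : ∀ w ∈ Metric.ball (0 : CSpace n) ε,
      ((p, Real.sqrt δ), w) ∈ Metric.ball ((z₀, (0 : ℝ)), (0 : CSpace n)) ε := fun w hw => by
    rw [← ball_prod_same, ← ball_prod_same]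
    refine ⟨⟨hp, ?_⟩, hw⟩
    rw [mem_ball_zero_iff, Real.norm_eq_abs, abs_of_pos hτ0]
    exact hτε
  refine ⟨expWeight δ⁻¹ K fun ζ => ρ (p, ζ), contDiff_expWeight hf _ _, fun ζ hζ hneg => ⟨?_, ?_⟩,
    fun ζ hζ Y => ?_, fun ζ hζ β γ => ?_⟩
  · exact abs_expWeight_le_one (by positivity) hK0 hneg.le (hζ.le.trans (min_le_left _ _))
  · intro Y
    exact levi_expWeight_nonneg hf (by positivity) (le_max_right _ _) hneg.le Y
      ((h2 _ (hpw ζ (mem_ball_zero_iff.2 hζ))).2 hpS Y)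
  · obtain ⟨w, hw, rfl⟩ := hpol ζ hζ
    have h3 := h1 _ (Metric.ball_subset_ball hεε₁ (hx w hw))
    rw [delPairing_eq (hf.differentiable (by simp) _), leviForm_expWeight_eq hf]
    refine levi_anisotropic hl hρ hR (half_pos hc) hδ ?_ h3.2 h3.1 Y
    filter_upwards [Metric.isOpen_ball.mem_nhds hw] with w' hw'
    exact (h2 _ (hpw w' hw')).1 _
  · obtain ⟨w, hw, rfl⟩ := hpol ζ hζ
    exact mixedDeriv_weight_bound hl hδ Metric.isOpen_ball hw
      (fun w' hw' => (h2 _ (hpw w' hw')).1 _) β γ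
      (hCα β γ _ (Metric.ball_subset_closedBall
        (Metric.ball_subset_ball (min_le_left _ _) (hx w hw))))

end Weights

/-! ### Existence of normal coordinates -/

section Existence

variable {n : ℕ} [NeZero n] {l : ℕ} {r : CSpace n → ℝ} {v z₀ : CSpace n}

/-- Under the hypothesis of constant Levi rank there are adapted data. -/
theorem exists_isAdapted (hl : l < n) (hr : ContDiff ℝ ∞ r)
    (ht : ∀ᶠ z in 𝓝 z₀, fderiv ℝ r z v = 1)
    (hlev : ∀ᶠ z in 𝓝 z₀, (∀ X, delForm r z X = 0 → 0 ≤ (leviL r z X X).re) ∧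
      Module.finrank ℂ (nullSpace r z) = l) :
    ∃ (g : Fin n → CSpace n → CSpace n) (𝓔 : CSpace n → CSpace n →L[ℂ] CSpace n)
      (Ψ : CSpace n × CSpace n → CSpace n), IsAdapted l r v z₀ g 𝓔 Ψ := by
  have hv : delForm r z₀ v ≠ 0 := fun h0 => by
    have := delForm_re r z₀ v
    rw [h0, ht.self_of_nhds] at this
    simp at this
  obtain ⟨f, 𝓔, hf, hff, h𝓔, hlast, hnull, hcomm, hinj⟩ := exists_null_frame hl hr hv hlev
  obtain ⟨g, hg, hg2⟩ := exists_levi_orthonormal hr hv f (midIdx n l) (fun j _ => hf j) hff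
  let ι : (CSpace n →L[ℂ] CSpace n) →L[ℝ] CSpace n →L[ℝ] CSpace n :=
    ContinuousLinearMap.restrictScalarsL ℂ (CSpace n) (CSpace n) ℝ ℝ
  have hE : ContDiff ℝ ∞ fun z => ι (𝓔 z) := ι.contDiff.comp h𝓔
  have hEd : ∀ z a, fderiv ℝ (fun z => ι (𝓔 z)) z a = ι (fderiv ℝ 𝓔 z a) := fun z a => by
    have h1 : HasFDerivAt (fun z => ι (𝓔 z)) (ι ∘L fderiv ℝ 𝓔 z) z :=
      ι.hasFDerivAt.comp z (h𝓔.differentiable (by simp) z).hasFDerivAt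
    rw [h1.fderiv]
    rfl
  obtain ⟨Ψ, hΨ, hΨ0, hΨd⟩ := exists_leaves hE (z₀ := z₀) (by
    filter_upwards [hcomm] with z hz a b
    rw [hEd, hEd]
    exact hz a b)
  refine ⟨g, 𝓔, Ψ, hr, ht, fun j hj => (hg j hj).1, hg2.mono fun p hp => hp.1,
    hg2.mono fun p hp => hp.2, hnull, hlast, hΨ, hΨ0, hΨd, fun ζ hζ => hinj ζ ?_⟩
  rw [← hζ]
  congr 2
  exact Finset.sum_congr rfl fun j hj => by rw [(hg j hj).2]

variable {g : Fin n → CSpace n → CSpace n} {𝓔 : CSpace n → CSpace n →L[ℂ] CSpace n}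
  {Ψ : CSpace n × CSpace n → CSpace n}

theorem IsAdapted.normalMap_zero (h : IsAdapted l r v z₀ g 𝓔 Ψ) (hl : l < n) :
    ∀ᶠ p in 𝓝 z₀, normalMap l r v g Ψ (p, 0) = p := by
  filter_upwards [h.leafPoint_zero] with p hp
  rw [(normalMap_of_eq_last (q := (p, 0)) hl (map_zero _)).2, hp]

theorem IsAdapted.exists_inverse (h : IsAdapted l r v z₀ g 𝓔 Ψ) (hl : l < n) :
    ∃ Φ : CSpace n × CSpace n → CSpace n, SmoothNear Φ (z₀, z₀) ∧
      (∀ᶠ p in 𝓝 z₀, Φ (p, p) = 0) ∧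
      (∀ᶠ x in 𝓝 (z₀, z₀), normalMap l r v g Ψ (x.1, Φ x) = x.2) ∧
      ∀ᶠ q in 𝓝 (z₀, (0 : CSpace n)), Φ (q.1, normalMap l r v g Ψ q) = q.2 := by
  obtain ⟨T, hT, hTX⟩ := h.normalMap_fderiv.self_of_nhds (by simp)
  refine exists_parametrized_inverse h.smoothNear_normalMap (h.normalMap_zero hl) hT
    fun X hX => ?_
  have hv := h.delForm_ne.self_of_nhds
  rw [hTX, h.leafPoint_zero.self_of_nhds] at hX
  set κ := (2 * delForm r z₀ v)⁻¹ with hκ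
  have hκ0 : κ ≠ 0 := inv_ne_zero (mul_ne_zero two_ne_zero hv)
  -- Rescaling the normal coordinate by `κ` reduces to the injectivity in `IsAdapted`.
  set ζ := X + (κ * X 0 - X 0) • (EuclideanSpace.single 0 1 : CSpace n) with hζ
  have hζ0 : ζ 0 = κ * X 0 := by simp [hζ]
  have hζj : ∀ j, j ≠ 0 → ζ j = X j := fun j hj => by simp [hζ, hj]
  have hζl : blockProj (lastIdx n l) ζ = blockProj (lastIdx n l) X := by
    ext j
    rw [blockProj_apply, blockProj_apply]
    split_ifs with hj
    · exact hζj j fun h0 => zero_notMem_lastIdx hl (h0 ▸ hj)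
    · rfl
  have hz : ζ = 0 := h.injective ζ (by
    rw [← h.last z₀ ζ, hζl, h.last z₀ X, hζ0, ← hX]
    have : ∑ j ∈ midIdx n l, ζ j • g j z₀ =
        ∑ j ∈ midIdx n l, X j • tangentField r v (g j z₀) z₀ :=
      Finset.sum_congr rfl fun j hj => by
        rw [hζj j fun h0 => zero_notMem_midIdx (h0 ▸ hj), tangentField,
          h.tangent.self_of_nhds j hj]
        simp
    rw [this]
    abel)
  ext j
  by_cases hj : j = 0
  · subst hj
    have := hζ0
    rw [hz] at this
    simpa [hκ0] using this.symm
  · rw [← hζj j hj, hz]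

end Existence

/-! ### Normal families with plurisubharmonic weights -/

theorem theorem4p1 (n l : ℕ) [NeZero n] (hl : l < n)
    (Ω V : Set (CSpace n)) (z₀ : CSpace n)
    (hΩo : IsOpen Ω) (hΩc : IsConnected Ω) (hΩb : Bornology.IsBounded Ω)
    (hΩp : IsPseudoconvex Ω) (hz₀ : z₀ ∈ frontier Ω)
    (hV : IsOpen V) (hz₀V : z₀ ∈ V)
    (hsmooth : SmoothBoundaryIn Ω V)
    (hrank : ∀ q ∈ frontier Ω ∩ V, HasLeviRank Ω q (n - l - 1)) :
    ∃ (U : Set (CSpace n)) (Φ : CSpace n → CSpace n → CSpace n)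
      (lam : CSpace n → Fin n → ℝ) (ρ : CSpace n → CSpace n → ℝ),
      IsNormalFamily l Ω V z₀ U Φ lam ρ ∧
      ∀ W : Set (CSpace n), IsOpen W → z₀ ∈ W → closure W ⊆ U →
        ∃ a > 0, ∃ b > 0, ∃ C > 0, ∃ Cα : (Fin n → ℕ) → ℝ, ∃ δ₀ > 0,
          ∀ p ∈ frontier Ω ∩ W, ∀ δ : ℝ, 0 < δ → δ < δ₀ →
            ∃ g : CSpace n → ℝ,
              ContDiff ℝ ∞ g ∧
              (∀ ζ ∈ Φ p '' (Ω ∩ U), |g ζ| ≤ 1) ∧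
              PlurisubharmonicOn g (Φ p '' (Ω ∩ U)) ∧
              (∀ ζ ∈ polydisc l δ (a * b) ∩ Φ p '' (Ω ∩ U), ∀ Y : CSpace n,
                (1 / C) * (‖delPairing (ρ p) ζ Y‖ ^ 2 / δ ^ 2
                    + ∑ j ∈ midIdx n l, ‖Y j‖ ^ 2 / δ
                    + ∑ j ∈ lastIdx n l, ‖Y j‖ ^ 2)
                  ≤ (leviForm g ζ Y Y).re) ∧
              (∀ ζ ∈ polydisc l δ (a * b) ∩ Φ p '' (Ω ∩ U), ∀ β γ : Fin n → ℕ,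
                ‖mixedDeriv β γ (toC g) ζ‖ ≤
                  Cα (β + γ) * δ ^ (-(((β + γ) 0 : ℝ)
                    + (1 / 2) * ∑ j ∈ midIdx n l, ((β + γ) j : ℝ)))) := by
  obtain ⟨r, v, hr, hr0, hdef, hrv⟩ := exists_local_defining_function ⟨hz₀, hz₀V⟩ hsmooth
  have hlev := eventually_levi hl hΩo hΩp hV hz₀V hrank hr hr0 hdef hrv
  obtain ⟨g, 𝓔, Ψ, h⟩ := exists_isAdapted hl hr (eventually_fderiv_eq_one hrv hr) hlev
  obtain ⟨ρ, hρ, hsgn, ht, hleaf, hd, hh⟩ := h.exists_normal_form hl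
  -- `λ_j = 1`: the tangential frame is orthonormal for the Levi form.
  obtain ⟨A, hA⟩ := exists_remainder_bound hl hρ ht hleaf hd hh
  obtain ⟨Φ, hΦ, hΦ0, hΘΦ, hΦΘ⟩ := h.exists_inverse hl
  have hnn := eventually_levi_nonneg hΩo hΩp hdef h.smoothNear_normalMap
    (h.normalMap_zero hl).self_of_nhds h.differentiableAt_normalMap hρ
    (hleaf.self_of_nhds (map_zero _)).1 hsgn ht
  obtain ⟨η, hη, a, ha, C, hC, Cα, δ₀, hδ₀, hw⟩ := exists_weights hl hρ hleaf hd hh hnn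
  obtain ⟨ε, ⟨hfam, himg⟩, -, hεη⟩ := ((isNormalFamily_ball hV hz₀V hdef h.smoothNear_normalMap
    h.differentiableAt_normalMap hΦ hΦ0 hΘΦ hΦΘ hρ hsgn ht hA hη).and
      (Ioo_mem_nhdsGT hη)).exists
  -- The constants serve all `p ∈ bΩ ∩ U`, so they do not depend on `W`.
  refine ⟨Metric.ball z₀ ε, _, _, _, hfam, fun W _ _ hWU => ⟨a, ha, 1, one_pos, C, hC, Cα, δ₀, hδ₀,
    fun p hp δ hδ hδ₀ => ?_⟩⟩
  have hpU : p ∈ Metric.ball z₀ ε := hWU (subset_closure hp.2)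
  obtain ⟨G, hG, hpsh, hlower, hbound⟩ :=
    hw p (Metric.ball_subset_ball hεη.le hpU) hp.1 δ hδ hδ₀
  have himg' := himg p ⟨hp.1, hpU⟩
  rw [mul_one]
  refine ⟨G, hG, fun ζ hζ => (hpsh ζ (himg' ζ hζ).2.1 (himg' ζ hζ).2.2).1,
    plurisubharmonicOn_of_levi_nonneg hG fun ζ hζ =>
      (hpsh ζ (himg' ζ hζ).2.1 (himg' ζ hζ).2.2).2,
    fun ζ hζ => hlower ζ hζ.1, fun ζ hζ => hbound ζ hζ.1⟩
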